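/- Let $p,q>0$ and $r$ be real numbers. **Hamiltonian.** For $N$ particles $z_i$ in layer 1 and $M$ particles $w_m$ in layer 2 write $Z=(z,w)$, $\partial_I=Z_I\,\partial/\partial Z_I$, and let $$\Psi(z,w)=\prod_{i<j}(z_i-z_j)^{p/2}\prod_{m<n}(w_m-w_n)^{q/2}\prod_{i,m}(z_i-w_m)^{r}$$ (any local holomorphic branch) be the Halperin state with intra-layer exponents $p/2,q/2$ and inter-layer exponent $r$. The Hamiltonian $\sum_I(\partial_I+\partial_I\ln\Psi)(\partial_I-\partial_I\ln\Psi)$, conjugated by $\Psi$, acts on holomorphic functions as $$\mathcal H=\sum_I\partial_I^2+p\sum_{i<j}\frac{z_i\partial_{z_i}-z_j\partial_{z_j}}{z_i-z_j}+q\sum_{m<n}\frac{w_m\partial_{w_m}-w_n\partial_{w_n}}{w_m-w_n}+2r\sum_{i,m}\frac{z_i\partial_{z_i}-w_m\partial_{w_m}}{z_i-w_m}$$ (with Euler derivatives $\partial_{z_i},\partial_{w_m}$). **Bosonic form.** Let $[a^I_n,a^J_m]=n\,\delta^{IJ}\delta_{n+m,0}$, $I,J\in\{1,2\}$, act on the Fock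 space with $a^I_0=0$ generated from the vacuum, and put $$H_L(p,a)=\sum_{n>0}\Bigl(1-\frac p2\Bigr)n\,a_{-n}a_n+\sqrt p\sum_{n,m>0}\Bigl(a_{-n}a_{-m}a_{n+m}+\tfrac12a_{-n-m}a_na_m\Bigr),$$ $$H_{int}=2r\Bigl(\frac1{\sqrt q}\sum_{n\ge0,m>0}a^1_{-n}a^1_{n-m}a^2_m-\frac1{\sqrt p}\sum_{n,m>0}a^1_{-m}a^2_{-n}a^2_{n+m}\Bigr).$$ The bosonic form of $\mathcal H$ is $$H_L(p,a^1)+H_L(q,a^2)+H_{int}+B_{N,M},$$ where the bilinear background is $$B_{N,M}=\bigl(p(N-\tfrac12)+2rM\bigr)\sum_{n>0} a^1_{-n}a^1_n+q(M-\tfrac12)\sum_{n>0} a^2_{-n}a^2_n+2rN\sqrt{p/q}\,\sum_{n>0} a^1_{-n}a^2_n.$$ "Bosonic form" means the following. There is one expansion, independent of $N,M$, into at most cubic products of creation operators $a^I_{-n}$ ($n>0$) and further modes $a^I_j$ ($j\in\mathbb Z$) such that, for pairwise distinct coordinates with $|w_m|<|z_i|$, the action of $\mathcal H$ on the coherent state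 $\exp\bigl(\sum_{n>0}\frac{\sqrt p}{n}a^1_{-n}\sum_iz_i^n+\frac{\sqrt q}{n}a^2_{-n}\sum_mw_m^n\bigr)$ is multiplication by the value of the expansion at $a^1_j\mapsto\sqrt p\sum_iz_i^j$, $a^2_j\mapsto\sqrt q\sum_mw_m^j$ (the creation operators being commuting variables); and the normal ordered operator of that expansion, with $a^1_0=\sqrt pN$, $a^2_0=\sqrt qM$, is the operator above. Moreover, with $L^1_{-m}=\frac12\sum_{n\in\mathbb Z}a^1_{-n}a^1_{n-m}$, $$H_{int}=r\Bigl(\frac2{\sqrt q}\sum_{m>0}L^1_{-m}a^2_m+\sum_{n,m>0}\Bigl(\frac1{\sqrt q}a^1_{-n}-\frac2{\sqrt p}a^2_{-n}\Bigr)a^1_{-m}a^2_{n+m}\Bigr).$$ **Fermionization.** On the Fock space of two fermions, $\{\psi^I_a,\psi^{J*}_b\}=\delta^{IJ}\delta_{a+b,0}$, $a,b\in\mathbb Z+\frac12$ (all other anticommutators vanish; positive modes annihilate the vacuum), the currents $a^I_n=\sum_{b\in\mathbb Z+1/2}:\psi^I_{n-b}\psi^{I*}_b:$ satisfy the relations above,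 and the bosonic Fock space embeds, with its modes $a^I_n$ acting as these currents and its vacuum going to the vacuum. The two sums of $H_{int}=H^1_{int}+H^2_{int}$ become (sums over half-integers $a,b,c,d,u,\rho$ and integers $m>0$) $$H^1_{int}=\frac{2r}{\sqrt q}\Bigl(\sum_{\substack{a+b+c+d=-m\\a+b\le0}}:\psi^1_a\psi^{1*}_b\psi^1_c\psi^{1*}_d\,\psi^2_{-u}\psi^{2*}_{m+u}:+\sum_{\rho>0}(\rho+\tfrac12):(\psi^1_{-\rho}\psi^{1*}_{\rho-m}+\psi^{1*}_{-\rho}\psi^1_{\rho-m})\,\psi^2_{-u}\psi^{2*}_{m+u}:\Bigr),$$ $$H^2_{int}=-\frac{2r}{\sqrt p}\Bigl(\sum_{\substack{a+b+c+d=m\\a+b<0}}:\psi^2_a\psi^{2*}_b\psi^2_c\psi^{2*}_d\,\psi^1_{-u}\psi^{1*}_{-m+u}:+\sum_{\rho>0}(\rho-\tfrac12):(\psi^2_{-\rho}\psi^{2*}_{\rho+m}+\psi^{2*}_{-\rho}\psi^2_{\rho+m})\,\psi^1_{-u}\psi^{1*}_{-m+u}:\Bigr).$$ **Bi-Jack states.**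 Let $P_\lambda$ be the Jack symmetric function with parameter $\alpha>0$: the Gram–Schmidt orthogonalization of the monomial symmetric functions in lexicographic order for $\langle p_\lambda,p_\mu\rangle=\delta_{\lambda\mu}z_\lambda\alpha^{\ell(\lambda)}$ (it exists and is unique). The bi-Jack state $P_\lambda\otimes P_\mu$ is obtained with $\alpha=2/p$, $p_n\mapsto\frac2{\sqrt p}a^1_{-n}$ in layer 1 and $\alpha=2/q$, $p_n\mapsto\frac2{\sqrt q}a^2_{-n}$ in layer 2. These states form a basis of the Fock space, and $(H_L(p,a^1)+H_L(q,a^2))\,P_\lambda\otimes P_\mu=E_{\lambda,\mu}\,P_\lambda\otimes P_\mu$ with $$E_{\lambda,\mu}=\sum_i\lambda_i^2+\sum_j\mu_j^2-\frac p2\sum_k(\lambda^t_k)^2-\frac q2\sum_l(\mu^t_l)^2 .$$ **Triangularity.** $H_{int}(P_\lambda\otimes P_\mu)$ lies in the span $W_{\lambda,\mu}$ of the states $P_{\lambda'}\otimes P_{\mu'}$ with $|\lambda'|=|\lambda|+k$, $|\mu'|=|\mu|-k$ for some $k>0$. **Eigenstates.** If $E_{\lambda',\mu'}\ne E_{\lambda,\mu}$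 for all these $\lambda',\mu'$, then $E_{\lambda,\mu}-H_L(p,a^1)-H_L(q,a^2)$ is invertible on $W_{\lambda,\mu}$, and, with this inverse, $$\Omega=\frac1{1-\frac1{E_{\lambda,\mu}-H_L(p,a^1)-H_L(q,a^2)}H_{int}}\;P_\lambda\otimes P_\mu$$ (a geometric series that terminates after $|\mu|+1$ terms; $\Omega$ is the only vector in $P_\lambda\otimes P_\mu+W_{\lambda,\mu}$ satisfying $\Omega-(E_{\lambda,\mu}-H_L(p,a^1)-H_L(q,a^2))^{-1}H_{int}\Omega=P_\lambda\otimes P_\mu$) is a nonzero eigenvector of $H_L(p,a^1)+H_L(q,a^2)+H_{int}$ with eigenvalue $E_{\lambda,\mu}$. -/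

import Mathlib

noncomputable section

namespace Halperin

/-! ### The Hamiltonian built from the two-layer ground state

A configuration of `N` particles `z` in layer 1 and `M` particles `w` in layer 2 is a point
`Z : Fin N ⊕ Fin M → ℂ`, with `z i = Z (inl i)` and `w m = Z (inr m)`. -/

/-- The Euler derivative `∂_I = Z_I ∂/∂Z_I`. -/
def euler {ι : Type} [DecidableEq ι] (I : ι) (f : (ι → ℂ) → ℂ) : (ι → ℂ) → ℂ :=
  fun Z => Z I * deriv (fun t => f (Function.update Z I t)) (Z I)

/-- The logarithmic derivative `∂_I ln Ψ`. -/
def logEuler {ι : Type} [DecidableEq ι] (Ψ : (ι → ℂ) → ℂ) (I : ι) : (ι → ℂ) → ℂ :=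
  fun Z => euler I Ψ Z / Ψ Z

/-- `∑_I (∂_I + ∂_I ln Ψ) (∂_I - ∂_I ln Ψ)`, the Hamiltonian with ground state `Ψ`. -/
def groundHam {ι : Type} [Fintype ι] [DecidableEq ι] (Ψ : (ι → ℂ) → ℂ)
    (g : (ι → ℂ) → ℂ) : (ι → ℂ) → ℂ := fun Z =>
  ∑ I, (euler I (fun Y => euler I g Y - logEuler Ψ I Y * g Y) Z
    + logEuler Ψ I Z * (euler I g Z - logEuler Ψ I Z * g Z))

/-- `Ψ⁻¹ ∘ (∑_I (∂_I + ∂_I ln Ψ) (∂_I - ∂_I ln Ψ)) ∘ Ψ`, the Hamiltonian acting on excitations. -/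
def excitationHam {ι : Type} [Fintype ι] [DecidableEq ι] (Ψ : (ι → ℂ) → ℂ)
    (f : (ι → ℂ) → ℂ) : (ι → ℂ) → ℂ := fun Z =>
  (Ψ Z)⁻¹ * groundHam Ψ (fun Y => Ψ Y * f Y) Z

/-- `Ψ` is, on `U`, a branch of the Halperin state
`∏_{i<j} (z_i - z_j)^k ∏_{m<n} (w_m - w_n)^l ∏_{i,m} (z_i - w_m)^r`:
`L I J` is a holomorphic branch of `log (Z_I - Z_J)`. -/
def IsHalperinState {N M : ℕ} (k l r : ℝ) (U : Set (Fin N ⊕ Fin M → ℂ))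
    (Ψ : (Fin N ⊕ Fin M → ℂ) → ℂ) : Prop :=
  ∃ L : Fin N ⊕ Fin M → Fin N ⊕ Fin M → (Fin N ⊕ Fin M → ℂ) → ℂ,
    (∀ I J, I ≠ J → DifferentiableOn ℂ (L I J) U ∧
      ∀ Z ∈ U, Complex.exp (L I J Z) = Z I - Z J) ∧
    ∀ Z ∈ U, Ψ Z = Complex.exp (
      (k : ℂ) * ∑ i : Fin N, ∑ j ∈ Finset.Ioi i, L (.inl i) (.inl j) Z
      + (l : ℂ) * ∑ m : Fin M, ∑ n ∈ Finset.Ioi m, L (.inr m) (.inr n) Z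
      + (r : ℂ) * ∑ i : Fin N, ∑ m : Fin M, L (.inl i) (.inr m) Z)

/-- The explicit two-layer differential operator
`∑_I ∂_I² + p ∑_{i<j} (z_i ∂_{z_i} - z_j ∂_{z_j}) / (z_i - z_j)
  + q ∑_{m<n} (w_m ∂_{w_m} - w_n ∂_{w_n}) / (w_m - w_n)
  + 2 r ∑_{i,m} (z_i ∂_{z_i} - w_m ∂_{w_m}) / (z_i - w_m)` with Euler derivatives `∂`. -/
def diffHam (p q r : ℝ) (N M : ℕ) (f : (Fin N ⊕ Fin M → ℂ) → ℂ) :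
    (Fin N ⊕ Fin M → ℂ) → ℂ := fun Z =>
  ∑ I, euler I (euler I f) Z
  + (p : ℂ) * ∑ i : Fin N, ∑ j ∈ Finset.Ioi i,
      (Z (.inl i) * euler (.inl i) f Z - Z (.inl j) * euler (.inl j) f Z)
        / (Z (.inl i) - Z (.inl j))
  + (q : ℂ) * ∑ m : Fin M, ∑ n ∈ Finset.Ioi m,
      (Z (.inr m) * euler (.inr m) f Z - Z (.inr n) * euler (.inr n) f Z)
        / (Z (.inr m) - Z (.inr n))
  + 2 * (r : ℂ) * ∑ i : Fin N, ∑ m : Fin M,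
      (Z (.inl i) * euler (.inl i) f Z - Z (.inr m) * euler (.inr m) f Z)
        / (Z (.inl i) - Z (.inr m))

/-! ### Bosonic Fock space -/

/-- The Fock space of two free bosons: polynomials in the creation operators
`X (I, n) = a^I_{-n}`, `n > 0`; layer 1 is `I = 0`, layer 2 is `I = 1`. -/
abbrev Fock : Type := MvPolynomial (Fin 2 × ℕ+) ℂ

/-- The mode `a^I_j`, `j ∈ ℤ`, on the Fock space with charges `a^I_0 = κ I`;
`[a^I_j, a^J_k] = j δ^{IJ} δ_{j+k,0}`. -/
def mode (κ : Fin 2 → ℂ) (I : Fin 2) (j : ℤ) : Module.End ℂ Fock :=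
  if 0 < j then (j : ℂ) • (MvPolynomial.pderiv (I, j.natAbs.toPNat')).toLinearMap
  else if j < 0 then LinearMap.mulLeft ℂ (MvPolynomial.X (I, j.natAbs.toPNat'))
  else κ I • LinearMap.id

/-- The modes on the neutral Fock space, where `a^I_0 = 0`. -/
def bose (I : Fin 2) (j : ℤ) (v : Fock) : Fock := mode 0 I j v

section Operators

variable {V : Type} [AddCommGroup V] [Module ℂ V]

/-- The Laughlin Hamiltonian in the modes of layer `I`:
`H_L(p, a) = ∑_{n>0} (1 - p/2) n a_{-n} a_n
  + √p ∑_{n,m>0} (a_{-n} a_{-m} a_{n+m} + ½ a_{-n-m} a_n a_m)`. -/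
def laughlinHam (a : Fin 2 → ℤ → V → V) (p : ℝ) (I : Fin 2) (v : V) : V :=
  (1 - (p : ℂ) / 2) • ∑ᶠ n : ℕ+, (n : ℂ) • a I (-n) (a I n v)
  + ((Real.sqrt p : ℝ) : ℂ) • ∑ᶠ t : ℕ+ × ℕ+,
      (a I (-t.1) (a I (-t.2) (a I (t.1 + t.2) v))
        + (1 / 2 : ℂ) • a I (-t.1 - t.2) (a I t.1 (a I t.2 v)))

/-- `H_int¹ = (2 r / √q) ∑_{n≥0, m>0} a¹_{-n} a¹_{n-m} a²_m`. -/
def int1 (a : Fin 2 → ℤ → V → V) (q r : ℝ) (v : V) : V :=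
  (2 * (r : ℂ) / (Real.sqrt q : ℝ)) •
    ∑ᶠ t : ℕ × ℕ+, a 0 (-t.1) (a 0 (t.1 - t.2) (a 1 t.2 v))

/-- `H_int² = -(2 r / √p) ∑_{n,m>0} a¹_{-m} a²_{-n} a²_{n+m}`. -/
def int2 (a : Fin 2 → ℤ → V → V) (p r : ℝ) (v : V) : V :=
  -((2 * (r : ℂ) / (Real.sqrt p : ℝ)) •
    ∑ᶠ t : ℕ+ × ℕ+, a 0 (-t.2) (a 1 (-t.1) (a 1 (t.1 + t.2) v)))

/-- The inter-layer interaction `H_int = H_int¹ + H_int²`. -/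
def interaction (a : Fin 2 → ℤ → V → V) (p q r : ℝ) (v : V) : V :=
  int1 a q r v + int2 a p r v

/-- The Virasoro mode `L^I_j = ½ ∑_{n ∈ ℤ} a^I_{-n} a^I_{n+j}` for `j ≠ 0`
(the two factors commute, so that no normal ordering is needed). -/
def virasoro (a : Fin 2 → ℤ → V → V) (I : Fin 2) (j : ℤ) (v : V) : V :=
  (1 / 2 : ℂ) • ∑ᶠ n : ℤ, a I (-n) (a I (n + j) v)

end Operators

/-- `H_L(p, a¹) + H_L(q, a²)` on the bosonic Fock space. -/
def freeHam (p q : ℝ) (v : Fock) : Fock := laughlinHam bose p 0 v + laughlinHam bose q 1 v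

/-- `H_L(p, a¹) + H_L(q, a²) + H_int` on the bosonic Fock space. -/
def halperinHam (p q r : ℝ) (v : Fock) : Fock := freeHam p q v + interaction bose p q r v

/-- The bilinear background for `N` and `M` particles:
`(p (N - ½) + 2 r M) ∑ a¹_{-n} a¹_n + q (M - ½) ∑ a²_{-n} a²_n + 2 r N √p / √q ∑ a¹_{-n} a²_n`. -/
def background (p q r : ℝ) (N M : ℕ) (v : Fock) : Fock :=
  ((p : ℂ) * (N - 1 / 2) + 2 * r * M) • ∑ᶠ n : ℕ+, bose 0 (-n) (bose 0 n v)
  + ((q : ℂ) * (M - 1 / 2)) • ∑ᶠ n : ℕ+, bose 1 (-n) (bose 1 n v)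
  + (2 * (r : ℂ) * N * ((Real.sqrt p : ℝ) : ℂ) / ((Real.sqrt q : ℝ) : ℂ)) •
      ∑ᶠ n : ℕ+, bose 0 (-n) (bose 1 n v)

/-! ### From differential operators to bosonic operators -/

/-- The power sums `∑_i z_i^j` (`I = 0`) and `∑_m w_m^j` (`I = 1`), `j ∈ ℤ`. -/
def powerSum {N M : ℕ} (I : Fin 2) (j : ℤ) (Z : Fin N ⊕ Fin M → ℂ) : ℂ :=
  if I = 0 then ∑ i : Fin N, Z (.inl i) ^ j else ∑ m : Fin M, Z (.inr m) ^ j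

/-- The charges `√p`, `√q` of the vertex operators of the two layers. -/
def charge (p q : ℝ) (I : Fin 2) : ℂ :=
  if I = 0 then ((Real.sqrt p : ℝ) : ℂ) else ((Real.sqrt q : ℝ) : ℂ)

/-- The coherent state `∏_i V¹_{√p}^-(z_i) ∏_m V²_{√q}^-(w_m) |0⟩
= exp (∑_{n>0} √p a¹_{-n} p_n(z) / n + ∑_{n>0} √q a²_{-n} p_n(w) / n)`,
as a function of the values `x (I, n)` of the commuting variables `a^I_{-n}`. -/
def coherent (p q : ℝ) {N M : ℕ} (x : Fin 2 × ℕ+ →₀ ℂ) (Z : Fin N ⊕ Fin M → ℂ) : ℂ :=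
  Complex.exp (x.sum fun k c => charge p q k.1 * c * powerSum k.1 (k.2 : ℤ) Z / (k.2 : ℂ))

/-- A term of a bosonic expression: a coefficient, a product of creation operators
`a^I_{-n}`, and a product of further modes `a^I_j`, `j ∈ ℤ`. -/
structure BoseTerm where
  coeff : ℂ
  creators : List (Fin 2 × ℕ+)
  modes : List (Fin 2 × ℤ)

/-- The value of a term on the coherent state, where a creation operator has the value `x (I, n)`
and a mode `a^I_j` has the value `√p ∑_i z_i^j`, resp. `√q ∑_m w_m^j`. -/
def BoseTerm.eval (p q : ℝ) {N M : ℕ} (x : Fin 2 × ℕ+ →₀ ℂ) (Z : Fin N ⊕ Fin M → ℂ)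
    (t : BoseTerm) : ℂ :=
  t.coeff * (t.creators.map fun k => x k).prod
    * (t.modes.map fun k => charge p q k.1 * powerSum k.1 k.2 Z).prod

/-- The normal ordered operator of a term, on the Fock space with charges `κ`. -/
def BoseTerm.op (κ : Fin 2 → ℂ) (t : BoseTerm) : Module.End ℂ Fock :=
  t.coeff • ((t.creators.map fun k => mode κ k.1 (-(k.2 : ℤ))).prod
    * ((t.modes.filter fun k => k.2 ≤ 0).map fun k => mode κ k.1 k.2).prod
    * ((t.modes.filter fun k => 0 < k.2).map fun k => mode κ k.1 k.2).prod)

/-- `H N M` is the bosonic form of the differential operators `D N M` (for all particle numbers):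
there is one expansion into at most cubic terms, independent of `N` and `M`, which gives the
action of `D N M` on coherent states in the region `|w_m| < |z_i|`, once the modes `a^I_j`
take their values `√p ∑_i z_i^j`, `√q ∑_m w_m^j`; and `H N M` is the normal ordered operator of
that expansion on the Fock space with charges `a¹_0 = √p N`, `a²_0 = √q M`. -/
def IsBosonicForm (p q : ℝ)
    (D : ∀ N M : ℕ, ((Fin N ⊕ Fin M → ℂ) → ℂ) → (Fin N ⊕ Fin M → ℂ) → ℂ)
    (H : ℕ → ℕ → Fock → Fock) : Prop :=
  ∃ (ι : Type) (S : ι → BoseTerm),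
    (∀ t, (S t).creators.length + (S t).modes.length ≤ 3) ∧
    ∀ N M : ℕ,
      (∀ Z : Fin N ⊕ Fin M → ℂ, Function.Injective Z →
        (∀ i m, ‖Z (.inr m)‖ < ‖Z (.inl i)‖) → ∀ x : Fin 2 × ℕ+ →₀ ℂ,
        HasSum (fun t => (S t).eval p q x Z)
          (D N M (coherent p q x) Z / coherent p q x Z)) ∧
      ∀ v : Fock,
        (Function.support fun t =>
          (S t).op (fun I => charge p q I * if I = 0 then (N : ℂ) else (M : ℂ)) v).Finite ∧
        H N M v = ∑ᶠ t,
          (S t).op (fun I => charge p q I * if I = 0 then (N : ℂ) else (M : ℂ)) v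

/-! ### Jack states -/

/-- The symmetric polynomial in `N` variables of a polynomial in the power sums `X n = p_n`. -/
def toSymm (N : ℕ) : MvPolynomial ℕ+ ℂ →ₐ[ℂ] MvPolynomial (Fin N) ℂ :=
  MvPolynomial.aeval fun n => MvPolynomial.psum (Fin N) ℂ n

/-- The scalar product `⟨p_λ, p_μ⟩_α = δ_{λμ} z_λ α^{ℓ(λ)}` on symmetric functions. -/
def jackProduct (α : ℂ) (f g : MvPolynomial ℕ+ ℂ) : ℂ :=
  ∑ d ∈ f.support, f.coeff d * g.coeff d * d.prod fun n k => (α * n) ^ k * (k.factorial : ℂ)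

/-- The parts of a partition in decreasing order. -/
def rows {n : ℕ} (lam : n.Partition) : List ℕ := lam.parts.sort (· ≥ ·)

/-- `P` is the Jack symmetric function `P_λ` with parameter `α`, written in power sums: the
Gram-Schmidt orthogonalization of the monomial symmetric functions in lexicographic order,
`P_λ = m_λ + ∑_{μ < λ} c_μ m_μ` with `⟨P_λ, m_μ⟩_α = 0` for all `μ < λ`. -/
def IsJack (α : ℂ) {n : ℕ} (lam : n.Partition) (P : MvPolynomial ℕ+ ℂ) : Prop :=
  (∃ c : n.Partition → ℂ, c lam = 1 ∧ (∀ mu, rows lam < rows mu → c mu = 0) ∧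
    ∀ N, toSymm N P = ∑ mu, c mu • MvPolynomial.msymm (Fin N) ℂ mu) ∧
  ∀ mu : n.Partition, rows mu < rows lam →
    ∀ g, (∀ N, toSymm N g = MvPolynomial.msymm (Fin N) ℂ mu) → jackProduct α P g = 0

/-- The Jack symmetric function `P_λ` with parameter `α`. -/
def jack (α : ℂ) {n : ℕ} (lam : n.Partition) : MvPolynomial ℕ+ ℂ :=
  Classical.epsilon (IsJack α lam)

/-- The Jack state of layer `I`, `P_λ(β = p/2)`: the Jack symmetric function with parameter
`α = 1/β = 2/p`, with `p_n` replaced by the rescaled mode `(2/√p) a^I_{-n}`. -/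
def jackState (p : ℝ) (I : Fin 2) {n : ℕ} (lam : n.Partition) : Fock :=
  MvPolynomial.aeval
    (fun k => (2 / ((Real.sqrt p : ℝ) : ℂ)) • (MvPolynomial.X (I, k) : Fock))
    (jack (2 / (p : ℂ)) lam)

/-- The bi-Jack state `P_λ(p/2) ⊗ P_μ(q/2)`. -/
def biJack (p q : ℝ) {d e : ℕ} (lam : d.Partition) (mu : e.Partition) : Fock :=
  jackState p 0 lam * jackState q 1 mu

/-- `λ^t_k`, the length of the `k`-th column of the diagram of `λ`, `k ≥ 1`. -/
def column {n : ℕ} (lam : n.Partition) (k : ℕ) : ℕ := (lam.parts.filter fun i => k ≤ i).card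

/-- `∑_i λ_i² - (p/2) ∑_k (λ^t_k)²`. -/
def layerEnergy (p : ℝ) {n : ℕ} (lam : n.Partition) : ℝ :=
  (lam.parts.map fun i => (i : ℝ) ^ 2).sum
    - p / 2 * ∑ k ∈ Finset.Icc 1 n, (column lam k : ℝ) ^ 2

/-- `E_{λ,μ} = ∑ λ_i² + ∑ μ_j² - (p/2) ∑ (λ^t_k)² - (q/2) ∑ (μ^t_l)²`. -/
def energy (p q : ℝ) {d e : ℕ} (lam : d.Partition) (mu : e.Partition) : ℝ :=
  layerEnergy p lam + layerEnergy q mu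

/-- The span of the bi-Jack states `P_λ' ⊗ P_μ'` with `|λ'| = d + k` and `|μ'| = e - k` for some
`k > 0`: at least one box has moved from layer 2 to layer 1. -/
def movedSpan (p q : ℝ) (d e : ℕ) : Submodule ℂ Fock :=
  Submodule.span ℂ {f | ∃ k d' e' : ℕ, ∃ (lam' : d'.Partition) (mu' : e'.Partition),
    0 < k ∧ d' = d + k ∧ e' + k = e ∧ f = biJack p q lam' mu'}

/-- The energy of `λ, μ` differs from those of all `λ', μ'` obtained by moving boxes from
layer 2 to layer 1. -/
def NonResonant (p q : ℝ) {d e : ℕ} (lam : d.Partition) (mu : e.Partition) : Prop :=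
  ∀ (k d' e' : ℕ) (lam' : d'.Partition) (mu' : e'.Partition),
    0 < k → d' = d + k → e' + k = e → energy p q lam' mu' ≠ energy p q lam mu

/-- `(E_{λ,μ} - H_L(p) - H_L(q))⁻¹ H_int`, with the inverse taken on `movedSpan`. -/
def dressing (p q r : ℝ) {d e : ℕ} (lam : d.Partition) (mu : e.Partition) (v : Fock) : Fock :=
  Function.invFunOn (fun u => (energy p q lam mu : ℂ) • u - freeHam p q u)
    (movedSpan p q d e : Set Fock) (interaction bose p q r v)

/-- The (finite) geometric series of
`(1 - (E_{λ,μ} - H_L(p) - H_L(q))⁻¹ H_int)⁻¹ (P_λ ⊗ P_μ)`. -/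
def dressedState (p q r : ℝ) {d e : ℕ} (lam : d.Partition) (mu : e.Partition) : Fock :=
  ∑ k ∈ Finset.range (e + 1), (dressing p q r lam mu)^[k] (biJack p q lam mu)

/-! ### Fermions -/

/-- The one-particle creation modes: `(I, false, k)` stands for `ψ^I_{-(k+1/2)}` and
`(I, true, k)` for `ψ^{I*}_{-(k+1/2)}`. -/
abbrev FermiMode : Type := Fin 2 × Bool × ℕ

/-- The fermionic Fock space of both layers: the exterior algebra on the creation modes;
the vacuum is `1`. -/
abbrev Fermi : Type := ExteriorAlgebra ℂ (FermiMode →₀ ℂ)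

/-- A fermion: `(I, false, k)` is `ψ^I_{k+1/2}` and `(I, true, k)` is `ψ^{I*}_{k+1/2}`, `k ∈ ℤ`. -/
abbrev Fermion : Type := Fin 2 × Bool × ℤ

/-- The operator of a fermion. Negative modes create (exterior multiplication), positive modes
annihilate (contraction): `{ψ^I_r, ψ^{J*}_s} = δ^{IJ} δ_{r+s,0}`, and all other anticommutators
vanish. -/
def fermiOp : Fermion → Module.End ℂ Fermi
  | (I, s, Int.negSucc k) =>
      LinearMap.mulLeft ℂ (ExteriorAlgebra.ι ℂ (Finsupp.single ((I, s, k) : FermiMode) (1 : ℂ)))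
  | (I, s, Int.ofNat k) =>
      CliffordAlgebra.contractLeft (Finsupp.lapply ((I, !s, k) : FermiMode))

/-- The number of pairs that normal ordering has to interchange. -/
def inversions : List Fermion → ℕ
  | [] => 0
  | x :: l => (if 0 ≤ x.2.2 then l.countP fun y => y.2.2 < 0 else 0) + inversions l

/-- The normal ordered product `: x₁ x₂ ⋯ :` of fermions. -/
def normalOrdered (l : List Fermion) : Module.End ℂ Fermi :=
  (-1 : ℂ) ^ inversions l •
    (((l.filter fun y => y.2.2 < 0).map fermiOp).prod
      * ((l.filter fun y => 0 ≤ y.2.2).map fermiOp).prod)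

/-- The fermion `ψ^I_{k+1/2}`. -/
def psi (I : Fin 2) (k : ℤ) : Fermion := (I, false, k)

/-- The fermion `ψ^{I*}_{k+1/2}`. -/
def psiStar (I : Fin 2) (k : ℤ) : Fermion := (I, true, k)

/-- The current `a^I_n = ∑_{r ∈ ℤ+1/2} : ψ^I_{n-r} ψ^{I*}_r :`, with `r = k + 1/2`. -/
def current (I : Fin 2) (n : ℤ) (v : Fermi) : Fermi :=
  ∑ᶠ k : ℤ, normalOrdered [psi I (n - k - 1), psiStar I k] v

/-- The fermionic form of `H_int¹`, with half-integers `r = i + ½`, `s = j + ½`, `k = g + ½`,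
`l = h + ½`, `u = b + ½`, `ρ = c + ½`:
`(2 r₀ / √q) (∑_{r+s+k+l = -m < 0, r+s ≤ 0} : ψ¹_r ψ¹*_s ψ¹_k ψ¹*_l ψ²_{-u} ψ²*_{m+u} :
 + ∑_{m, ρ > 0, u} (ρ + ½) : (ψ¹_{-ρ} ψ¹*_{ρ-m} + ψ¹*_{-ρ} ψ¹_{ρ-m}) ψ²_{-u} ψ²*_{m+u} :)`. -/
def fermiInt1 (q r₀ : ℝ) (v : Fermi) : Fermi :=
  (2 * (r₀ : ℂ) / (Real.sqrt q : ℝ)) •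
    ((∑ᶠ (m : ℕ+) (i : ℤ) (j : ℤ) (g : ℤ) (h : ℤ) (b : ℤ)
        (_ : i + j + g + h + 2 = -(m : ℤ)) (_ : i + j + 1 ≤ 0),
      normalOrdered [psi 0 i, psiStar 0 j, psi 0 g, psiStar 0 h,
        psi 1 (-b - 1), psiStar 1 (m + b)] v)
    + ∑ᶠ (m : ℕ+) (c : ℕ) (b : ℤ), ((c : ℂ) + 1) •
        (normalOrdered [psi 0 (-c - 1), psiStar 0 (c - m), psi 1 (-b - 1), psiStar 1 (m + b)] v
        + normalOrdered [psiStar 0 (-c - 1), psi 0 (c - m),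
            psi 1 (-b - 1), psiStar 1 (m + b)] v))

/-- The fermionic form of `H_int²`, with half-integers `r = i + ½`, `s = j + ½`, `k = g + ½`,
`l = h + ½`, `u = b + ½`, `ρ = c + ½`:
`-(2 r₀ / √p) (∑_{r+s+k+l = m > 0, r+s < 0} : ψ²_r ψ²*_s ψ²_k ψ²*_l ψ¹_{-u} ψ¹*_{-m+u} :
 + ∑_{m, ρ > 0, u} (ρ - ½) : (ψ²_{-ρ} ψ²*_{ρ+m} + ψ²*_{-ρ} ψ²_{ρ+m}) ψ¹_{-u} ψ¹*_{-m+u} :)`. -/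
def fermiInt2 (p r₀ : ℝ) (v : Fermi) : Fermi :=
  -((2 * (r₀ : ℂ) / (Real.sqrt p : ℝ)) •
    ((∑ᶠ (m : ℕ+) (i : ℤ) (j : ℤ) (g : ℤ) (h : ℤ) (b : ℤ)
        (_ : i + j + g + h + 2 = (m : ℤ)) (_ : i + j + 1 < 0),
      normalOrdered [psi 1 i, psiStar 1 j, psi 1 g, psiStar 1 h,
        psi 0 (-b - 1), psiStar 0 (-m + b)] v)
    + ∑ᶠ (m : ℕ+) (c : ℕ) (b : ℤ), (c : ℂ) •
        (normalOrdered [psi 1 (-c - 1), psiStar 1 (c + m), psi 0 (-b - 1), psiStar 0 (-m + b)] v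
        + normalOrdered [psiStar 1 (-c - 1), psi 1 (c + m),
            psi 0 (-b - 1), psiStar 0 (-m + b)] v)))

end Halperin

end

noncomputable section

set_option linter.unusedSectionVars false

namespace Halperin

/-! ### The Hamiltonian conjugated by its ground state -/

section Slices

variable {ι : Type} [Fintype ι] [DecidableEq ι]

/-! Hamiltonian. Multiplication by Ψ turns ∂_I - ∂_I ln Ψ into ∂_I, so the conjugated operator is ∑
(∂_I² + 2 (∂_I ln Ψ) ∂_I). The logarithmic derivative of Ψ is a sum over pairs of particles, and
collecting the two contributions of each pair gives the divided differences of `diffHam`.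

Bosonic form. On a coherent state ∂_I is multiplication by a power series in Z_I. Inside a layer,
(u^{n+1} - v^{n+1})/(u - v) is a finite sum of products of powers; between layers z/(z - w) is
expanded in w/z. This gives one list of terms, `formTerm`, which is evaluated on coherent states and
then read as normal ordered operators. The modes a_0 among them produce the background.

Fermions. Every vector is killed by all modes of large index, so each sum has only finitely many
nonzero terms on a given vector; `HasFinsum` carries this finiteness along, and the facts that need
only commutators are proved for any `IsHeisenberg` family, hence both for bosons and for currents.
Wick's theorem for two pairs writes a product of two currents as a four-fermion term plus single
contractions. Counting how often a given contraction occurs yields the weights ρ ± ½. The embedding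
Φ sends a polynomial in the creation operators to the same polynomial in the currents, applied to
the vacuum.

Jack functions. Symmetric functions are polynomials in the power sums. Up to rescaling, the Laughlin
Hamiltonian is `jackHam` with β = p/2. It is self-adjoint for the scalar product with α = 1/β, and
in finitely many variables it becomes ∑ D_i² plus a pair operator that moves boxes from longer rows
to shorter ones (D_i the Euler operators). It is therefore triangular on monomial functions in the
lexicographic order, with the stated energies on the diagonal. Triangularity and self-adjointness
together force the Gram-Schmidt vectors to be eigenvectors (`jackHam_jack`).

Eigenstates. Every term of H_int moves at least one box from layer 2 to layer 1 (`interaction_mem`),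
so G = (E - H_0)⁻¹ H_int, with H_0 the sum of the two Laughlin Hamiltonians, is nilpotent on the
filtration `movedFrom` and the geometric series is finite. From Ω - GΩ = P_λ ⊗ P_μ, applying E - H_0
gives (E - H_0) Ω = H_int Ω. -/

theorem hasDerivAt_update (Z : ι → ℂ) (I : ι) (t : ℂ) :
    HasDerivAt (fun s => Function.update Z I s) (Pi.single I (1 : ℂ)) t := by
  rw [hasDerivAt_pi]
  intro J
  by_cases h : J = I
  · subst h
    simpa using hasDerivAt_id' t
  · simpa [h] using hasDerivAt_const t (Z J)

theorem differentiable_update (Z : ι → ℂ) (I : ι) :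
    Differentiable ℂ fun s => Function.update Z I s :=
  fun t => (hasDerivAt_update Z I t).differentiableAt

theorem isOpen_slice {U : Set (ι → ℂ)} (hU : IsOpen U) (Z : ι → ℂ) (I : ι) :
    IsOpen {t : ℂ | Function.update Z I t ∈ U} :=
  hU.preimage (differentiable_update Z I).continuous

theorem differentiableOn_slice {U : Set (ι → ℂ)} {f : (ι → ℂ) → ℂ}
    (hf : DifferentiableOn ℂ f U) (Z : ι → ℂ) (I : ι) :
    DifferentiableOn ℂ (fun t => f (Function.update Z I t)) {t : ℂ | Function.update Z I t ∈ U} :=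
  hf.comp (differentiable_update Z I).differentiableOn fun _ ht => ht

theorem differentiableAt_slice {U : Set (ι → ℂ)} (hU : IsOpen U) {f : (ι → ℂ) → ℂ}
    (hf : DifferentiableOn ℂ f U) {Z : ι → ℂ} (hZ : Z ∈ U) (I : ι) :
    DifferentiableAt ℂ (fun t => f (Function.update Z I t)) (Z I) :=
  (differentiableOn_slice hf Z I).differentiableAt
    ((isOpen_slice hU Z I).mem_nhds (by simpa using hZ))

theorem eventually_slice {U : Set (ι → ℂ)} (hU : IsOpen U) {Z : ι → ℂ} (hZ : Z ∈ U) (I : ι) :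
    ∀ᶠ t in nhds (Z I), Function.update Z I t ∈ U :=
  (isOpen_slice hU Z I).mem_nhds (by simpa using hZ)

theorem euler_congr {U : Set (ι → ℂ)} (hU : IsOpen U) {f g : (ι → ℂ) → ℂ}
    (h : ∀ Z ∈ U, f Z = g Z) {Z : ι → ℂ} (hZ : Z ∈ U) (I : ι) : euler I f Z = euler I g Z := by
  unfold euler
  congr 1
  exact Filter.EventuallyEq.deriv_eq ((eventually_slice hU hZ I).mono fun t ht => h _ ht)

theorem euler_mul {f g : (ι → ℂ) → ℂ} {Z : ι → ℂ} (I : ι)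
    (hf : DifferentiableAt ℂ (fun t => f (Function.update Z I t)) (Z I))
    (hg : DifferentiableAt ℂ (fun t => g (Function.update Z I t)) (Z I)) :
    euler I (fun Y => f Y * g Y) Z = euler I f Z * g Z + f Z * euler I g Z := by
  unfold euler
  rw [deriv_fun_mul hf hg]
  simp only [Function.update_eq_self]
  ring

theorem differentiableAt_slice_euler {U : Set (ι → ℂ)} (hU : IsOpen U) {f : (ι → ℂ) → ℂ}
    (hf : DifferentiableOn ℂ f U) {Z : ι → ℂ} (hZ : Z ∈ U) (I : ι) :
    DifferentiableAt ℂ (fun t => euler I f (Function.update Z I t)) (Z I) := by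
  have h1 := (differentiableOn_slice hf Z I).deriv (isOpen_slice hU Z I)
  have h2 := h1.differentiableAt ((isOpen_slice hU Z I).mem_nhds (x := Z I) (by simpa using hZ))
  have h3 : (fun t => euler I f (Function.update Z I t)) =
      fun t => t * deriv (fun s => f (Function.update Z I s)) t := by
    funext t
    simp [euler]
  rw [h3]
  exact differentiableAt_id.mul h2

/-- Conjugation: (∂_I - ∂_I ln Ψ)(Ψ f) = Ψ ∂_I f, and then (∂_I + ∂_I ln Ψ)(Ψ g) = Ψ (∂_I g + 2 (∂_I
ln Ψ) g). The first identity is needed on all of U, not only at Z, because it is differentiated once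
more. -/
theorem excitationHam_eq {U : Set (ι → ℂ)} (hU : IsOpen U) {Ψ f : (ι → ℂ) → ℂ}
    (hΨ : DifferentiableOn ℂ Ψ U) (h0 : ∀ Z ∈ U, Ψ Z ≠ 0) (hf : DifferentiableOn ℂ f U)
    {Z : ι → ℂ} (hZ : Z ∈ U) :
    excitationHam Ψ f Z = ∑ I, (euler I (euler I f) Z + 2 * logEuler Ψ I Z * euler I f Z) := by
  have key : ∀ I, ∀ Y ∈ U, euler I (fun Y => Ψ Y * f Y) Y - logEuler Ψ I Y * (Ψ Y * f Y)
      = Ψ Y * euler I f Y := by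
    intro I Y hY
    rw [euler_mul I (differentiableAt_slice hU hΨ hY I) (differentiableAt_slice hU hf hY I),
      logEuler]
    have := h0 Y hY
    field_simp
    ring
  unfold excitationHam groundHam
  rw [Finset.mul_sum]
  refine Finset.sum_congr rfl fun I _ => ?_
  rw [euler_congr hU (key I) hZ I, key I Z hZ,
    euler_mul I (differentiableAt_slice hU hΨ hZ I) (differentiableAt_slice_euler hU hf hZ I),
    logEuler]
  have := h0 Z hZ
  field_simp
  ring

end Slices

/-- Differentiating exp L = Z_I - Z_J along the coordinate K and comparing the two derivatives
determines L', so no particular branch of the logarithm is involved. The differences of `Pi.single`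
cover at once the cases K = I, K = J and K different from both. -/
theorem hasDerivAt_logBranch {ι : Type} [Fintype ι] [DecidableEq ι] {U : Set (ι → ℂ)}
    (hU : IsOpen U) {L : (ι → ℂ) → ℂ} {I J : ι} (hL : DifferentiableOn ℂ L U)
    (hexp : ∀ Z ∈ U, Complex.exp (L Z) = Z I - Z J) {Z : ι → ℂ} (hZ : Z ∈ U) (K : ι) :
    HasDerivAt (fun t => L (Function.update Z K t))
      (((Pi.single K (1 : ℂ) : ι → ℂ) I - (Pi.single K (1 : ℂ) : ι → ℂ) J) / (Z I - Z J)) (Z K) := by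
  have h1 := (differentiableAt_slice hU hL hZ K).hasDerivAt
  have h2 := h1.cexp
  have h3 : HasDerivAt (fun t => Function.update Z K t I - Function.update Z K t J)
      ((Pi.single K (1 : ℂ) : ι → ℂ) I - (Pi.single K (1 : ℂ) : ι → ℂ) J) (Z K) :=
    ((hasDerivAt_pi.1 (hasDerivAt_update Z K (Z K))) I).sub
      ((hasDerivAt_pi.1 (hasDerivAt_update Z K (Z K))) J)
  have h4 := h2.congr_of_eventuallyEq
    (f₁ := fun t => Function.update Z K t I - Function.update Z K t J)
    ((eventually_slice hU hZ K).mono fun t ht => (hexp _ ht).symm)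
  have h5 := h3.unique h4
  simp only [Function.update_eq_self] at h5
  rw [hexp Z hZ] at h5
  have h0 : Z I - Z J ≠ 0 := by
    rw [← hexp Z hZ]; exact Complex.exp_ne_zero _
  rw [h5, mul_div_cancel_left₀ _ h0]
  exact h1

theorem logEuler_halperin {N M : ℕ} {k l r : ℝ} {U : Set (Fin N ⊕ Fin M → ℂ)}
    {Ψ : (Fin N ⊕ Fin M → ℂ) → ℂ} (hU : IsOpen U) (h : IsHalperinState k l r U Ψ) :
    DifferentiableOn ℂ Ψ U ∧ (∀ Z ∈ U, Ψ Z ≠ 0) ∧ ∀ Z ∈ U, ∀ K, logEuler Ψ K Z = Z K * (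
      (k : ℂ) * ∑ i : Fin N, ∑ j ∈ Finset.Ioi i,
        ((Pi.single K (1 : ℂ) : Fin N ⊕ Fin M → ℂ) (.inl i)
          - (Pi.single K (1 : ℂ) : Fin N ⊕ Fin M → ℂ) (.inl j)) / (Z (.inl i) - Z (.inl j))
      + (l : ℂ) * ∑ m : Fin M, ∑ n ∈ Finset.Ioi m,
        ((Pi.single K (1 : ℂ) : Fin N ⊕ Fin M → ℂ) (.inr m)
          - (Pi.single K (1 : ℂ) : Fin N ⊕ Fin M → ℂ) (.inr n)) / (Z (.inr m) - Z (.inr n))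
      + (r : ℂ) * ∑ i : Fin N, ∑ m : Fin M,
        ((Pi.single K (1 : ℂ) : Fin N ⊕ Fin M → ℂ) (.inl i)
          - (Pi.single K (1 : ℂ) : Fin N ⊕ Fin M → ℂ) (.inr m)) / (Z (.inl i) - Z (.inr m))) := by
  obtain ⟨L, hL, hΨ⟩ := h
  have hne : ∀ Z ∈ U, Ψ Z ≠ 0 := fun Z hZ => by
    rw [hΨ Z hZ]; exact Complex.exp_ne_zero _
  refine ⟨?_, hne, ?_⟩
  · refine DifferentiableOn.congr (DifferentiableOn.cexp ?_) hΨ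
    refine ((DifferentiableOn.const_mul ?_ _).add (DifferentiableOn.const_mul ?_ _)).add
      (DifferentiableOn.const_mul ?_ _)
    · refine DifferentiableOn.fun_sum fun i _ => DifferentiableOn.fun_sum fun j hj => (hL _ _ ?_).1
      simpa using (Finset.mem_Ioi.1 hj).ne
    · refine DifferentiableOn.fun_sum fun i _ => DifferentiableOn.fun_sum fun j hj => (hL _ _ ?_).1
      simpa using (Finset.mem_Ioi.1 hj).ne
    · exact DifferentiableOn.fun_sum fun i _ => DifferentiableOn.fun_sum fun j _ =>
        (hL _ _ (by simp)).1
  · intro Z hZ K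
    have hd : ∀ I J, I ≠ J → HasDerivAt (fun t => L I J (Function.update Z K t))
        (((Pi.single K (1 : ℂ) : Fin N ⊕ Fin M → ℂ) I
          - (Pi.single K (1 : ℂ) : Fin N ⊕ Fin M → ℂ) J) / (Z I - Z J)) (Z K) :=
      fun I J hIJ => hasDerivAt_logBranch hU (hL I J hIJ).1 (hL I J hIJ).2 hZ K
    have hS := ((((HasDerivAt.fun_sum (u := Finset.univ) fun i (_ : i ∈ Finset.univ) =>
        HasDerivAt.fun_sum (u := Finset.Ioi i) fun j hj =>
          hd (.inl i) (.inl j) (by simpa using (Finset.mem_Ioi.1 hj).ne)).const_mul (k : ℂ)).add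
      ((HasDerivAt.fun_sum (u := Finset.univ) fun m (_ : m ∈ Finset.univ) =>
        HasDerivAt.fun_sum (u := Finset.Ioi m) fun n hn =>
          hd (.inr m) (.inr n) (by simpa using (Finset.mem_Ioi.1 hn).ne)).const_mul (l : ℂ))).add
      ((HasDerivAt.fun_sum (u := Finset.univ) fun i (_ : i ∈ Finset.univ) =>
        HasDerivAt.fun_sum (u := Finset.univ) fun m (_ : m ∈ Finset.univ) =>
          hd (.inl i) (.inr m) (by simp)).const_mul (r : ℂ))).cexp
    have hΨ' := hS.congr_of_eventuallyEq (f₁ := fun t => Ψ (Function.update Z K t))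
      ((eventually_slice hU hZ K).mono fun t ht => hΨ _ ht)
    unfold logEuler euler
    rw [hΨ'.deriv]
    simp only [Pi.add_apply, Function.update_eq_self]
    rw [← hΨ Z hZ, div_eq_iff (hne Z hZ)]
    ring

theorem sum_single_mul {ι : Type} [Fintype ι] [DecidableEq ι] (I : ι) (F : ι → ℂ) :
    ∑ K, (Pi.single K (1 : ℂ) : ι → ℂ) I * F K = F I := by
  simp [Pi.single_apply]

theorem excitationHam_halperin {N M : ℕ} {p q r : ℝ} {U : Set (Fin N ⊕ Fin M → ℂ)}
    {Ψ f : (Fin N ⊕ Fin M → ℂ) → ℂ} (hU : IsOpen U)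
    (h : IsHalperinState (p / 2) (q / 2) r U Ψ) (hf : DifferentiableOn ℂ f U)
    {Z : Fin N ⊕ Fin M → ℂ} (hZ : Z ∈ U) :
    excitationHam Ψ f Z = diffHam p q r N M f Z := by
  obtain ⟨hΨ, h0, hlog⟩ := logEuler_halperin hU h
  rw [excitationHam_eq hU hΨ h0 hf hZ, Finset.sum_add_distrib, diffHam]
  -- For a fixed pair only K = I and K = J contribute, with opposite signs; this is what produces
  -- the numerator of the divided difference.
  have pair : ∀ I J, ∑ K, ((Pi.single K (1 : ℂ) : Fin N ⊕ Fin M → ℂ) I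
      - (Pi.single K (1 : ℂ) : Fin N ⊕ Fin M → ℂ) J) / (Z I - Z J) * (Z K * euler K f Z)
      = (Z I * euler I f Z - Z J * euler J f Z) / (Z I - Z J) := by
    intro I J
    rw [← sum_single_mul I (fun K => Z K * euler K f Z),
      ← sum_single_mul J (fun K => Z K * euler K f Z), ← Finset.sum_sub_distrib, Finset.sum_div]
    exact Finset.sum_congr rfl fun K _ => by ring
  have swap : ∀ {α β : Type} [Fintype α] (s : α → Finset β) (u : α → Fin N ⊕ Fin M)
      (w : β → Fin N ⊕ Fin M), ∑ K, (∑ i, ∑ j ∈ s i,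
        ((Pi.single K (1 : ℂ) : Fin N ⊕ Fin M → ℂ) (u i)
          - (Pi.single K (1 : ℂ) : Fin N ⊕ Fin M → ℂ) (w j)) / (Z (u i) - Z (w j)))
          * (Z K * euler K f Z)
      = ∑ i, ∑ j ∈ s i, (Z (u i) * euler (u i) f Z - Z (w j) * euler (w j) f Z)
          / (Z (u i) - Z (w j)) := by
    intro α β _ s u w
    simp_rw [Finset.sum_mul]
    rw [Finset.sum_comm]
    refine Finset.sum_congr rfl fun i _ => ?_
    rw [Finset.sum_comm]
    exact Finset.sum_congr rfl fun j _ => pair _ _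
  rw [add_assoc, add_assoc, ← swap (fun i => Finset.Ioi i) Sum.inl Sum.inl,
    ← swap (fun i => Finset.Ioi i) Sum.inr Sum.inr, ← swap (fun _ => Finset.univ) Sum.inl Sum.inr]
  congr 1
  rw [Finset.mul_sum, Finset.mul_sum, Finset.mul_sum, ← Finset.sum_add_distrib, ← Finset.sum_add_distrib]
  refine Finset.sum_congr rfl fun K _ => ?_
  rw [hlog Z hZ]
  push_cast
  ring

end Halperin

namespace Halperin

/-! ### Sums with finite support -/

/-- The family `f` has finite support and sum `s`. -/
def HasFinsum {α V : Type*} [AddCommMonoid V] (f : α → V) (s : V) : Prop :=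
  (Function.support f).Finite ∧ ∑ᶠ a, f a = s

namespace HasFinsum

variable {α β V W : Type*} [AddCommGroup V] [AddCommGroup W]

theorem eq {f : α → V} {s : V} (h : HasFinsum f s) : ∑ᶠ a, f a = s := h.2

theorem of_finite {f : α → V} (h : (Function.support f).Finite) : HasFinsum f (∑ᶠ a, f a) :=
  ⟨h, rfl⟩

theorem of_subset {f : α → V} {A : Set α} (hA : A.Finite) (h : ∀ a ∉ A, f a = 0) :
    HasFinsum f (∑ᶠ a, f a) :=
  of_finite (hA.subset fun a ha => by_contra fun h' => ha (h a h'))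

theorem self {f : α → V} {s : V} (h : HasFinsum f s) : HasFinsum f (∑ᶠ a, f a) := ⟨h.1, rfl⟩

theorem unique {f : α → V} {s t : V} (h : HasFinsum f s) (h' : HasFinsum f t) : s = t :=
  h.2.symm.trans h'.2

theorem of_eq {f : α → V} {s t : V} (h : HasFinsum f s) (hst : s = t) : HasFinsum f t := hst ▸ h

theorem congr {f g : α → V} {s : V} (h : HasFinsum f s) (hfg : ∀ a, g a = f a) :
    HasFinsum g s := by
  rwa [funext hfg]

theorem zero : HasFinsum (fun _ : α => (0 : V)) 0 := ⟨by simp, finsum_zero⟩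

theorem add {f g : α → V} {s t : V} (hf : HasFinsum f s) (hg : HasFinsum g t) :
    HasFinsum (fun a => f a + g a) (s + t) :=
  ⟨(hf.1.union hg.1).subset (Function.support_add _ _), by
    rw [finsum_add_distrib hf.1 hg.1, hf.2, hg.2]⟩

theorem sub {f g : α → V} {s t : V} (hf : HasFinsum f s) (hg : HasFinsum g t) :
    HasFinsum (fun a => f a - g a) (s - t) :=
  ⟨(hf.1.union hg.1).subset (Function.support_sub _ _), by
    rw [finsum_sub_distrib hf.1 hg.1, hf.2, hg.2]⟩

theorem map {F : Type*} [FunLike F V W] [AddMonoidHomClass F V W] {f : α → V} {s : V}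
    (hf : HasFinsum f s) (L : F) : HasFinsum (fun a => L (f a)) (L s) :=
  ⟨hf.1.subset fun a ha h => ha (by simp [h]), by rw [← hf.2, map_finsum L hf.1]⟩

theorem smul [Module ℂ V] {f : α → V} {s : V} (hf : HasFinsum f s) (c : ℂ) :
    HasFinsum (fun a => c • f a) (c • s) :=
  hf.map (LinearMap.lsmul ℂ V c)

/-- The general change of summation variables. It is an equivalence because vanishing off the range
makes the supports, and not only the sums, correspond. -/
theorem of_injective {f : β → V} {s : V} {g : α → β} (hg : Function.Injective g)
    (h0 : ∀ b, b ∉ Set.range g → f b = 0) : HasFinsum (fun a => f (g a)) s ↔ HasFinsum f s := by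
  have hsub : Function.support f ⊆ Set.range g := fun b hb => by_contra fun h => hb (h0 b h)
  have h1 : (Function.support fun a => f (g a)) = g ⁻¹' Function.support f := rfl
  have h2 : ∑ᶠ a, f (g a) = ∑ᶠ b, f b := by
    rw [← finsum_mem_range hg, ← finsum_mem_inter_support, Set.inter_eq_right.2 hsub,
      finsum_mem_support]
  unfold HasFinsum
  rw [h1, h2]
  exact and_congr_left' ⟨fun h =>
    Set.image_preimage_eq_of_subset hsub ▸ h.image g, fun h => h.preimage hg.injOn⟩

theorem of_equiv {f : β → V} {s : V} (e : α ≃ β) :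
    HasFinsum (fun a => f (e a)) s ↔ HasFinsum f s :=
  of_injective e.injective fun b hb => absurd (e.surjective b) hb

theorem comp_injective {f : β → V} {s : V} {g : α → β} (hg : Function.Injective g)
    (h : HasFinsum f s) : HasFinsum (fun a => f (g a)) (∑ᶠ a, f (g a)) :=
  of_finite (h.1.preimage hg.injOn)

theorem finset (A : Finset α) {f : α → V} (h : ∀ a ∉ A, f a = 0) :
    HasFinsum f (∑ a ∈ A, f a) := by
  have hs : Function.support f ⊆ A := fun a ha => by_contra fun h' => ha (h a h')
  exact ⟨A.finite_toSet.subset hs, finsum_eq_finsetSum_of_support_subset f hs⟩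

theorem single (a : α) {f : α → V} (h : ∀ b, b ≠ a → f b = 0) : HasFinsum f (f a) := by
  simpa using finset {a} (f := f) (by simpa using h)

theorem fintype [Fintype α] (f : α → V) : HasFinsum f (∑ a, f a) :=
  finset Finset.univ (by simp)

theorem finset_sum {f : β → α → V} {s : β → V} (A : Finset β)
    (h : ∀ b ∈ A, HasFinsum (f b) (s b)) :
    HasFinsum (fun a => ∑ b ∈ A, f b a) (∑ b ∈ A, s b) := by
  classical
  induction A using Finset.induction_on with
  | empty => simpa using zero
  | insert b A hb ih =>
    simp only [Finset.sum_insert hb]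
    exact (h b (by simp)).add (ih fun c hc => h c (by simp [hc]))

theorem exists_finset {f : α → V} {s : V} (h : HasFinsum f s) :
    ∃ A : Finset α, (∀ a ∉ A, f a = 0) ∧ ∑ a ∈ A, f a = s :=
  ⟨h.1.toFinset, fun a ha => by simpa using ha, (finsum_eq_sum f h.1).symm.trans h.2⟩

theorem sum {f : α ⊕ β → V} {s t : V} (hf : HasFinsum (fun a => f (.inl a)) s)
    (hg : HasFinsum (fun b => f (.inr b)) t) : HasFinsum f (s + t) := by
  obtain ⟨A, hA, rfl⟩ := hf.exists_finset
  obtain ⟨B, hB, rfl⟩ := hg.exists_finset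
  rw [← Finset.sum_disjSum A B f]
  refine finset _ ?_
  rintro (a | b) h
  · exact hA a (by simpa using h)
  · exact hB b (by simpa using h)

theorem fiber {f : α × β → V} {s : V} (h : HasFinsum f s) (a : α) :
    HasFinsum (fun b => f (a, b)) (∑ᶠ b, f (a, b)) :=
  h.comp_injective (Prod.mk_right_injective a)

theorem curry {f : α × β → V} {s : V} (h : HasFinsum f s) :
    HasFinsum (fun a => ∑ᶠ b, f (a, b)) s := by
  refine ⟨(h.1.image Prod.fst).subset fun a ha => ?_, ?_⟩
  · obtain ⟨b, hb⟩ : ∃ b, f (a, b) ≠ 0 := by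
      by_contra! h'
      exact ha (by simp [h'])
    exact ⟨(a, b), hb, rfl⟩
  · rw [← h.2, finsum_curry f h.1]

/-- Finiteness in the outer variable has to be a separate hypothesis: nonzero fibres can have sum
zero, so the function g of fibre sums does not control the support of f. -/
theorem uncurry {f : α × β → V} {g : α → V} {A : Set α} (hA : A.Finite)
    (h0 : ∀ a ∉ A, ∀ b, f (a, b) = 0) (h : ∀ a, HasFinsum (fun b => f (a, b)) (g a)) :
    HasFinsum f (∑ᶠ a, g a) := by
  have hf : (Function.support f).Finite := by
    refine (hA.biUnion fun a _ => (h a).1.image (Prod.mk a)).subset fun ⟨a, b⟩ hab => ?_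
    simp only [Set.mem_iUnion]
    exact ⟨a, by_contra fun ha => hab (h0 a ha b), b, hab, rfl⟩
  refine ⟨hf, ?_⟩
  rw [finsum_curry f hf]
  exact finsum_congr fun a => (h a).2

theorem nat_add {f : ℕ → V} {s : V} (h : HasFinsum f s) (m : ℕ) :
    s = ∑ n ∈ Finset.range m, f n + ∑ᶠ n, f (n + m) := by
  obtain ⟨A, hA, rfl⟩ := h.exists_finset
  obtain ⟨K, hK⟩ : ∃ K, ∀ n, K ≤ n → n ∉ A := by
    refine ⟨A.sup id + 1, fun n hn hnA => ?_⟩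
    have := Finset.le_sup (f := id) hnA
    simp at this; omega
  rw [h.unique (finset (Finset.range (m + K)) fun n hn => hA n (hK n (by simp at hn; omega))),
    Finset.sum_range_add, (finset (Finset.range K) (f := fun n => f (n + m)) fun n hn =>
      hA _ (hK _ (by simp at hn; omega))).eq]
  simp [add_comm]

theorem int_split {f : ℤ → V} {s : V} (h : HasFinsum f s) :
    s = ∑ᶠ n : ℕ, f n + ∑ᶠ n : ℕ, f (-(n + 1 : ℕ)) := by
  have h1 := (of_equiv (f := f) Equiv.intEquivNatSumNat.symm).2 h
  have hl := h1.comp_injective Sum.inl_injective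
  have hr := h1.comp_injective Sum.inr_injective
  rw [h1.unique (hl.sum hr)]
  rfl

end HasFinsum

end Halperin

namespace Halperin

/-! ### Representations of the Heisenberg algebra -/

/-- The operators `A I n` satisfy the relations of the modes of two free bosons, and every vector
is annihilated by the modes of large index. -/
structure IsHeisenberg {V : Type} [AddCommGroup V] [Module ℂ V]
    (A : Fin 2 → ℤ → Module.End ℂ V) : Prop where
  comm : ∀ (I J : Fin 2) (n m : ℤ) (v : V), A I n (A J m v) - A J m (A I n v)
    = if I = J ∧ n + m = 0 then (n : ℂ) • v else 0
  nil : ∀ v, ∃ K : ℕ, ∀ I, ∀ n : ℤ, K ≤ n → A I n v = 0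

namespace IsHeisenberg

variable {V : Type} [AddCommGroup V] [Module ℂ V] {A : Fin 2 → ℤ → Module.End ℂ V}

theorem swap (h : IsHeisenberg A) {I J : Fin 2} {n m : ℤ} (hne : ¬(I = J ∧ n + m = 0)) (v : V) :
    A I n (A J m v) = A J m (A I n v) := by
  have := h.comm I J n m v
  rwa [if_neg hne, sub_eq_zero] at this

theorem finsum_number (h : IsHeisenberg A) (I J : Fin 2) (v : V) :
    HasFinsum (fun n : ℕ+ => A I (-n) (A J n v)) (∑ᶠ n : ℕ+, A I (-n) (A J n v)) := by
  obtain ⟨K, hK⟩ := h.nil v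
  refine HasFinsum.of_subset (A := {n : ℕ+ | (n : ℕ) ≤ K}) ?_ fun n hn => ?_
  · exact (Set.finite_Iic K).preimage PNat.coe_injective.injOn
  · rw [hK, map_zero]
    simp at hn
    omega

theorem finsum_pair {W : Type*} [AddCommGroup W] {F : ℕ+ × ℕ+ → W} (K : ℕ)
    (hF : ∀ t, K ≤ (t.1 : ℕ) + t.2 → F t = 0) : HasFinsum F (∑ᶠ t, F t) := by
  refine HasFinsum.of_subset (A := {t : ℕ+ × ℕ+ | (t.1 : ℕ) ≤ K ∧ (t.2 : ℕ) ≤ K}) ?_ fun n hn => ?_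
  · refine (((Set.finite_Iic K).prod (Set.finite_Iic K)).preimage
      (f := fun t : ℕ+ × ℕ+ => ((t.1 : ℕ), (t.2 : ℕ))) ?_)
    rintro ⟨a, b⟩ _ ⟨c, d⟩ _ h
    simpa using h
  · refine hF _ ?_
    simp at hn
    by_contra hlt
    have := hn (by omega)
    omega

theorem finsum_split (h : IsHeisenberg A) (I J L : Fin 2) (v : V) :
    HasFinsum (fun t : ℕ+ × ℕ+ => A I (-t.1) (A J (-t.2) (A L (t.1 + t.2) v)))
      (∑ᶠ t : ℕ+ × ℕ+, A I (-t.1) (A J (-t.2) (A L (t.1 + t.2) v))) := by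
  obtain ⟨K, hK⟩ := h.nil v
  refine finsum_pair K fun t ht => ?_
  rw [hK L _ (by exact_mod_cast ht), map_zero, map_zero]

theorem finsum_merge (h : IsHeisenberg A) (I J L : Fin 2) (v : V) :
    HasFinsum (fun t : ℕ+ × ℕ+ => A I (-t.1 - t.2) (A J t.1 (A L t.2 v)))
      (∑ᶠ t : ℕ+ × ℕ+, A I (-t.1 - t.2) (A J t.1 (A L t.2 v))) := by
  obtain ⟨K, hK⟩ := h.nil v
  -- If the two indices add up to at least 2K, one of them is at least K. Both are positive, so the
  -- two modes commute and whichever is large can act first.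
  refine finsum_pair (2 * K) fun t ht => ?_
  by_cases h2 : (K : ℤ) ≤ t.2
  · rw [hK L _ h2, map_zero, map_zero]
  · rw [h.swap (I := J) (J := L) (fun h' => by have := t.1.pos; have := t.2.pos; omega),
      hK J _ (by omega), map_zero, map_zero]

theorem finsum_shift (h : IsHeisenberg A) (I : Fin 2) (k : ℤ) (w : V) :
    HasFinsum (fun n : ℕ => A I (-n) (A I (n + k) w)) (∑ᶠ n : ℕ, A I (-n) (A I (n + k) w)) := by
  obtain ⟨K, hK⟩ := h.nil w
  refine HasFinsum.of_subset (Set.finite_Iic (K + k.natAbs)) fun n hn => ?_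
  rw [hK, map_zero]
  simp at hn
  omega

/-- For large positive n the right factor kills w; for large negative n the left one does after the
factors trade places, which k ≠ 0 allows. -/
theorem finsum_virasoro (h : IsHeisenberg A) (I : Fin 2) {k : ℤ} (hk : k ≠ 0) (w : V) :
    HasFinsum (fun n : ℤ => A I (-n) (A I (n + k) w)) (∑ᶠ n : ℤ, A I (-n) (A I (n + k) w)) := by
  obtain ⟨K, hK⟩ := h.nil w
  refine HasFinsum.of_subset (Set.finite_Icc (-(K : ℤ)) (K + k.natAbs)) fun n hn => ?_
  by_cases h1 : (K : ℤ) ≤ n + k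
  · rw [hK _ _ h1, map_zero]
  · rw [h.swap (by omega), hK I, map_zero]
    have hn' : ¬(-(K : ℤ) ≤ n ∧ n ≤ K + k.natAbs) := hn
    omega

theorem finsum_int1 (h : IsHeisenberg A) (v : V) :
    HasFinsum (fun t : ℕ+ × ℕ => A 0 (-t.2) (A 0 (t.2 - t.1) (A 1 t.1 v)))
      (∑ᶠ m : ℕ+, ∑ᶠ n : ℕ, A 0 (-n) (A 0 (n + (-m)) (A 1 m v))) := by
  obtain ⟨K, hK⟩ := h.nil v
  refine HasFinsum.uncurry (A := {n : ℕ+ | (n : ℕ) ≤ K}) ?_ (fun n hn k => ?_) fun m => ?_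
  · exact (Set.finite_Iic K).preimage PNat.coe_injective.injOn
  · dsimp only
    rw [hK, map_zero, map_zero]
    simp at hn
    omega
  · exact (h.finsum_shift 0 (-m) (A 1 m v)).congr fun n => by rw [← sub_eq_add_neg]

theorem finsum_int1' (h : IsHeisenberg A) (v : V) :
    HasFinsum (fun t : ℕ × ℕ+ => A 0 (-t.1) (A 0 (t.1 - t.2) (A 1 t.2 v)))
      (∑ᶠ m : ℕ+, ∑ᶠ n : ℕ, A 0 (-n) (A 0 (n + (-m)) (A 1 m v))) :=
  (HasFinsum.of_equiv (Equiv.prodComm _ _)).2 (h.finsum_int1 v)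

theorem finsum_int2 (h : IsHeisenberg A) (v : V) :
    HasFinsum (fun t : ℕ+ × ℕ+ => A 0 (-t.2) (A 1 (-t.1) (A 1 (t.1 + t.2) v)))
      (∑ᶠ t : ℕ+ × ℕ+, A 0 (-t.2) (A 1 (-t.1) (A 1 (t.1 + t.2) v))) :=
  (h.finsum_split 1 0 1 v).self.congr (fun t => by
    rw [h.swap (by simp)]) |> fun h' => h'.self

/-- Twice the sum over `n ≥ 0` in terms of the Virasoro mode. -/
theorem two_smul_finsum_shift (h : IsHeisenberg A) (h0 : ∀ I v, A I 0 v = 0) (I : Fin 2) (m : ℕ+)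
    (w : V) : (2 : ℂ) • ∑ᶠ n : ℕ, A I (-n) (A I (n + (-m)) w)
      = (2 : ℂ) • virasoro (fun I n v => A I n v) I (-m) w
        + ∑ n ∈ Finset.range m, A I (-n) (A I (n + (-m)) w) := by
  have hm := m.pos
  -- The sum over ℤ, which is 2 L_{-m}, is cut at 0. Its negative half, with the two commuting
  -- factors exchanged, is the tail n ≥ m + 1 of the one-sided sum. The one-sided sum has in
  -- addition the terms n < m, and its term n = m vanishes because a_0 = 0.
  have h1 := (h.finsum_virasoro I (k := -m) (by omega) w).int_split
  have h2 := (h.finsum_shift I (-m) w).nat_add (m + 1)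
  have h3 : ∑ᶠ n : ℕ, A I (-(-(n + 1 : ℕ) : ℤ)) (A I ((-(n + 1 : ℕ) : ℤ) + (-m)) w)
      = ∑ᶠ n : ℕ, A I (-(n + (m + 1) : ℕ)) (A I ((n + (m + 1) : ℕ) + (-m)) w) := by
    refine finsum_congr fun n => ?_
    rw [h.swap (by push_cast; omega)]
    congr 2
    · push_cast; ring
    · congr 1
      push_cast; ring
  rw [Finset.sum_range_succ] at h2
  rw [show A I (-(m : ℕ)) (A I ((m : ℕ) + (-m)) w) = 0 by simp [h0]] at h2
  unfold virasoro
  rw [smul_smul, h1, h3, two_smul]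
  nth_rewrite 2 [h2]
  norm_num
  abel

theorem interaction_eq (h : IsHeisenberg A) (h0 : ∀ I v, A I 0 v = 0) (p q r : ℝ) (v : V) :
    interaction (fun I n v => A I n v) p q r v =
      (r : ℂ) • ((2 / ((Real.sqrt q : ℝ) : ℂ)) •
          ∑ᶠ m : ℕ+, virasoro (fun I n v => A I n v) 0 (-m) (A 1 m v)
        + ∑ᶠ t : ℕ+ × ℕ+,
          ((1 / ((Real.sqrt q : ℝ) : ℂ)) • A 0 (-t.1) (A 0 (-t.2) (A 1 (t.1 + t.2) v))
            - (2 / ((Real.sqrt p : ℝ) : ℂ)) • A 1 (-t.1) (A 0 (-t.2) (A 1 (t.1 + t.2) v)))) := by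
  -- Here the terms n < m become the sum over pairs of positive integers: a_{-n} a_{-(m-n)} a²_m is
  -- indexed by (n, m - n), and the term n = 0 contains a_0 = 0.
  have key : (2 : ℂ) • ∑ᶠ m : ℕ+, ∑ᶠ n : ℕ, A 0 (-n) (A 0 (n + (-m)) (A 1 m v))
      = (2 : ℂ) • ∑ᶠ m : ℕ+, virasoro (fun I n v => A I n v) 0 (-m) (A 1 m v)
        + ∑ᶠ t : ℕ+ × ℕ+, A 0 (-t.1) (A 0 (-t.2) (A 1 (t.1 + t.2) v)) := by
    obtain ⟨K, hK⟩ := h.nil v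
    have hfin : {n : ℕ+ | (n : ℕ) ≤ K}.Finite :=
      (Set.finite_Iic K).preimage PNat.coe_injective.injOn
    have hz : ∀ m ∉ {n : ℕ+ | (n : ℕ) ≤ K}, A 1 m v = 0 := fun m hm => hK _ _ (by
      simp at hm; omega)
    have hS : HasFinsum (fun m : ℕ+ => ∑ n ∈ Finset.range m, A 0 (-n) (A 0 (n + (-m)) (A 1 m v)))
        (∑ᶠ t : ℕ+ × ℕ+, A 0 (-t.1) (A 0 (-t.2) (A 1 (t.1 + t.2) v))) := by
      have h1 := h.finsum_split 0 0 1 v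
      have h2 : HasFinsum (fun x : ℕ+ × ℕ+ => if x.2 < x.1 then
          A 0 (-x.2) (A 0 (x.2 + (-x.1)) (A 1 x.1 v)) else 0)
          (∑ᶠ t : ℕ+ × ℕ+, A 0 (-t.1) (A 0 (-t.2) (A 1 (t.1 + t.2) v))) := by
        refine (HasFinsum.of_injective (g := fun t : ℕ+ × ℕ+ => (t.1 + t.2, t.1)) ?_ ?_).1
          (h1.congr fun t => ?_)
        · rintro ⟨a, b⟩ ⟨c, d⟩ hab
          simp only [Prod.mk.injEq] at hab
          obtain ⟨h1, rfl⟩ := hab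
          simpa using h1
        · rintro ⟨a, b⟩ hab
          refine if_neg fun hlt => hab ⟨(b, a - b), ?_⟩
          simp [PNat.add_sub_of_lt hlt]
        · rw [if_pos (PNat.lt_add_right _ _)]
          simp
      refine h2.curry.congr fun m => ?_
      have h3 : HasFinsum (fun n : ℕ => if n < (m : ℕ) then
          A 0 (-n) (A 0 (n + (-m)) (A 1 m v)) else 0)
          (∑ n ∈ Finset.range m, A 0 (-n) (A 0 (n + (-m)) (A 1 m v))) := by
        have := HasFinsum.finset (Finset.range m) (f := fun n : ℕ => if n < (m : ℕ) then
          A 0 (-n) (A 0 (n + (-m)) (A 1 m v)) else 0) fun n hn => if_neg (by simpa using hn)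
        rwa [Finset.sum_congr rfl fun n hn => if_pos (Finset.mem_range.1 hn)] at this
      have h4 := (HasFinsum.of_injective (g := fun n : ℕ+ => (n : ℕ)) PNat.coe_injective
        (fun n hn => ?_)).2 h3
      · rw [← h4.eq]
        rfl
      · obtain rfl : n = 0 := by
          by_contra hn0
          exact hn ⟨⟨n, Nat.pos_of_ne_zero hn0⟩, rfl⟩
        simp [h0]
    have hV : HasFinsum (fun m : ℕ+ => virasoro (fun I n v => A I n v) 0 (-m) (A 1 m v))
        (∑ᶠ m : ℕ+, virasoro (fun I n v => A I n v) 0 (-m) (A 1 m v)) :=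
      HasFinsum.of_subset hfin fun m hm => by simp [hz m hm, virasoro]
    have hL : HasFinsum (fun m : ℕ+ => ∑ᶠ n : ℕ, A 0 (-n) (A 0 (n + (-m)) (A 1 m v)))
        (∑ᶠ m : ℕ+, ∑ᶠ n : ℕ, A 0 (-n) (A 0 (n + (-m)) (A 1 m v))) :=
      HasFinsum.of_subset hfin fun m hm => by simp [hz m hm]
    refine (hL.smul 2).unique (((hV.smul 2).add hS).congr fun m => ?_)
    exact h.two_smul_finsum_shift h0 0 m _
  have h2 := (((h.finsum_split 0 0 1 v).smul (1 / ((Real.sqrt q : ℝ) : ℂ))).sub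
    ((h.finsum_split 1 0 1 v).smul (2 / ((Real.sqrt p : ℝ) : ℂ)))).eq
  rw [h2]
  have h3 : ∑ᶠ t : ℕ+ × ℕ+, A 0 (-t.2) (A 1 (-t.1) (A 1 (t.1 + t.2) v))
      = ∑ᶠ t : ℕ+ × ℕ+, A 1 (-t.1) (A 0 (-t.2) (A 1 (t.1 + t.2) v)) :=
    finsum_congr fun t => h.swap (by simp) _
  unfold interaction int1 int2
  rw [(h.finsum_int1' v).eq, h3]
  have h4 : (2 * (r : ℂ) / (Real.sqrt q : ℝ)) •
      ∑ᶠ m : ℕ+, ∑ᶠ n : ℕ, A 0 (-n) (A 0 (n + (-m)) (A 1 m v))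
      = ((r : ℂ) / (Real.sqrt q : ℝ)) • ((2 : ℂ) •
        ∑ᶠ m : ℕ+, ∑ᶠ n : ℕ, A 0 (-n) (A 0 (n + (-m)) (A 1 m v))) := by
    rw [smul_smul]; congr 1; ring
  rw [h4, key]
  module

/-- A linear map that intertwines the modes intertwines the interactions. -/
theorem map_int1 {W : Type} [AddCommGroup W] [Module ℂ W] {B : Fin 2 → ℤ → Module.End ℂ W}
    (h : IsHeisenberg A) (Φ : V →ₗ[ℂ] W) (hΦ : ∀ I n v, Φ (A I n v) = B I n (Φ v)) (q r : ℝ)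
    (v : V) : Φ (int1 (fun I n v => A I n v) q r v) = int1 (fun I n v => B I n v) q r (Φ v) := by
  unfold int1
  rw [map_smul]
  congr 1
  have h1 := (h.finsum_int1' v).self.map Φ
  rw [← h1.eq]
  simp only [hΦ]

theorem map_int2 {W : Type} [AddCommGroup W] [Module ℂ W] {B : Fin 2 → ℤ → Module.End ℂ W}
    (h : IsHeisenberg A) (Φ : V →ₗ[ℂ] W) (hΦ : ∀ I n v, Φ (A I n v) = B I n (Φ v)) (p r : ℝ)
    (v : V) : Φ (int2 (fun I n v => A I n v) p r v) = int2 (fun I n v => B I n v) p r (Φ v) := by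
  unfold int2
  rw [map_neg, map_smul]
  congr 2
  have h1 := (h.finsum_int2 v).self.map Φ
  rw [← h1.eq]
  simp only [hΦ]

end IsHeisenberg

/-! ### The modes on the bosonic Fock space -/

theorem mode_pos (κ : Fin 2 → ℂ) (I : Fin 2) (n : ℕ+) (v : Fock) :
    mode κ I n v = (n : ℂ) • MvPolynomial.pderiv (I, n) v := by
  simp [mode]

theorem mode_neg (κ : Fin 2 → ℂ) (I : Fin 2) (n : ℕ+) (v : Fock) :
    mode κ I (-n) v = MvPolynomial.X (I, n) * v := by
  have h : ¬ (n : ℤ) < 0 := by have := n.pos; omega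
  simp [mode, h]

theorem mode_zero (κ : Fin 2 → ℂ) (I : Fin 2) (v : Fock) : mode κ I 0 v = κ I • v := by
  simp [mode]

theorem mode_eq_of_ne (κ κ' : Fin 2 → ℂ) (I : Fin 2) {j : ℤ} (hj : j ≠ 0) :
    mode κ I j = mode κ' I j := by
  unfold mode
  split_ifs <;> first | rfl | omega

theorem int_cases (j : ℤ) : (∃ n : ℕ+, j = n) ∨ j = 0 ∨ ∃ n : ℕ+, j = -n := by
  rcases lt_trichotomy j 0 with h | h | h
  · exact Or.inr (Or.inr ⟨⟨j.natAbs, by omega⟩, by change j = - ((j.natAbs : ℕ) : ℤ); omega⟩)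
  · exact Or.inr (Or.inl h)
  · exact Or.inl ⟨⟨j.natAbs, by omega⟩, by change j = ((j.natAbs : ℕ) : ℤ); omega⟩

theorem pderiv_comm' {σ : Type*} (i j : σ) (v : MvPolynomial σ ℂ) :
    MvPolynomial.pderiv i (MvPolynomial.pderiv j v)
      = MvPolynomial.pderiv j (MvPolynomial.pderiv i v) := by
  classical
  have h : ⁅MvPolynomial.pderiv (R := ℂ) i, MvPolynomial.pderiv (R := ℂ) j⁆ = 0 := by
    refine MvPolynomial.derivation_ext fun k => ?_
    simp only [Derivation.commutator_apply, MvPolynomial.pderiv_X, Pi.single_apply]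
    split_ifs <;> simp
  have := DFunLike.congr_fun h v
  simpa [Derivation.commutator_apply, sub_eq_zero] using this

theorem mode_comm (κ : Fin 2 → ℂ) (I J : Fin 2) (n m : ℤ) (v : Fock) :
    mode κ I n (mode κ J m v) - mode κ J m (mode κ I n v)
      = if I = J ∧ n + m = 0 then (n : ℂ) • v else 0 := by
  rcases int_cases n with ⟨n, rfl⟩ | rfl | ⟨n, rfl⟩ <;>
  rcases int_cases m with ⟨m, rfl⟩ | rfl | ⟨m, rfl⟩
  · rw [if_neg (by have := n.pos; have := m.pos; omega)]
    simp only [mode_pos, map_smul, pderiv_comm' (I, n) (J, m)]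
    rw [smul_comm, sub_self]
  · rw [if_neg (by have := n.pos; omega)]
    simp only [mode_pos, mode_zero, map_smul]
    rw [smul_comm, sub_self]
  · simp only [mode_pos, mode_neg, Derivation.leibniz, MvPolynomial.pderiv_X, Pi.single_apply,
      Prod.mk.injEq, smul_eq_mul]
    by_cases h : I = J ∧ n = m
    · obtain ⟨rfl, rfl⟩ := h
      simp
    · rw [if_neg (fun h' => h ⟨h'.1.symm, h'.2.symm⟩), if_neg (by
        rintro ⟨h1, h2⟩
        exact h ⟨h1, PNat.coe_injective (by omega)⟩)]
      simp
  · rw [if_neg (by have := m.pos; omega)]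
    simp only [mode_pos, mode_zero, map_smul]
    rw [smul_comm, sub_self]
  · simp only [mode_zero, map_smul]
    rw [smul_comm, sub_self]
    simp
  · rw [if_neg (by have := m.pos; omega)]
    simp [mode_neg, mode_zero]
  · simp only [mode_pos, mode_neg, Derivation.leibniz, MvPolynomial.pderiv_X, Pi.single_apply,
      Prod.mk.injEq, smul_eq_mul]
    by_cases h : I = J ∧ n = m
    · obtain ⟨rfl, rfl⟩ := h
      simp
    · rw [if_neg h, if_neg (by
        rintro ⟨h1, h2⟩
        exact h ⟨h1, PNat.coe_injective (by omega)⟩)]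
      simp
  · rw [if_neg (by have := n.pos; omega)]
    simp [mode_neg, mode_zero]
  · rw [if_neg (by have := n.pos; have := m.pos; omega)]
    simp only [mode_neg]
    ring

theorem isHeisenberg_mode (κ : Fin 2 → ℂ) : IsHeisenberg (mode κ) where
  comm := mode_comm κ
  nil v := by
    refine ⟨v.vars.sup (fun k => (k.2 : ℕ)) + 1, fun I n hn => ?_⟩
    lift n to ℕ using by omega
    obtain ⟨n, rfl⟩ : ∃ m : ℕ+, n = m := ⟨⟨n, by omega⟩, rfl⟩
    rw [mode_pos, MvPolynomial.pderiv_eq_zero_of_notMem_vars, smul_zero]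
    intro h
    have : (n : ℕ) ≤ _ := Finset.le_sup (f := fun k : Fin 2 × ℕ+ => (k.2 : ℕ)) h
    omega

theorem bose_zero (I : Fin 2) (v : Fock) : bose I 0 v = 0 := by
  simp [bose, mode_zero]

end Halperin

namespace Halperin

/-! ### The action of the differential operator on coherent states -/

section Coherent

variable {N M : ℕ}

/-- The layer of a particle. -/
def layer : Fin N ⊕ Fin M → Fin 2 := Sum.elim (fun _ => 0) (fun _ => 1)

theorem powerSum_eq_sum_layer (J : Fin 2) (n : ℤ) (Z : Fin N ⊕ Fin M → ℂ) :
    powerSum J n Z = ∑ K, if J = layer K then Z K ^ n else 0 := by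
  rw [Fintype.sum_sum_type]
  fin_cases J <;> simp [powerSum, layer]

theorem hasDerivAt_powerSum (J : Fin 2) (n : ℕ+) (Z : Fin N ⊕ Fin M → ℂ) (K : Fin N ⊕ Fin M)
    (t : ℂ) : HasDerivAt (fun s => powerSum J n (Function.update Z K s))
      (if J = layer K then (n : ℂ) * t ^ ((n : ℕ) - 1) else 0) t := by
  simp_rw [powerSum_eq_sum_layer]
  have h : ∀ K', HasDerivAt (fun s => if J = layer K' then
      Function.update Z K s K' ^ ((n : ℕ) : ℤ) else 0)
      (if K' = K then (if J = layer K then (n : ℂ) * t ^ ((n : ℕ) - 1) else 0) else 0) t := by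
    intro K'
    simp only [zpow_natCast]
    by_cases hK : K' = K
    · subst hK
      simp only [Function.update_self, if_true]
      split_ifs
      · exact hasDerivAt_pow _ _
      · exact hasDerivAt_const _ _
    · simp only [Function.update_of_ne hK, if_neg hK]
      exact hasDerivAt_const _ _
  have := HasDerivAt.fun_sum (u := Finset.univ) fun K' (_ : K' ∈ Finset.univ) => h K'
  simpa using this

/-- The logarithmic Euler derivative of the coherent state at a particle of layer `I` with
coordinate `u`. -/
def drift (p q : ℝ) (x : Fin 2 × ℕ+ →₀ ℂ) (I : Fin 2) (u : ℂ) : ℂ :=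
  ∑ k ∈ x.support, if k.1 = I then charge p q k.1 * x k * u ^ (k.2 : ℕ) else 0

/-- The Euler derivative of `drift`. -/
def driftEuler (p q : ℝ) (x : Fin 2 × ℕ+ →₀ ℂ) (I : Fin 2) (u : ℂ) : ℂ :=
  ∑ k ∈ x.support, if k.1 = I then charge p q k.1 * x k * (k.2 * u ^ (k.2 : ℕ)) else 0

theorem pow_pnat_eq (u : ℂ) (n : ℕ+) : u * u ^ ((n : ℕ) - 1) = u ^ (n : ℕ) := by
  rw [← pow_succ', Nat.sub_add_cancel n.pos]

theorem hasDerivAt_coherent (p q : ℝ) (x : Fin 2 × ℕ+ →₀ ℂ) (Z : Fin N ⊕ Fin M → ℂ)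
    (K : Fin N ⊕ Fin M) (t : ℂ) :
    HasDerivAt (fun s => coherent p q x (Function.update Z K s))
      (coherent p q x (Function.update Z K t) * ∑ k ∈ x.support,
        if k.1 = layer K then charge p q k.1 * x k * t ^ ((k.2 : ℕ) - 1) else 0) t := by
  unfold coherent Finsupp.sum
  refine HasDerivAt.cexp ?_
  refine HasDerivAt.fun_sum fun k _ => ?_
  have hk : (k.2 : ℂ) ≠ 0 := by exact_mod_cast k.2.pos.ne'
  convert! ((hasDerivAt_powerSum k.1 k.2 Z K t).const_mul (charge p q k.1 * x k)).div_const
    (k.2 : ℂ) using 1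
  split_ifs
  · field_simp
  · simp

theorem euler_coherent (p q : ℝ) (x : Fin 2 × ℕ+ →₀ ℂ) (Z : Fin N ⊕ Fin M → ℂ)
    (K : Fin N ⊕ Fin M) :
    euler K (coherent p q x) Z = coherent p q x Z * drift p q x (layer K) (Z K) := by
  unfold euler
  rw [(hasDerivAt_coherent p q x Z K (Z K)).deriv, Function.update_eq_self, mul_left_comm]
  congr 1
  unfold drift
  rw [Finset.mul_sum]
  refine Finset.sum_congr rfl fun k _ => ?_
  split_ifs
  · rw [← pow_pnat_eq]; ring
  · simp

theorem euler_euler_coherent (p q : ℝ) (x : Fin 2 × ℕ+ →₀ ℂ) (Z : Fin N ⊕ Fin M → ℂ)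
    (K : Fin N ⊕ Fin M) :
    euler K (euler K (coherent p q x)) Z = coherent p q x Z *
      (drift p q x (layer K) (Z K) ^ 2 + driftEuler p q x (layer K) (Z K)) := by
  have h1 : euler K (coherent p q x)
      = fun Y : Fin N ⊕ Fin M → ℂ => coherent p q x Y * drift p q x (layer K) (Y K) := by
    funext Y
    exact euler_coherent p q x Y K
  have h2 : HasDerivAt (fun s => drift p q x (layer K) (Function.update Z K s K))
      (∑ k ∈ x.support, if k.1 = layer K then
        charge p q k.1 * x k * (k.2 * Z K ^ ((k.2 : ℕ) - 1)) else 0) (Z K) := by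
    unfold drift
    refine HasDerivAt.fun_sum fun k _ => ?_
    simp only [Function.update_self]
    split_ifs
    · exact (hasDerivAt_pow _ _).const_mul _
    · exact hasDerivAt_const _ _
  have h3 : euler K (fun Y : Fin N ⊕ Fin M → ℂ => drift p q x (layer K) (Y K)) Z
      = driftEuler p q x (layer K) (Z K) := by
    unfold euler driftEuler
    rw [h2.deriv, Finset.mul_sum]
    refine Finset.sum_congr rfl fun k _ => ?_
    split_ifs
    · rw [← pow_pnat_eq]; ring
    · simp
  rw [h1, euler_mul K (hasDerivAt_coherent p q x Z K (Z K)).differentiableAt h2.differentiableAt,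
    h3, euler_coherent]
  ring

/-- Replaces the support of x by one finite set of mode numbers that serves both layers, so that all
later sums can be compared term by term over S. -/
theorem drift_eq {p q : ℝ} {x : Fin 2 × ℕ+ →₀ ℂ} {S : Finset ℕ+} (hS : ∀ I, ∀ n ∉ S, x (I, n) = 0)
    (I : Fin 2) (g : ℕ+ → ℂ) :
    ∑ k ∈ x.support, (if k.1 = I then charge p q k.1 * x k * g k.2 else 0)
      = ∑ n ∈ S, charge p q I * x (I, n) * g n := by
  have h1 : ∑ k ∈ x.support, (if k.1 = I then charge p q k.1 * x k * g k.2 else 0)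
      = ∑ k ∈ Finset.univ ×ˢ S, (if k.1 = I then charge p q k.1 * x k * g k.2 else 0) := by
    refine Finset.sum_subset (fun k hk => ?_) fun k _ hk => ?_
    · simp only [Finset.mem_product, Finset.mem_univ, true_and]
      by_contra h
      exact (Finsupp.mem_support_iff.1 hk) (hS k.1 k.2 h)
    · simp [Finsupp.notMem_support_iff.1 hk]
  rw [h1, Finset.sum_product, Finset.sum_eq_single I]
  · simp
  · intro J _ hJ
    simp [hJ]
  · simp

end Coherent

/-! ### The terms of the bosonic form -/

/-- The index set of the terms of one layer. -/
abbrev LayerIndex : Type := (ℕ+ ⊕ ℕ+) ⊕ ((ℕ+ × ℕ+) ⊕ (ℕ+ × ℕ+))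

/-- The terms that come from one layer. -/
def layerTerm (p : ℝ) (I : Fin 2) : LayerIndex → BoseTerm
  -- The summand n comes from ∂², and -p (n + 1)/2 from the missing diagonal i = j of the divided
  -- differences. It splits as (1 - p/2) n - p/2; the second part is the -½ in the background. The
  -- next line keeps a_0 as a mode, which makes the list independent of the number of particles.
  | .inl (.inl n) => ⟨n - p / 2 * (n + 1), [(I, n)], [(I, n)]⟩
  | .inl (.inr n) => ⟨(Real.sqrt p : ℝ), [(I, n)], [(I, 0), (I, n)]⟩
  | .inr (.inl t) => ⟨(Real.sqrt p : ℝ), [(I, t.1), (I, t.2)], [(I, t.1 + t.2)]⟩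
  | .inr (.inr t) => ⟨(Real.sqrt p : ℝ) / 2, [(I, t.1 + t.2)], [(I, t.1), (I, t.2)]⟩

/-- The index set of the terms that couple the layers. -/
abbrev CrossIndex : Type := ℕ+ ⊕ ((ℕ+ × ℕ+) ⊕ (ℕ+ × ℕ+))

/-- The terms that couple the layers. -/
def crossTerm (p q r : ℝ) : CrossIndex → BoseTerm
  -- The three families come from z/(z - w) = 1 + ∑_{k>0} (w/z)^k, which multiplies the drift of the
  -- z particle, and from w/(z - w) = ∑_{k>0} (w/z)^k, which multiplies that of the w particle. The
  -- constant 1 is the mode a²_0, since it is summed over the particles w.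
  | .inl n => ⟨2 * r / (Real.sqrt q : ℝ), [(0, n)], [(0, n), (1, 0)]⟩
  | .inr (.inl t) => ⟨2 * r / (Real.sqrt q : ℝ), [(0, t.1)], [(0, t.1 - t.2), (1, t.2)]⟩
  | .inr (.inr t) => ⟨-(2 * r / (Real.sqrt p : ℝ)), [(1, t.1)], [(1, t.1 + t.2), (0, -t.2)]⟩

/-- The terms of the bosonic form. -/
def formTerm (p q r : ℝ) : (LayerIndex ⊕ LayerIndex) ⊕ CrossIndex → BoseTerm
  | .inl (.inl t) => layerTerm p 0 t
  | .inl (.inr t) => layerTerm q 1 t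
  | .inr t => crossTerm p q r t

theorem formTerm_length (p q r : ℝ) (t : (LayerIndex ⊕ LayerIndex) ⊕ CrossIndex) :
    (formTerm p q r t).creators.length + (formTerm p q r t).modes.length ≤ 3 := by
  rcases t with (((n | n) | (n | n)) | ((n | n) | (n | n))) | (n | (n | n)) <;>
    simp [formTerm, layerTerm, crossTerm]

/-! ### Values on coherent states -/

theorem HasFinsum.hasSum {α : Type*} {f : α → ℂ} {s : ℂ} (h : HasFinsum f s) : HasSum f s := by
  obtain ⟨A, hA, rfl⟩ := h.exists_finset
  exact hasSum_sum_of_ne_finset_zero hA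

theorem finsum_convolve {S : Finset ℕ+} {y : ℕ+ → ℂ} (hy : ∀ n ∉ S, y n = 0) (F : ℕ → ℕ → ℂ) :
    HasFinsum (fun t : ℕ+ × ℕ+ => y (t.1 + t.2) * F t.1 t.2)
      (∑ n ∈ S, y n * ∑ k ∈ Finset.Ioo 0 (n : ℕ), F k (n - k)) := by
  have h1 : HasFinsum (fun t : ℕ+ × ℕ => if 0 < t.2 ∧ t.2 < (t.1 : ℕ) then
      y t.1 * F t.2 (t.1 - t.2) else 0)
      (∑ n ∈ S, y n * ∑ k ∈ Finset.Ioo 0 (n : ℕ), F k (n - k)) := by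
    have h := HasFinsum.uncurry (f := fun t : ℕ+ × ℕ => if 0 < t.2 ∧ t.2 < (t.1 : ℕ) then
      y t.1 * F t.2 (t.1 - t.2) else 0) (A := S)
      (g := fun n => y n * ∑ k ∈ Finset.Ioo 0 (n : ℕ), F k (n - k)) S.finite_toSet
      (fun n hn k => by simp [hy n (by simpa using hn)]) fun n => ?_
    · rwa [(HasFinsum.finset S fun n hn => by simp [hy n hn]).eq] at h
    · have := HasFinsum.finset (Finset.Ioo 0 (n : ℕ)) (f := fun k : ℕ =>
        if 0 < k ∧ k < (n : ℕ) then y n * F k (n - k) else 0)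
        fun k hk => if_neg (by simpa using hk)
      rwa [Finset.sum_congr rfl fun k hk => if_pos (by simpa using hk), ← Finset.mul_sum] at this
  refine ((HasFinsum.of_injective (g := fun t : ℕ+ × ℕ+ => (t.1 + t.2, (t.1 : ℕ))) ?_ ?_).2
    h1).congr fun t => ?_
  · rintro ⟨a, b⟩ ⟨c, d⟩ hab
    simp only [Prod.mk.injEq, PNat.coe_inj] at hab
    obtain ⟨h1, rfl⟩ := hab
    simpa using h1
  · rintro ⟨n, k⟩ hk
    refine if_neg fun h => hk ⟨(⟨k, h.1⟩, ⟨n - k, by simp only at h; omega⟩), ?_⟩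
    refine Prod.ext (PNat.coe_injective ?_) rfl
    change k + (n - k) = n
    simp only at h; omega
  · have := t.1.pos
    have := t.2.pos
    simp

theorem two_mul_sum_Ioi {P : ℕ} (g : Fin P → Fin P → ℂ) (hg : ∀ i j, g i j = g j i) :
    2 * ∑ i, ∑ j ∈ Finset.Ioi i, g i j = ∑ i, ∑ j, g i j - ∑ i, g i i := by
  have h1 : ∀ i, ∑ j, g i j = ∑ j ∈ Finset.Ioi i, g i j + ∑ j ∈ Finset.Iio i, g i j + g i i := by
    intro i
    have : (Finset.univ : Finset (Fin P)) = (Finset.Ioi i ∪ Finset.Iio i) ∪ {i} := by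
      ext j; simp; have := lt_trichotomy i j; grind
    rw [this, Finset.sum_union, Finset.sum_union]
    · simp
    · rw [Finset.disjoint_left]; intro j; simp; exact fun h => h.le
    · simp
  have h2 : ∑ i, ∑ j ∈ Finset.Iio i, g i j = ∑ i, ∑ j ∈ Finset.Ioi i, g i j := by
    rw [Finset.sum_comm' (t' := Finset.univ) (s' := fun j => Finset.Ioi j) (by simp)]
    exact Finset.sum_congr rfl fun i _ => Finset.sum_congr rfl fun j _ => hg _ _
  simp_rw [h1, Finset.sum_add_distrib]
  rw [h2]
  ring

/-- The quotient equals ∑_{k ≤ n} u_i^k u_j^{n-k}, which is symmetric in i and j, so twice the sum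
over i < j is the full double sum minus the diagonal. The extreme values k = 0 and k = n each give P
∑ u_i^n, and the diagonal gives (n + 1) ∑ u_i^n. -/
theorem sum_divided_difference {P : ℕ} {u : Fin P → ℂ} (hu : Function.Injective u) (n : ℕ+) :
    2 * ∑ i, ∑ j ∈ Finset.Ioi i, (u i ^ ((n : ℕ) + 1) - u j ^ ((n : ℕ) + 1)) / (u i - u j)
      = 2 * (P * ∑ i, u i ^ (n : ℕ))
        + ∑ k ∈ Finset.Ioo 0 (n : ℕ), (∑ i, u i ^ k) * (∑ i, u i ^ ((n : ℕ) - k))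
        - (n + 1) * ∑ i, u i ^ (n : ℕ) := by
  have h1 : ∀ i, ∀ j ∈ Finset.Ioi i, (u i ^ ((n : ℕ) + 1) - u j ^ ((n : ℕ) + 1)) / (u i - u j)
      = ∑ k ∈ Finset.range (n + 1), u i ^ k * u j ^ ((n : ℕ) - k) := by
    intro i j hij
    rw [div_eq_iff (sub_ne_zero.2 (hu.ne (Finset.mem_Ioi.1 hij).ne))]
    exact ((Commute.all (u i) (u j)).geom_sum₂_mul ((n : ℕ) + 1)).symm
  rw [Finset.sum_congr rfl fun i _ => Finset.sum_congr rfl (h1 i), two_mul_sum_Ioi]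
  · have h2 : ∑ i, ∑ j, ∑ k ∈ Finset.range (n + 1), u i ^ k * u j ^ ((n : ℕ) - k)
        = ∑ k ∈ Finset.range (n + 1), (∑ i, u i ^ k) * (∑ i, u i ^ ((n : ℕ) - k)) := by
      simp_rw [Finset.sum_mul_sum]
      rw [Finset.sum_comm (s := Finset.range (n + 1))]
      refine Finset.sum_congr rfl fun i _ => ?_
      rw [Finset.sum_comm]
    have h3 : Finset.range (n + 1) = insert 0 (insert (n : ℕ) (Finset.Ioo 0 (n : ℕ))) := by
      ext k; have := n.pos; simp only [Finset.mem_range, Finset.mem_insert, Finset.mem_Ioo]; omega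
    rw [h2, h3, Finset.sum_insert (by simp), Finset.sum_insert (by simp)]
    have h4 : ∀ i, ∑ k ∈ insert 0 (insert (n : ℕ) (Finset.Ioo 0 (n : ℕ))),
        u i ^ k * u i ^ ((n : ℕ) - k) = (n + 1) * u i ^ (n : ℕ) := by
      intro i
      rw [← h3, Finset.sum_congr rfl (g := fun _ => u i ^ (n : ℕ)) fun k hk => ?_]
      · simp
      · rw [← pow_add]
        congr 1
        have := Finset.mem_range.1 hk
        omega
    rw [Finset.sum_congr rfl fun i _ => h4 i, ← Finset.mul_sum]
    simp
    ring
  · intro i j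
    rw [← Finset.sum_range_reflect]
    refine Finset.sum_congr rfl fun k hk => ?_
    have := Finset.mem_range.1 hk
    rw [mul_comm]
    congr 2
    omega

theorem hasSum_prod_finset {S : Finset ℕ+} {F : ℕ+ × ℕ+ → ℂ} {g : ℕ+ → ℂ}
    (h0 : ∀ n ∉ S, ∀ k, F (n, k) = 0) (h : ∀ n ∈ S, HasSum (fun k => F (n, k)) (g n)) :
    HasSum F (∑ n ∈ S, g n) := by
  have h1 : ∀ n ∈ S, HasSum (fun t : ℕ+ × ℕ+ => if t.1 = n then F t else 0) (g n) := by
    intro n hn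
    refine ((Prod.mk_right_injective n).hasSum_iff ?_).1 ((h n hn).congr_fun fun k => ?_)
    · rintro ⟨a, b⟩ hab
      exact if_neg fun h' => hab ⟨b, Prod.ext h'.symm rfl⟩
    · simp
  refine (hasSum_sum h1).congr_fun fun t => ?_
  rw [Finset.sum_ite_eq]
  split_ifs with ht
  · rfl
  · exact h0 _ ht _

/-- The square of the drift gives the terms a_{-n} a_{-m} a_{n+m}, the derivative of the drift a
diagonal quadratic term, and the divided differences everything else. As x has finite support, all
four sums are finite. -/
theorem hasSum_layerTerm {p q p₀ : ℝ} (hp : 0 < p₀) {I : Fin 2}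
    (hc : charge p q I = (Real.sqrt p₀ : ℝ)) {N M P : ℕ} {Z : Fin N ⊕ Fin M → ℂ} {u : Fin P → ℂ}
    (hu : Function.Injective u) (hP : ∀ j, powerSum I j Z = ∑ i, u i ^ j)
    {x : Fin 2 × ℕ+ →₀ ℂ} {S : Finset ℕ+} (hS : ∀ I, ∀ n ∉ S, x (I, n) = 0) :
    HasSum (fun t => (layerTerm p₀ I t).eval p q x Z)
      (∑ i, (drift p q x I (u i) ^ 2 + driftEuler p q x I (u i))
        + (p₀ : ℂ) * ∑ i, ∑ j ∈ Finset.Ioi i,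
          (u i * drift p q x I (u i) - u j * drift p q x I (u j)) / (u i - u j)) := by
  set c : ℂ := ((Real.sqrt p₀ : ℝ) : ℂ) with hcdef
  have hcc : c * c = p₀ := by
    rw [hcdef, ← Complex.ofReal_mul, Real.mul_self_sqrt hp.le]
  have hd : ∀ v, drift p q x I v = ∑ n ∈ S, c * x (I, n) * v ^ (n : ℕ) := fun v => by
    rw [← hc]; exact drift_eq hS I fun n => v ^ (n : ℕ)
  have hd' : ∀ v, driftEuler p q x I v = ∑ n ∈ S, c * x (I, n) * (n * v ^ (n : ℕ)) := fun v => by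
    rw [← hc]; exact drift_eq hS I fun n => n * v ^ (n : ℕ)
  have hPn : ∀ n : ℕ, powerSum I n Z = ∑ i, u i ^ n := fun n => by simpa using hP n
  have hP0 : powerSum I 0 Z = P := by simpa using hPn 0
  have e1 : HasSum (fun n : ℕ+ => (layerTerm p₀ I (.inl (.inl n))).eval p q x Z)
      (∑ n ∈ S, (n - p₀ / 2 * (n + 1)) * x (I, n) * (c * ∑ i, u i ^ (n : ℕ))) := by
    refine (hasSum_sum_of_ne_finset_zero (s := S) ?_).congr_fun fun n => ?_
    · intro n hn; simp [hS I n hn]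
    · simp [layerTerm, BoseTerm.eval, hPn, hc]
  have e2 : HasSum (fun n : ℕ+ => (layerTerm p₀ I (.inl (.inr n))).eval p q x Z)
      (∑ n ∈ S, c * x (I, n) * (c * P * (c * ∑ i, u i ^ (n : ℕ)))) := by
    refine (hasSum_sum_of_ne_finset_zero (s := S) ?_).congr_fun fun n => ?_
    · intro n hn; simp [hS I n hn]
    · simp [layerTerm, BoseTerm.eval, hPn, hP0, hc, ← hcdef]
  have e3 : HasSum (fun t : ℕ+ × ℕ+ => (layerTerm p₀ I (.inr (.inl t))).eval p q x Z)
      (∑ n ∈ S, ∑ m ∈ S, c * (x (I, n) * x (I, m)) * (c * ∑ i, u i ^ ((n : ℕ) + m))) := by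
    rw [← Finset.sum_product']
    refine (hasSum_sum_of_ne_finset_zero (s := S ×ˢ S) (f := fun t : ℕ+ × ℕ+ =>
      c * (x (I, t.1) * x (I, t.2)) * (c * ∑ i, u i ^ ((t.1 : ℕ) + t.2))) ?_).congr_fun fun t => ?_
    · intro t ht
      by_cases h1 : t.1 ∈ S
      · have h2 : t.2 ∉ S := fun h => ht (Finset.mem_product.2 ⟨h1, h⟩)
        simp [hS I _ h2]
      · simp [hS I _ h1]
    · have := hPn (t.1 + t.2)
      push_cast at this
      simp [layerTerm, BoseTerm.eval, this, hc, ← hcdef]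
  have e4 : HasSum (fun t : ℕ+ × ℕ+ => (layerTerm p₀ I (.inr (.inr t))).eval p q x Z)
      (∑ n ∈ S, x (I, n) * ∑ k ∈ Finset.Ioo 0 (n : ℕ),
        (c / 2 * ((c * ∑ i, u i ^ k) * (c * ∑ i, u i ^ ((n : ℕ) - k))))) := by
    refine (finsum_convolve (y := fun n => x (I, n)) (hS I) (fun k l =>
      c / 2 * ((c * ∑ i, u i ^ k) * (c * ∑ i, u i ^ l)))).hasSum.congr_fun fun t => ?_
    simp [layerTerm, BoseTerm.eval, hPn, hc]
    ring
  have e := (HasSum.sum (f := fun t => (layerTerm p₀ I t).eval p q x Z)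
    (HasSum.sum (f := fun t => (layerTerm p₀ I (.inl t)).eval p q x Z) e1 e2)
    (HasSum.sum (f := fun t => (layerTerm p₀ I (.inr t)).eval p q x Z) e3 e4))
  convert e using 1
  have s1 : ∑ i, drift p q x I (u i) ^ 2
      = ∑ n ∈ S, ∑ m ∈ S, c * (x (I, n) * x (I, m)) * (c * ∑ i, u i ^ ((n : ℕ) + m)) := by
    simp_rw [hd, sq, Finset.sum_mul_sum, Finset.mul_sum]
    rw [Finset.sum_comm]
    refine Finset.sum_congr rfl fun n _ => ?_
    rw [Finset.sum_comm]
    refine Finset.sum_congr rfl fun m _ => Finset.sum_congr rfl fun i _ => ?_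
    rw [pow_add]; ring
  have s2 : ∑ i, driftEuler p q x I (u i)
      = ∑ n ∈ S, c * x (I, n) * (n * ∑ i, u i ^ (n : ℕ)) := by
    simp_rw [hd', Finset.mul_sum]
    rw [Finset.sum_comm]
  have s3 : ∑ i, ∑ j ∈ Finset.Ioi i,
      (u i * drift p q x I (u i) - u j * drift p q x I (u j)) / (u i - u j)
      = ∑ n ∈ S, c * x (I, n) * ∑ i, ∑ j ∈ Finset.Ioi i,
        (u i ^ ((n : ℕ) + 1) - u j ^ ((n : ℕ) + 1)) / (u i - u j) := by
    simp_rw [Finset.mul_sum]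
    rw [Finset.sum_comm (s := S)]
    refine Finset.sum_congr rfl fun i _ => ?_
    rw [Finset.sum_comm (s := S)]
    refine Finset.sum_congr rfl fun j _ => ?_
    simp_rw [hd, Finset.mul_sum]
    rw [← Finset.sum_sub_distrib, Finset.sum_div]
    refine Finset.sum_congr rfl fun n _ => ?_
    rw [pow_succ, pow_succ]; ring
  rw [Finset.sum_add_distrib, s1, s2, s3]
  have s4 : (∑ n ∈ S, c * x (I, n) * (n * ∑ i, u i ^ (n : ℕ)))
      + (p₀ : ℂ) * ∑ n ∈ S, c * x (I, n) * ∑ i, ∑ j ∈ Finset.Ioi i,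
        (u i ^ ((n : ℕ) + 1) - u j ^ ((n : ℕ) + 1)) / (u i - u j)
      = (∑ n ∈ S, (n - p₀ / 2 * (n + 1)) * x (I, n) * (c * ∑ i, u i ^ (n : ℕ)))
        + (∑ n ∈ S, c * x (I, n) * (c * P * (c * ∑ i, u i ^ (n : ℕ))))
        + ∑ n ∈ S, x (I, n) * ∑ k ∈ Finset.Ioo 0 (n : ℕ),
        (c / 2 * ((c * ∑ i, u i ^ k) * (c * ∑ i, u i ^ ((n : ℕ) - k)))) := by
    rw [Finset.mul_sum, ← Finset.sum_add_distrib, ← Finset.sum_add_distrib,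
      ← Finset.sum_add_distrib]
    refine Finset.sum_congr rfl fun n _ => ?_
    have hdd := sum_divided_difference hu n
    have h5 : ∑ k ∈ Finset.Ioo 0 (n : ℕ),
        (c / 2 * ((c * ∑ i, u i ^ k) * (c * ∑ i, u i ^ ((n : ℕ) - k))))
        = c * (c * c) / 2 * ∑ k ∈ Finset.Ioo 0 (n : ℕ), (∑ i, u i ^ k) * (∑ i, u i ^ ((n : ℕ) - k)) := by
      rw [Finset.mul_sum]
      exact Finset.sum_congr rfl fun k _ => by ring
    rw [h5]
    have h6 : c * x (I, n) * (c * P * (c * ∑ i, u i ^ (n : ℕ)))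
        = c * x (I, n) * ((c * c) * (P * ∑ i, u i ^ (n : ℕ))) := by ring
    rw [h6, hcc]
    linear_combination (p₀ : ℂ) * c * x (I, n) / 2 * hdd
  linear_combination s4

/-- The only genuinely infinite series of the bosonic form. Its convergence is the reason for the
region |w_m| < |z_i|. -/
theorem hasSum_pow_ratio {z w : ℂ} (h : ‖w‖ < ‖z‖) :
    HasSum (fun k : ℕ+ => (w / z) ^ (k : ℕ)) (w / (z - w)) := by
  have hz : z ≠ 0 := by
    rintro rfl
    rw [norm_zero] at h
    exact absurd h (not_lt.2 (norm_nonneg w))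
  have h1 : ‖w / z‖ < 1 := by
    rw [norm_div, div_lt_one (norm_pos_iff.2 hz)]
    exact h
  have hzw : z - w ≠ 0 := by
    intro h0
    rw [sub_eq_zero] at h0
    rw [h0] at h
    exact lt_irrefl _ h
  have h2 := (hasSum_geometric_of_norm_lt_one h1).mul_left (w / z)
  have h3 := (Equiv.pnatEquivNat.hasSum_iff (f := fun n : ℕ => w / z * (w / z) ^ n)).2 h2
  convert h3 using 1
  · funext k
    simp only [Function.comp, Equiv.pnatEquivNat_apply]
    rw [← pow_succ', ← PNat.natPred_add_one k]
  · field_simp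

theorem hasSum_crossTerm {p q r : ℝ} (hp : 0 < p) (hq : 0 < q) {N M : ℕ}
    {Z : Fin N ⊕ Fin M → ℂ} (hZ : ∀ i m, ‖Z (.inr m)‖ < ‖Z (.inl i)‖)
    {x : Fin 2 × ℕ+ →₀ ℂ} {S : Finset ℕ+} (hS : ∀ I, ∀ n ∉ S, x (I, n) = 0) :
    HasSum (fun t => (crossTerm p q r t).eval p q x Z)
      (2 * (r : ℂ) * ∑ i : Fin N, ∑ m : Fin M,
        (Z (.inl i) * drift p q x 0 (Z (.inl i)) - Z (.inr m) * drift p q x 1 (Z (.inr m)))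
          / (Z (.inl i) - Z (.inr m))) := by
  set a : ℂ := ((Real.sqrt p : ℝ) : ℂ) with ha
  set b : ℂ := ((Real.sqrt q : ℝ) : ℂ) with hb
  have ha0 : a ≠ 0 := by simpa [ha] using (Real.sqrt_pos.2 hp).ne'
  have hb0 : b ≠ 0 := by simpa [hb] using (Real.sqrt_pos.2 hq).ne'
  have hd0 : ∀ v, drift p q x 0 v = ∑ n ∈ S, a * x (0, n) * v ^ (n : ℕ) := fun v =>
    drift_eq hS 0 fun n => v ^ (n : ℕ)
  have hd1 : ∀ v, drift p q x 1 v = ∑ n ∈ S, b * x (1, n) * v ^ (n : ℕ) := fun v =>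
    drift_eq hS 1 fun n => v ^ (n : ℕ)
  have hz : ∀ i (m : Fin M), Z (.inl i) ≠ 0 := by
    intro i m h0
    have := hZ i m
    rw [h0, norm_zero] at this
    exact absurd this (not_lt.2 (norm_nonneg _))
  have hzw : ∀ i m, Z (.inl i) - Z (.inr m) ≠ 0 := by
    intro i m h0
    have := hZ i m
    rw [sub_eq_zero.1 h0] at this
    exact lt_irrefl _ this
  have e1 : HasSum (fun n : ℕ+ => (crossTerm p q r (.inl n)).eval p q x Z)
      (∑ n ∈ S, 2 * r / b * x (0, n) * (∑ i, ∑ m : Fin M, a * b * Z (.inl i) ^ (n : ℕ))) := by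
    refine (hasSum_sum_of_ne_finset_zero (s := S) ?_).congr_fun fun n => ?_
    · intro n hn; simp [hS 0 n hn]
    · simp [crossTerm, BoseTerm.eval, powerSum, charge, ← ha, ← hb]
      rw [← Finset.mul_sum, ← Finset.mul_sum]
      exact Or.inl (by ring)
  have e2 : HasSum (fun t : ℕ+ × ℕ+ => (crossTerm p q r (.inr (.inl t))).eval p q x Z)
      (∑ n ∈ S, 2 * r / b * x (0, n) * (∑ i, ∑ m, a * b * (Z (.inl i) ^ (n : ℕ)
        * (Z (.inr m) / (Z (.inl i) - Z (.inr m)))))) := by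
    refine hasSum_prod_finset ?_ fun n hn => ?_
    · intro n hn k
      simp [crossTerm, BoseTerm.eval, hS 0 n hn]
    · refine (HasSum.mul_left _ (hasSum_sum fun i _ => hasSum_sum fun m _ =>
        ((hasSum_pow_ratio (hZ i m)).mul_left (Z (.inl i) ^ (n : ℕ))).mul_left (a * b))).congr_fun
        fun k => ?_
      simp only [crossTerm, BoseTerm.eval, powerSum, charge, ← ha, ← hb, List.map_cons,
        List.map_nil, List.prod_cons, List.prod_nil, if_true, one_ne_zero, if_false, mul_one]
      rw [Finset.mul_sum, Finset.mul_sum, Finset.sum_mul_sum]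
      congr 1
      refine Finset.sum_congr rfl fun i _ => Finset.sum_congr rfl fun m _ => ?_
      rw [zpow_sub₀ (hz i m), div_pow]
      simp only [zpow_natCast]
      ring
  have e3 : HasSum (fun t : ℕ+ × ℕ+ => (crossTerm p q r (.inr (.inr t))).eval p q x Z)
      (∑ n ∈ S, -(2 * r / a) * x (1, n) * (∑ i, ∑ m, a * b * (Z (.inr m) ^ (n : ℕ)
        * (Z (.inr m) / (Z (.inl i) - Z (.inr m)))))) := by
    refine hasSum_prod_finset ?_ fun n hn => ?_
    · intro n hn k
      simp [crossTerm, BoseTerm.eval, hS 1 n hn]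
    · refine (HasSum.mul_left _ (hasSum_sum fun i _ => hasSum_sum fun m _ =>
        ((hasSum_pow_ratio (hZ i m)).mul_left (Z (.inr m) ^ (n : ℕ))).mul_left (a * b))).congr_fun
        fun k => ?_
      simp only [crossTerm, BoseTerm.eval, powerSum, charge, ← ha, ← hb, List.map_cons,
        List.map_nil, List.prod_cons, List.prod_nil, if_true, one_ne_zero, if_false, mul_one]
      rw [Finset.mul_sum, Finset.mul_sum, mul_comm (∑ i, _), Finset.sum_mul_sum]
      congr 1
      refine Finset.sum_congr rfl fun i _ => Finset.sum_congr rfl fun m _ => ?_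
      rw [zpow_neg, ← Nat.cast_add, zpow_natCast, zpow_natCast, pow_add, div_pow]
      ring
  have e := (HasSum.sum (f := fun t => (crossTerm p q r t).eval p q x Z) e1
    (HasSum.sum (f := fun t => (crossTerm p q r (.inr t)).eval p q x Z) e2 e3))
  convert e using 1
  rw [← Finset.sum_add_distrib, ← Finset.sum_add_distrib]
  simp_rw [hd0, hd1, Finset.mul_sum]
  rw [Finset.sum_congr rfl fun i _ => Finset.sum_congr rfl fun m _ => by
    rw [← Finset.sum_sub_distrib, Finset.sum_div, Finset.mul_sum]]
  rw [Finset.sum_congr rfl fun i _ => Finset.sum_comm, Finset.sum_comm]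
  refine Finset.sum_congr rfl fun n _ => ?_
  rw [← Finset.sum_add_distrib, ← Finset.sum_add_distrib]
  refine Finset.sum_congr rfl fun i _ => ?_
  rw [← Finset.sum_add_distrib, ← Finset.sum_add_distrib]
  refine Finset.sum_congr rfl fun m _ => ?_
  have := hzw i m
  field_simp
  ring

theorem hasSum_formTerm {p q r : ℝ} (hp : 0 < p) (hq : 0 < q) {N M : ℕ}
    {Z : Fin N ⊕ Fin M → ℂ} (hinj : Function.Injective Z)
    (hZ : ∀ i m, ‖Z (.inr m)‖ < ‖Z (.inl i)‖) (x : Fin 2 × ℕ+ →₀ ℂ) :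
    HasSum (fun t => (formTerm p q r t).eval p q x Z)
      (diffHam p q r N M (coherent p q x) Z / coherent p q x Z) := by
  have hS : ∀ I, ∀ n ∉ x.support.image Prod.snd, x (I, n) = 0 := by
    intro I n hn
    by_contra h
    exact hn (Finset.mem_image.2 ⟨(I, n), Finsupp.mem_support_iff.2 h, rfl⟩)
  have e := HasSum.sum (f := fun t => (formTerm p q r t).eval p q x Z)
    (HasSum.sum (f := fun t => (formTerm p q r (.inl t)).eval p q x Z)
      (hasSum_layerTerm (p := p) (q := q) hp (I := 0) rfl (Z := Z)
        (hinj.comp Sum.inl_injective) (fun j => by simp [powerSum]) hS)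
      (hasSum_layerTerm (p := p) (q := q) hq (I := 1) rfl (Z := Z)
        (hinj.comp Sum.inr_injective) (fun j => by simp [powerSum]) hS))
    (hasSum_crossTerm (r := r) hp hq hZ hS)
  convert e using 1
  have h0 : coherent p q x Z ≠ 0 := Complex.exp_ne_zero _
  rw [div_eq_iff h0]
  unfold diffHam
  simp_rw [euler_euler_coherent, euler_coherent]
  rw [Fintype.sum_sum_type]
  simp only [layer, Sum.elim_inl, Sum.elim_inr, Function.comp]
  have hf : ∀ a b c d : ℂ, (a * (coherent p q x Z * b) - c * (coherent p q x Z * d))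
      = coherent p q x Z * (a * b - c * d) := fun a b c d => by ring
  simp_rw [hf, mul_div_assoc, ← Finset.mul_sum]
  ring

end Halperin

namespace Halperin

/-! ### The normal ordered operators of the terms -/

theorem IsHeisenberg.finsum_number_smul {V : Type} [AddCommGroup V] [Module ℂ V]
    {A : Fin 2 → ℤ → Module.End ℂ V} (h : IsHeisenberg A) (I J : Fin 2) (c : ℕ+ → ℂ) (v : V) :
    HasFinsum (fun n : ℕ+ => c n • A I (-n) (A J n v))
      (∑ᶠ n : ℕ+, c n • A I (-n) (A J n v)) :=
  HasFinsum.of_finite ((h.finsum_number I J v).1.subset fun n hn h0 => hn (by simp [h0]))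

/-- As an operator the mode a_0 is the number √p P, so the cubic term containing it becomes p P ∑
a_{-n} a_n. With the -p/2 split off from the diagonal coefficient this adds up to p (P - ½). -/
theorem hasFinsum_layerTerm {p : ℝ} (hp : 0 < p) {I : Fin 2} {κ : Fin 2 → ℂ} {P : ℂ}
    (hκ : κ I = (Real.sqrt p : ℝ) * P) (v : Fock) :
    HasFinsum (fun t => (layerTerm p I t).op κ v) (laughlinHam bose p I v
      + ((p : ℂ) * (P - 1 / 2)) • ∑ᶠ n : ℕ+, bose I (-n) (bose I n v)) := by
  have hH := isHeisenberg_mode 0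
  have hcc : ((Real.sqrt p : ℝ) : ℂ) * (Real.sqrt p : ℝ) = p := by
    rw [← Complex.ofReal_mul, Real.mul_self_sqrt hp.le]
  have hne : ∀ n : ℕ+, (n : ℤ) ≠ 0 := fun n => by exact_mod_cast n.pos.ne'
  have hn1 : ∀ n : ℕ+, mode κ I n = mode 0 I n := fun n => mode_eq_of_ne _ _ _ (hne n)
  have hn2 : ∀ n : ℕ+, mode κ I (-n) = mode 0 I (-n) := fun n =>
    mode_eq_of_ne _ _ _ (neg_ne_zero.2 (hne n))
  have e1 : HasFinsum (fun n => (layerTerm p I (.inl (.inl n))).op κ v)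
      (∑ᶠ n : ℕ+, ((n : ℂ) - p / 2 * (n + 1)) • mode 0 I (-n) (mode 0 I n v)) := by
    refine (hH.finsum_number_smul I I _ v).congr fun n => ?_
    simp [layerTerm, BoseTerm.op, hn1, hn2]
  have e2 : HasFinsum (fun n => (layerTerm p I (.inl (.inr n))).op κ v)
      (((p : ℂ) * P) • ∑ᶠ n : ℕ+, mode 0 I (-n) (mode 0 I n v)) := by
    refine ((hH.finsum_number I I v).smul _).congr fun n => ?_
    simp [layerTerm, BoseTerm.op, hn1, hn2, mode_zero, hκ, smul_smul, ← hcc, mul_assoc]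
  have e3 : HasFinsum (fun t => (layerTerm p I (.inr (.inl t))).op κ v)
      (((Real.sqrt p : ℝ) : ℂ) • ∑ᶠ t : ℕ+ × ℕ+,
        mode 0 I (-t.1) (mode 0 I (-t.2) (mode 0 I (t.1 + t.2) v))) := by
    refine ((hH.finsum_split I I I v).smul _).congr fun t => ?_
    have h1 := hn1 (t.1 + t.2)
    have h2 : (0 : ℤ) < t.1 + t.2 := by have := t.1.pos; have := t.2.pos; omega
    push_cast at h1
    simp [layerTerm, BoseTerm.op, hn2, h1, h2, h2.not_ge]
  have e4 : HasFinsum (fun t => (layerTerm p I (.inr (.inr t))).op κ v)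
      ((((Real.sqrt p : ℝ) : ℂ) / 2) • ∑ᶠ t : ℕ+ × ℕ+,
        mode 0 I (-t.1 - t.2) (mode 0 I t.1 (mode 0 I t.2 v))) := by
    refine ((hH.finsum_merge I I I v).smul _).congr fun t => ?_
    have h1 := hn2 (t.1 + t.2)
    have h2 : (-(t.1 : ℤ) - t.2) = -((t.1 + t.2 : ℕ+) : ℤ) := by push_cast; ring
    simp only [h2]
    simp [layerTerm, BoseTerm.op, hn1]
    simp at h1
    rw [h1]
  have e := (HasFinsum.sum (f := fun t => (layerTerm p I t).op κ v)
    (HasFinsum.sum (f := fun t => (layerTerm p I (.inl t)).op κ v) e1 e2)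
    (HasFinsum.sum (f := fun t => (layerTerm p I (.inr t)).op κ v) e3 e4))
  refine e.of_eq ?_
  have f1 : ∑ᶠ n : ℕ+, ((n : ℂ) - p / 2 * (n + 1)) • mode 0 I (-n) (mode 0 I n v)
      = (1 - (p : ℂ) / 2) • (∑ᶠ n : ℕ+, (n : ℂ) • mode 0 I (-n) (mode 0 I n v))
        - ((p : ℂ) / 2) • ∑ᶠ n : ℕ+, mode 0 I (-n) (mode 0 I n v) := by
    refine HasFinsum.eq ((((hH.finsum_number_smul I I (fun n => (n : ℂ)) v).smul _).sub
      ((hH.finsum_number I I v).smul _)).congr fun n => ?_)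
    module
  have f2 := ((hH.finsum_split I I I v).add ((hH.finsum_merge I I I v).smul (1 / 2 : ℂ))).eq
  unfold laughlinHam bose
  rw [f1, f2]
  module

theorem hasFinsum_crossTerm {p q r : ℝ} (hq : 0 < q) {κ : Fin 2 → ℂ} {N M : ℂ}
    (h0 : κ 0 = (Real.sqrt p : ℝ) * N) (h1 : κ 1 = (Real.sqrt q : ℝ) * M) (v : Fock) :
    HasFinsum (fun t => (crossTerm p q r t).op κ v) (interaction bose p q r v
      + (2 * (r : ℂ) * M) • ∑ᶠ n : ℕ+, bose 0 (-n) (bose 0 n v)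
      + (2 * (r : ℂ) * N * ((Real.sqrt p : ℝ) : ℂ) / ((Real.sqrt q : ℝ) : ℂ)) •
        ∑ᶠ n : ℕ+, bose 0 (-n) (bose 1 n v)) := by
  have hH := isHeisenberg_mode 0
  have hq0 : ((Real.sqrt q : ℝ) : ℂ) ≠ 0 := by simpa using (Real.sqrt_pos.2 hq).ne'
  have hne : ∀ n : ℕ+, (n : ℤ) ≠ 0 := fun n => by exact_mod_cast n.pos.ne'
  have hn1 : ∀ I, ∀ n : ℕ+, mode κ I n = mode 0 I n := fun I n => mode_eq_of_ne _ _ _ (hne n)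
  have hn2 : ∀ I, ∀ n : ℕ+, mode κ I (-n) = mode 0 I (-n) := fun I n =>
    mode_eq_of_ne _ _ _ (neg_ne_zero.2 (hne n))
  have e1 : HasFinsum (fun n => (crossTerm p q r (.inl n)).op κ v)
      ((2 * (r : ℂ) * M) • ∑ᶠ n : ℕ+, mode 0 0 (-n) (mode 0 0 n v)) := by
    refine ((hH.finsum_number 0 0 v).smul _).congr fun n => ?_
    simp [crossTerm, BoseTerm.op, hn1, hn2, mode_zero, h1, smul_smul]
    congr 1
    field_simp
  have e2 : HasFinsum (fun t => (crossTerm p q r (.inr (.inl t))).op κ v)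
      ((2 * (r : ℂ) / (Real.sqrt q : ℝ)) • (∑ᶠ t : ℕ × ℕ+,
          mode 0 0 (-t.1) (mode 0 0 (t.1 - t.2) (mode 0 1 t.2 v))
        + κ 0 • ∑ᶠ n : ℕ+, mode 0 0 (-n) (mode 0 1 n v))) := by
    have g1 := (HasFinsum.of_injective (g := fun t : ℕ+ × ℕ+ => ((t.1 : ℕ), t.2))
      (fun a b hab => by simpa [Prod.ext_iff] using hab) (fun t ht => ?_)).2
      (hH.finsum_int1' v).self
    -- The terms with equal indices contain a¹_0. In the neutral Fock space they vanish and do not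
    -- contribute to the interaction, whereas with charge κ they give the mixed bilinear ∑ a¹_{-n}
    -- a²_n of the background. For unequal indices the charge plays no role.
    · have g2 : HasFinsum (fun t : ℕ+ × ℕ+ => if t.1 = t.2 then
          mode 0 0 (-t.1) (mode 0 1 t.1 v) else 0)
          (∑ᶠ n : ℕ+, mode 0 0 (-n) (mode 0 1 n v)) := by
        refine (HasFinsum.of_injective (g := fun n : ℕ+ => (n, n))
          (fun a b hab => (Prod.ext_iff.1 hab).1) ?_).1
          ((hH.finsum_number 0 1 v).congr fun n => by simp)
        rintro ⟨a, b⟩ hab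
        exact if_neg fun h => hab ⟨a, Prod.ext rfl h⟩
      refine ((g1.add (g2.smul (κ 0))).smul _).congr fun t => ?_
      rcases lt_trichotomy t.1 t.2 with hlt | heq | hgt
      · have : ((t.1 : ℤ) - t.2) < 0 := by
          have := PNat.coe_lt_coe _ _ |>.2 hlt; omega
        rw [if_neg hlt.ne]
        simp [crossTerm, BoseTerm.op, hn1, hn2, hlt.le, hlt.not_gt,
          mode_eq_of_ne κ 0 0 this.ne]
      · simp [crossTerm, BoseTerm.op, hn1, hn2, heq, mode_zero]
      · have : 0 < ((t.1 : ℤ) - t.2) := by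
          have := PNat.coe_lt_coe _ _ |>.2 hgt; omega
        rw [if_neg hgt.ne']
        simp [crossTerm, BoseTerm.op, hn1, hn2, hgt, hgt.not_ge,
          mode_eq_of_ne κ 0 0 this.ne']
    · have : t.1 = 0 := by
        by_contra h
        exact ht ⟨(⟨t.1, Nat.pos_of_ne_zero h⟩, t.2), rfl⟩
      simp [this, mode_zero]
  have e3 : HasFinsum (fun t => (crossTerm p q r (.inr (.inr t))).op κ v)
      (int2 bose p r v) := by
    have := ((hH.finsum_int2 v).self.smul (-(2 * (r : ℂ) / (Real.sqrt p : ℝ))))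
    rw [neg_smul] at this
    refine this.congr fun t => ?_
    have h1 := hn1 1 (t.1 + t.2)
    have h2 : (0 : ℤ) < t.1 + t.2 := by have := t.1.pos; have := t.2.pos; omega
    push_cast at h1
    rw [hH.swap (by simp)]
    simp [crossTerm, BoseTerm.op, hn2, h1, h2, h2.not_ge]
  have e := (HasFinsum.sum (f := fun t => (crossTerm p q r t).op κ v) e1
    (HasFinsum.sum (f := fun t => (crossTerm p q r (.inr t)).op κ v) e2 e3))
  refine e.of_eq ?_
  rw [h0]
  unfold interaction int1 bose
  module

theorem isBosonicForm {p q : ℝ} (r : ℝ) (hp : 0 < p) (hq : 0 < q) :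
    IsBosonicForm p q (diffHam p q r) (fun N M v => laughlinHam bose p 0 v
      + laughlinHam bose q 1 v + interaction bose p q r v + background p q r N M v) := by
  refine ⟨_, formTerm p q r, formTerm_length p q r, fun N M => ⟨fun Z hinj hZ x =>
    hasSum_formTerm hp hq hinj hZ x, fun v => ?_⟩⟩
  have e := HasFinsum.sum (f := fun t => (formTerm p q r t).op
      (fun I => charge p q I * if I = 0 then (N : ℂ) else (M : ℂ)) v)
    (HasFinsum.sum (f := fun t => (formTerm p q r (.inl t)).op
      (fun I => charge p q I * if I = 0 then (N : ℂ) else (M : ℂ)) v)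
      (hasFinsum_layerTerm (κ := fun I => charge p q I * if I = 0 then (N : ℂ) else (M : ℂ))
        hp (I := 0) (P := N) (by simp [charge]) v)
      (hasFinsum_layerTerm (κ := fun I => charge p q I * if I = 0 then (N : ℂ) else (M : ℂ))
        hq (I := 1) (P := M) (by simp [charge]) v))
    (hasFinsum_crossTerm (r := r) (κ := fun I => charge p q I * if I = 0 then (N : ℂ) else (M : ℂ))
      hq (N := N) (M := M) (by simp [charge]) (by simp [charge]) v)
  refine ⟨e.1, ?_⟩
  rw [e.2]
  unfold background
  module

end Halperin

namespace Halperin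

/-! ### Fermions -/

/-- The fermion conjugate to `x`. -/
def Fermion.conj (x : Fermion) : Fermion := (x.1, !x.2.1, -x.2.2 - 1)

/-- The anticommutator of two fermions. -/
def anti (x y : Fermion) : ℂ := if y = Fermion.conj x then 1 else 0

/-- The vacuum expectation value of the product of two fermions. -/
def contraction (x y : Fermion) : ℂ := if 0 ≤ x.2.2 then anti x y else 0

theorem fermiOp_neg (I : Fin 2) (s : Bool) (k : ℕ) (v : Fermi) :
    fermiOp (I, s, Int.negSucc k) v
      = ExteriorAlgebra.ι ℂ (Finsupp.single ((I, s, k) : FermiMode) (1 : ℂ)) * v := rfl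

theorem fermiOp_nonneg (I : Fin 2) (s : Bool) (k : ℕ) (v : Fermi) :
    fermiOp (I, s, Int.ofNat k) v
      = CliffordAlgebra.contractLeft (Finsupp.lapply ((I, !s, k) : FermiMode)) v := rfl

theorem anti_comm (x y : Fermion) : anti x y = anti y x := by
  unfold anti Fermion.conj
  obtain ⟨I, s, k⟩ := x
  obtain ⟨J, t, l⟩ := y
  refine if_congr ?_ rfl rfl
  simp only [Prod.mk.injEq]
  constructor
  · rintro ⟨rfl, rfl, rfl⟩
    simp
  · rintro ⟨rfl, rfl, rfl⟩
    simp

theorem anti_mixed (I J : Fin 2) (s t : Bool) (k l : ℕ) :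
    anti (I, s, Int.ofNat k) (J, t, Int.negSucc l)
      = (Finsupp.single ((J, t, l) : FermiMode) (1 : ℂ)) (I, !s, k) := by
  unfold anti Fermion.conj
  rw [Finsupp.single_apply]
  refine if_congr ?_ rfl rfl
  simp only [Prod.mk.injEq, Int.ofNat_eq_natCast]
  refine and_congr_right fun _ => and_congr_right fun _ => ?_
  rw [Int.negSucc_eq]
  omega

/-- Contraction with a functional is an antiderivation of the exterior algebra; this gives the mixed
case. Two contractions anticommute, and so do two exterior multiplications. -/
theorem fermiOp_anticomm (x y : Fermion) (v : Fermi) :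
    fermiOp x (fermiOp y v) + fermiOp y (fermiOp x v) = anti x y • v := by
  have mixed : ∀ (I J : Fin 2) (s t : Bool) (k l : ℕ),
      fermiOp (I, s, Int.ofNat k) (fermiOp (J, t, Int.negSucc l) v)
        + fermiOp (J, t, Int.negSucc l) (fermiOp (I, s, Int.ofNat k) v)
        = anti (I, s, Int.ofNat k) (J, t, Int.negSucc l) • v := by
    intro I J s t k l
    simp only [fermiOp_neg, fermiOp_nonneg]
    rw [anti_mixed]
    have := CliffordAlgebra.contractLeft_ι_mul (Q := (0 : QuadraticForm ℂ (FermiMode →₀ ℂ)))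
      (d := Finsupp.lapply ((I, !s, k) : FermiMode))
      (Finsupp.single ((J, t, l) : FermiMode) (1 : ℂ)) v
    unfold ExteriorAlgebra.ι
    rw [this]
    simp
  obtain ⟨I, s, k | k⟩ := x <;> obtain ⟨J, t, l | l⟩ := y
  · have h0 : anti (I, s, Int.ofNat k) (J, t, Int.ofNat l) = 0 := by
      refine if_neg fun h => ?_
      simp only [Fermion.conj, Prod.mk.injEq, Int.ofNat_eq_natCast] at h
      omega
    rw [h0, zero_smul]
    simp only [fermiOp_nonneg]
    rw [CliffordAlgebra.contractLeft_comm, neg_add_cancel]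
  · exact mixed I J s t k l
  · rw [add_comm, anti_comm]
    exact mixed J I t s l k
  · have h0 : anti (I, s, Int.negSucc k) (J, t, Int.negSucc l) = 0 := by
      refine if_neg fun h => ?_
      simp only [Fermion.conj, Prod.mk.injEq, Int.negSucc_eq] at h
      omega
    rw [h0, zero_smul]
    simp only [fermiOp_neg]
    rw [← mul_assoc, ← mul_assoc, ← add_mul, ExteriorAlgebra.ι_add_mul_swap, zero_mul]

theorem fermiOp_mul (x y : Fermion) :
    fermiOp x * fermiOp y = anti x y • (1 : Module.End ℂ Fermi) + (-1 : ℂ) • (fermiOp y * fermiOp x) := by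
  refine LinearMap.ext fun v => ?_
  simp only [Module.End.mul_apply, LinearMap.add_apply, LinearMap.smul_apply, Module.End.one_apply]
  rw [← fermiOp_anticomm x y v]
  module

theorem anti_of_nonneg {x y : Fermion} (hx : 0 ≤ x.2.2) (hy : 0 ≤ y.2.2) : anti x y = 0 := by
  refine if_neg fun h => ?_
  rw [h] at hy
  simp only [Fermion.conj] at hy
  omega

/-- Each vector is built from finitely many creation modes, and an annihilator beyond all of them
passes through to the vacuum. Every finiteness statement about fermionic sums rests on this. -/
theorem fermiOp_eventually_zero (v : Fermi) :
    ∃ K : ℕ, ∀ x : Fermion, (K : ℤ) ≤ x.2.2 → fermiOp x v = 0 := by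
  induction v using CliffordAlgebra.left_induction with
  | algebraMap c =>
    refine ⟨0, ?_⟩
    rintro ⟨I, s, k | k⟩ hk
    · rw [fermiOp_nonneg, CliffordAlgebra.contractLeft_algebraMap]
    · exact absurd hk (by simp only [Int.negSucc_eq]; omega)
  | add a b ha hb =>
    obtain ⟨K, hK⟩ := ha
    obtain ⟨L, hL⟩ := hb
    refine ⟨K + L, fun x hx => ?_⟩
    rw [map_add, hK x (by push_cast at hx; omega), hL x (by push_cast at hx; omega), add_zero]
  | ι_mul a m ha =>
    obtain ⟨K, hK⟩ := ha
    refine ⟨K + m.support.sup (fun k => k.2.2) + 1, ?_⟩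
    rintro ⟨I, s, k | k⟩ hk
    · have h1 := hK (I, s, Int.ofNat k) (by
        have hk' : ((K + m.support.sup (fun k => k.2.2) + 1 : ℕ) : ℤ) ≤ (k : ℤ) := hk
        change (K : ℤ) ≤ (k : ℤ)
        omega)
      have h2 : m (I, !s, k) = 0 := by
        by_contra h
        have : k ≤ _ := Finset.le_sup (f := fun k : FermiMode => k.2.2)
          (Finsupp.mem_support_iff.2 h)
        have hk' : ((K + m.support.sup (fun k => k.2.2) + 1 : ℕ) : ℤ) ≤ (k : ℤ) := hk
        omega
      rw [fermiOp_nonneg] at h1 ⊢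
      rw [CliffordAlgebra.contractLeft_ι_mul, h1]
      simp [h2]
    · exact absurd hk (by simp only [Int.negSucc_eq]; omega)

theorem fermiOp_one {x : Fermion} (hx : 0 ≤ x.2.2) : fermiOp x 1 = 0 := by
  obtain ⟨I, s, k | k⟩ := x
  · rw [fermiOp_nonneg, CliffordAlgebra.contractLeft_one]
  · exact absurd hx (by simp only [Int.negSucc_eq]; omega)

/-! ### Normal ordering -/

theorem fermiOp_mul_prod {x : Fermion} {l : List Fermion} (h : ∀ y ∈ l, anti x y = 0) :
    fermiOp x * (l.map fermiOp).prod
      = (-1 : ℂ) ^ l.length • ((l.map fermiOp).prod * fermiOp x) := by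
  induction l with
  | nil => simp
  | cons y l ih =>
    rw [List.map_cons, List.prod_cons, ← mul_assoc, fermiOp_mul, h y (by simp), zero_smul,
      zero_add, smul_mul_assoc, mul_assoc, ih fun z hz => h z (by simp [hz]), List.length_cons, pow_succ,
      mul_smul_comm, mul_assoc]
    module

theorem normalOrdered_eq (l : List Fermion) : normalOrdered l = (-1 : ℂ) ^ inversions l •
    (((l.filter fun y => y.2.2 < 0) ++ (l.filter fun y => 0 ≤ y.2.2)).map fermiOp).prod := by
  rw [List.map_append, List.prod_append]
  rfl

theorem length_filter_neg_add (l : List Fermion) :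
    (l.filter fun y => y.2.2 < 0).length + (l.filter fun y => 0 ≤ y.2.2).length = l.length := by
  rw [← List.countP_eq_length_filter, ← List.countP_eq_length_filter,
    List.length_eq_countP_add_countP (fun y : Fermion => decide (y.2.2 < 0))]
  congr 1
  refine List.countP_congr fun y _ => ?_
  simp

theorem fermiOp_mul_normalOrdered {x : Fermion} {l : List Fermion} (h : ∀ y ∈ l, anti x y = 0) :
    fermiOp x * normalOrdered l = (-1 : ℂ) ^ l.length • (normalOrdered l * fermiOp x) := by
  rw [normalOrdered_eq, mul_smul_comm, fermiOp_mul_prod, List.length_append,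
    length_filter_neg_add, smul_mul_assoc, smul_comm]
  intro y hy
  rw [List.mem_append] at hy
  rcases hy with hy | hy <;> exact h y (List.mem_of_mem_filter hy)

theorem normalOrdered_nil : normalOrdered [] = 1 := by
  simp [normalOrdered, inversions]

theorem normalOrdered_cons_neg {x : Fermion} (hx : x.2.2 < 0) (l : List Fermion) :
    normalOrdered (x :: l) = fermiOp x * normalOrdered l := by
  simp only [normalOrdered, inversions, hx, hx.not_ge, if_false, zero_add, decide_true,
    List.filter_cons_of_pos, decide_false, Bool.false_eq_true, not_false_eq_true,
    List.filter_cons_of_neg, List.map_cons, List.prod_cons, mul_smul_comm, mul_assoc]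

/-- `inversions` counts only the creators to the right of an annihilator. Carrying x to the far
right crosses the annihilators as well; these anticommute with x and supply the rest of the sign
(-1)^{length l}. -/
theorem normalOrdered_cons_nonneg {x : Fermion} (hx : 0 ≤ x.2.2) (l : List Fermion) :
    normalOrdered (x :: l) = (-1 : ℂ) ^ l.length • (normalOrdered l * fermiOp x) := by
  have h1 := fermiOp_mul_prod (x := x) (l := l.filter fun y => 0 ≤ y.2.2) fun y hy =>
    anti_of_nonneg hx (by simpa using (List.mem_filter.1 hy).2)
  have h2 := length_filter_neg_add l
  simp only [normalOrdered, inversions, hx, hx.not_gt, if_true, decide_true,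
    List.filter_cons_of_pos, decide_false, Bool.false_eq_true, not_false_eq_true,
    List.filter_cons_of_neg, List.map_cons, List.prod_cons]
  rw [h1, List.countP_eq_length_filter, ← h2, smul_mul_assoc, smul_smul, mul_smul_comm, smul_smul,
    ← mul_assoc]
  congr 1
  ring

/-- The terms of Wick's theorem for the product of `x` with a normal ordered product. -/
def contractions (x : Fermion) : List Fermion → List (ℂ × List Fermion)
  | [] => []
  | y :: l => (anti x y, l) :: (contractions x l).map fun t => (-t.1, y :: t.2)

theorem length_of_mem_contractions {x : Fermion} {l : List Fermion} {t : ℂ × List Fermion}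
    (ht : t ∈ contractions x l) : t.2.length + 1 = l.length := by
  induction l generalizing t with
  | nil => simp [contractions] at ht
  | cons y l ih =>
    simp only [contractions, List.mem_cons, List.mem_map] at ht
    rcases ht with rfl | ⟨t, ht, rfl⟩
    · rfl
    · simp [ih ht]

/-- Induction on l: moving x past its first entry y yields the anticommutator of the two and a sign,
and the remaining list is treated by induction. A creator y stands on the left of the remaining
product and an annihilator y on its right, hence the two cases. -/
theorem wick_commutator {x : Fermion} (hx : 0 ≤ x.2.2) (l : List Fermion) :
    fermiOp x * normalOrdered l = (-1 : ℂ) ^ l.length • (normalOrdered l * fermiOp x)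
      + ((contractions x l).map fun t => t.1 • normalOrdered t.2).sum := by
  induction l with
  | nil => simp [normalOrdered_nil, contractions]
  | cons y l ih =>
    simp only [contractions, List.map_cons, List.sum_cons, List.map_map, Function.comp_def,
      List.length_cons]
    rcases lt_or_ge y.2.2 0 with hy | hy
    · have h1 : ((contractions x l).map fun t => -t.1 • normalOrdered (y :: t.2)).sum
          = (-1 : ℂ) • (fermiOp y * ((contractions x l).map fun t => t.1 • normalOrdered t.2).sum) := by
        rw [← List.sum_map_mul_left, List.smul_sum, List.map_map]
        congr 1
        refine List.map_congr_left fun t _ => ?_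
        rw [normalOrdered_cons_neg hy, Function.comp_apply, mul_smul_comm]
        module
      rw [h1, normalOrdered_cons_neg hy, ← mul_assoc, fermiOp_mul, add_mul, smul_mul_assoc,
        smul_mul_assoc, mul_assoc, ih, mul_add, mul_smul_comm, pow_succ]
      simp only [one_mul, mul_assoc]
      module
    · have h1 : ((contractions x l).map fun t => -t.1 • normalOrdered (y :: t.2)).sum
          = (-1 : ℂ) ^ l.length •
            (((contractions x l).map fun t => t.1 • normalOrdered t.2).sum * fermiOp y) := by
        rw [← List.sum_map_mul_right, List.smul_sum, List.map_map]
        congr 1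
        refine List.map_congr_left fun t ht => ?_
        rw [normalOrdered_cons_nonneg hy, Function.comp_apply, ← length_of_mem_contractions ht,
          pow_succ, smul_mul_assoc]
        module
      rw [h1, normalOrdered_cons_nonneg hy, mul_smul_comm, ← mul_assoc, ih, add_mul, pow_succ,
        anti_of_nonneg hx hy, smul_mul_assoc, smul_mul_assoc, mul_assoc, mul_assoc,
        fermiOp_mul x y, anti_of_nonneg hx hy]
      simp only [zero_smul, zero_add, mul_smul_comm]
      module

/-- Wick's theorem for the product of a fermion with a normal ordered product. -/
theorem wick (x : Fermion) (l : List Fermion) :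
    fermiOp x * normalOrdered l = normalOrdered (x :: l)
      + if 0 ≤ x.2.2 then ((contractions x l).map fun t => t.1 • normalOrdered t.2).sum else 0 := by
  split_ifs with hx
  · rw [wick_commutator hx, normalOrdered_cons_nonneg hx]
  · rw [normalOrdered_cons_neg (not_le.1 hx), add_zero]

theorem normalOrdered_singleton (x : Fermion) : normalOrdered [x] = fermiOp x := by
  rcases lt_or_ge x.2.2 0 with hx | hx
  · simp [normalOrdered_cons_neg hx, normalOrdered_nil]
  · simp [normalOrdered_cons_nonneg hx, normalOrdered_nil]

theorem fermiOp_mul_fermiOp (a b : Fermion) :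
    fermiOp a * fermiOp b = normalOrdered [a, b] + contraction a b • 1 := by
  rw [← normalOrdered_singleton b, wick]
  unfold contraction
  split_ifs <;> simp [contractions, normalOrdered_nil]

theorem fermiOp_mul_pair (x c d : Fermion) :
    fermiOp x * normalOrdered [c, d] = normalOrdered [x, c, d]
      + contraction x c • fermiOp d - contraction x d • fermiOp c := by
  rw [wick]
  unfold contraction
  split_ifs <;> simp [contractions, normalOrdered_singleton]
  module

theorem fermiOp_mul_triple (x b c d : Fermion) :
    fermiOp x * normalOrdered [b, c, d] = normalOrdered [x, b, c, d]
      + contraction x b • normalOrdered [c, d] - contraction x c • normalOrdered [b, d]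
      + contraction x d • normalOrdered [b, c] := by
  rw [wick]
  unfold contraction
  split_ifs <;> simp [contractions]
  module

/-- Wick's theorem for the product of two pairs. -/
theorem pair_mul_pair (a b c d : Fermion) :
    normalOrdered [a, b] * normalOrdered [c, d] = normalOrdered [a, b, c, d]
      + contraction b c • normalOrdered [a, d] - contraction b d • normalOrdered [a, c]
      + contraction a d • normalOrdered [b, c] - contraction a c • normalOrdered [b, d]
      + (contraction a d * contraction b c - contraction a c * contraction b d) • 1 := by
  -- The first pair is written as the plain product a b minus its contraction. The Wick formula for
  -- a single fermion is then applied twice, for b and for a.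
  have h := fermiOp_mul_fermiOp a b
  rw [← sub_eq_iff_eq_add] at h
  rw [← h, sub_mul, mul_assoc, fermiOp_mul_pair, mul_sub, mul_add, fermiOp_mul_triple,
    mul_smul_comm, mul_smul_comm, fermiOp_mul_fermiOp, fermiOp_mul_fermiOp, smul_mul_assoc, one_mul]
  module

/-- Used for fermions of different layers. An annihilator at the head ends up at the far right on
either side, and crossing l₂ costs the same sign (-1)^{length l₂} in both. -/
theorem normalOrdered_append {l₁ l₂ : List Fermion} (h : ∀ x ∈ l₁, ∀ y ∈ l₂, anti x y = 0) :
    normalOrdered (l₁ ++ l₂) = normalOrdered l₁ * normalOrdered l₂ := by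
  induction l₁ with
  | nil => simp [normalOrdered_nil]
  | cons x l₁ ih =>
    have ih' := ih fun z hz => h z (by simp [hz])
    rcases lt_or_ge x.2.2 0 with hx | hx
    · rw [List.cons_append, normalOrdered_cons_neg hx, normalOrdered_cons_neg hx, ih', mul_assoc]
    · have h1 := fermiOp_mul_normalOrdered (x := x) (l := l₂) (h x (by simp))
      have h2 : ((-1 : ℂ) ^ l₂.length * (-1 : ℂ) ^ l₂.length) = 1 := by
        rw [← mul_pow]; simp
      rw [List.cons_append, normalOrdered_cons_nonneg hx, normalOrdered_cons_nonneg hx, ih',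
        List.length_append, smul_mul_assoc, mul_assoc _ (fermiOp x), h1, mul_smul_comm, smul_smul,
        pow_add, mul_assoc]

/-- Annihilators anticommute with one another, so up to sign x can be made the first operator to act
on v. -/
theorem normalOrdered_apply_eq_zero {l : List Fermion} {x : Fermion} (hx : x ∈ l)
    (hx0 : 0 ≤ x.2.2) {v : Fermi} (hv : fermiOp x v = 0) : normalOrdered l v = 0 := by
  have key : ∀ L : List Fermion, (∀ y ∈ L, 0 ≤ y.2.2) → x ∈ L → (L.map fermiOp).prod v = 0 := by
    intro L hL hxL
    induction L with
    | nil => simp at hxL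
    | cons y L ih =>
      by_cases hxL' : x ∈ L
      · rw [List.map_cons, List.prod_cons, Module.End.mul_apply,
          ih (fun z hz => hL z (by simp [hz])) hxL', map_zero]
      · obtain rfl : x = y := by simpa [hxL'] using hxL
        rw [List.map_cons, List.prod_cons, fermiOp_mul_prod fun z hz =>
          anti_of_nonneg hx0 (hL z (by simp [hz]))]
        simp [hv]
  unfold normalOrdered
  rw [LinearMap.smul_apply, Module.End.mul_apply,
    key _ (fun y hy => by simpa using (List.mem_filter.1 hy).2)
      (List.mem_filter.2 ⟨hx, by simpa using hx0⟩), map_zero, smul_zero]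

end Halperin

namespace Halperin

/-! ### Currents -/

/-- The two mode numbers add up to n - 1, so outside a bounded range of k one of them is at least K
and annihilates v. -/
theorem hasFinsum_current (I : Fin 2) (n : ℤ) (v : Fermi) :
    HasFinsum (fun k : ℤ => normalOrdered [psi I (n - k - 1), psiStar I k] v) (current I n v) := by
  obtain ⟨K, hK⟩ := fermiOp_eventually_zero v
  refine HasFinsum.of_subset (Set.finite_Icc (n - K - 1) K) fun k hk => ?_
  have hk' : ¬(n - K - 1 ≤ k ∧ k ≤ K) := hk
  by_cases h : (K : ℤ) ≤ k
  · exact normalOrdered_apply_eq_zero (x := psiStar I k) (by simp)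
      (by change 0 ≤ k; omega) (hK _ h)
  · exact normalOrdered_apply_eq_zero (x := psi I (n - k - 1)) (by simp)
      (by change 0 ≤ n - k - 1; omega) (hK _ (by change (K : ℤ) ≤ n - k - 1; omega))

/-- The current as a linear map. -/
def currentMap (I : Fin 2) (n : ℤ) : Module.End ℂ Fermi where
  toFun := current I n
  map_add' u v := ((hasFinsum_current I n (u + v)).unique
    (((hasFinsum_current I n u).add (hasFinsum_current I n v)).congr fun _ => map_add _ _ _))
  map_smul' c v := ((hasFinsum_current I n (c • v)).unique
    (((hasFinsum_current I n v).smul c).congr fun _ => map_smul _ _ _))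

theorem currentMap_apply (I : Fin 2) (n : ℤ) (v : Fermi) : currentMap I n v = current I n v := rfl

theorem current_eq_zero {K : ℕ} {v : Fermi} (hK : ∀ x : Fermion, (K : ℤ) ≤ x.2.2 → fermiOp x v = 0)
    (I : Fin 2) {n : ℤ} (hn : 2 * K + 1 ≤ n) (k : ℤ) :
    normalOrdered [psi I (n - k - 1), psiStar I k] v = 0 := by
  by_cases h : (K : ℤ) ≤ k
  · exact normalOrdered_apply_eq_zero (x := psiStar I k) (by simp)
      (by change 0 ≤ k; omega) (hK _ h)
  · exact normalOrdered_apply_eq_zero (x := psi I (n - k - 1)) (by simp)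
      (by change 0 ≤ n - k - 1; omega) (hK _ (by change (K : ℤ) ≤ n - k - 1; omega))

theorem anti_psi_psi (I J : Fin 2) (k l : ℤ) : anti (psi I k) (psi J l) = 0 :=
  if_neg fun h => by simp [psi, Fermion.conj] at h

theorem anti_star_star (I J : Fin 2) (k l : ℤ) : anti (psiStar I k) (psiStar J l) = 0 :=
  if_neg fun h => by simp [psiStar, Fermion.conj] at h

theorem anti_psi_star (I J : Fin 2) (k l : ℤ) :
    anti (psi I k) (psiStar J l) = if I = J ∧ k + l + 1 = 0 then 1 else 0 := by
  refine if_congr ?_ rfl rfl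
  simp only [psi, psiStar, Fermion.conj, Prod.mk.injEq]
  constructor
  · rintro ⟨rfl, -, h⟩; exact ⟨rfl, by omega⟩
  · rintro ⟨rfl, h⟩; exact ⟨rfl, rfl, by omega⟩

theorem anti_star_psi (I J : Fin 2) (k l : ℤ) :
    anti (psiStar I k) (psi J l) = if I = J ∧ k + l + 1 = 0 then 1 else 0 := by
  rw [anti_comm, anti_psi_star]
  exact if_congr (and_congr eq_comm (by rw [add_comm l])) rfl rfl

theorem contraction_psi_psi (I J : Fin 2) (k l : ℤ) : contraction (psi I k) (psi J l) = 0 := by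
  simp [contraction, anti_psi_psi]

theorem contraction_star_star (I J : Fin 2) (k l : ℤ) :
    contraction (psiStar I k) (psiStar J l) = 0 := by
  simp [contraction, anti_star_star]

theorem contraction_psi_star (I J : Fin 2) (k l : ℤ) :
    contraction (psi I k) (psiStar J l) = if 0 ≤ k ∧ I = J ∧ k + l + 1 = 0 then 1 else 0 := by
  unfold contraction
  rw [anti_psi_star, ← ite_and]
  rfl

theorem contraction_star_psi (I J : Fin 2) (k l : ℤ) :
    contraction (psiStar I k) (psi J l) = if 0 ≤ k ∧ I = J ∧ k + l + 1 = 0 then 1 else 0 := by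
  unfold contraction
  rw [anti_star_psi, ← ite_and]
  rfl

theorem pair_fermiOp (a b x : Fermion) (v : Fermi) :
    normalOrdered [a, b] (fermiOp x v) = fermiOp x (normalOrdered [a, b] v)
      + (anti b x • fermiOp a v - anti a x • fermiOp b v) := by
  have h : normalOrdered [a, b] = fermiOp a * fermiOp b - contraction a b • 1 := by
    rw [fermiOp_mul_fermiOp]; module
  have h1 := fermiOp_anticomm b x v
  have h2 := fermiOp_anticomm a x (fermiOp b v)
  rw [h]
  simp only [LinearMap.sub_apply, Module.End.mul_apply, LinearMap.smul_apply, Module.End.one_apply,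
    map_sub, map_smul]
  rw [eq_sub_of_add_eq h1, map_sub, map_smul, eq_sub_of_add_eq h2]
  module

theorem current_psi (I J : Fin 2) (n k : ℤ) (v : Fermi) :
    current I n (fermiOp (psi J k) v) = fermiOp (psi J k) (current I n v)
      + if I = J then fermiOp (psi J (k + n)) v else 0 := by
  refine (hasFinsum_current I n _).unique ?_
  have h1 := HasFinsum.single (V := Fermi) (-k - 1) (f := fun l : ℤ =>
    (if I = J ∧ l + k + 1 = 0 then (1 : ℂ) else 0) • fermiOp (psi I (n - l - 1)) v) fun l hl => by
      rw [if_neg (by omega), zero_smul]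
  refine (((hasFinsum_current I n v).map (fermiOp (psi J k))).add h1).of_eq ?_ |>.congr fun l => ?_
  · congr 1
    by_cases h : I = J
    · subst h
      rw [if_pos ⟨rfl, by omega⟩, if_pos rfl, one_smul]
      congr 3
      omega
    · simp [h]
  · rw [pair_fermiOp, anti_star_psi, anti_psi_psi, zero_smul, sub_zero]

theorem current_psiStar (I J : Fin 2) (n k : ℤ) (v : Fermi) :
    current I n (fermiOp (psiStar J k) v) = fermiOp (psiStar J k) (current I n v)
      - if I = J then fermiOp (psiStar J (k + n)) v else 0 := by
  refine (hasFinsum_current I n _).unique ?_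
  have h1 := HasFinsum.single (V := Fermi) (n + k) (f := fun l : ℤ =>
    (if I = J ∧ (n - l - 1) + k + 1 = 0 then (1 : ℂ) else 0) • fermiOp (psiStar I l) v)
    fun l hl => by rw [if_neg (by omega), zero_smul]
  refine (((hasFinsum_current I n v).map (fermiOp (psiStar J k))).sub h1).of_eq ?_ |>.congr
    fun l => ?_
  · congr 1
    by_cases h : I = J
    · subst h
      rw [if_pos ⟨rfl, by omega⟩, if_pos rfl, one_smul, add_comm]
    · simp [h]
  · rw [pair_fermiOp, anti_star_star, anti_psi_star, zero_smul, zero_sub, ← sub_eq_add_neg]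

/-- The source of the central term: the occupied levels and their shift by n differ by n, counted
with sign. -/
theorem hasFinsum_step_difference (n : ℤ) :
    HasFinsum (fun k : ℤ => (if k < 0 then (1 : ℂ) else 0) - if k + n < 0 then 1 else 0) n := by
  rcases le_total 0 n with hn | hn
  · refine (HasFinsum.finset (Finset.Ico (-n) 0) fun k hk => ?_).of_eq ?_
    · simp only [Finset.mem_Ico, not_and, not_lt] at hk
      split_ifs <;> first | omega | simp
    · rw [Finset.sum_congr rfl (g := fun _ => (1 : ℂ)) fun k hk => ?_]
      · simp
        lift n to ℕ using hn
        simp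
      · have := Finset.mem_Ico.1 hk
        rw [if_pos this.2, if_neg (by omega), sub_zero]
  · refine (HasFinsum.finset (Finset.Ico 0 (-n)) fun k hk => ?_).of_eq ?_
    · simp only [Finset.mem_Ico, not_and, not_lt] at hk
      split_ifs <;> first | omega | simp
    · rw [Finset.sum_congr rfl (g := fun _ => (-1 : ℂ)) fun k hk => ?_]
      · obtain ⟨m, rfl⟩ : ∃ m : ℕ, n = -m := ⟨n.natAbs, by omega⟩
        simp
      · have := Finset.mem_Ico.1 hk
        rw [if_neg (by omega), if_pos (by omega), zero_sub]

/-- A current shifts the index of ψ and of ψ* by n, with opposite signs. The commutator with one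
normal ordered pair is hence a difference of two pairs shifted against each other, plus the
difference of their vacuum expectation values. Summed over k, the pairs cancel by translation, as
both sums are finite, and the expectation values leave n when n + m = 0. -/
theorem current_comm (I J : Fin 2) (n m : ℤ) (v : Fermi) :
    current I n (current J m v) - current J m (current I n v)
      = if I = J ∧ n + m = 0 then (n : ℂ) • v else 0 := by
  have h1 := (hasFinsum_current J m v).map (currentMap I n)
  have h2 := hasFinsum_current J m (current I n v)
  have h3 := h1.sub h2
  simp only [currentMap_apply] at h3
  have term : ∀ k : ℤ, current I n (normalOrdered [psi J (m - k - 1), psiStar J k] v)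
      - normalOrdered [psi J (m - k - 1), psiStar J k] (current I n v)
      = if I = J then
        (normalOrdered [psi J (n + m - k - 1), psiStar J k] v
          - normalOrdered [psi J (n + m - (k + n) - 1), psiStar J (k + n)] v)
          + ((contraction (psi J (n + m - k - 1)) (psiStar J k)
          - contraction (psi J (m - k - 1)) (psiStar J (k + n))) • v)
        else 0 := by
    intro k
    have e : ∀ a b : Fermion, ∀ u, normalOrdered [a, b] u
        = fermiOp a (fermiOp b u) - contraction a b • u := by
      intro a b u
      have := congrArg (fun T : Module.End ℂ Fermi => T u) (fermiOp_mul_fermiOp a b)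
      simp only [Module.End.mul_apply, LinearMap.add_apply, LinearMap.smul_apply,
        Module.End.one_apply] at this
      rw [this]; abel
    have hsub : current I n (fermiOp (psi J (m - k - 1)) (fermiOp (psiStar J k) v)
          - contraction (psi J (m - k - 1)) (psiStar J k) • v)
        = current I n (fermiOp (psi J (m - k - 1)) (fermiOp (psiStar J k) v))
          - contraction (psi J (m - k - 1)) (psiStar J k) • current I n v := by
      simp only [← currentMap_apply, map_sub, map_smul]
    rw [e, hsub, current_psi, current_psiStar, e, e, e]
    have i1 : n + m - (k + n) - 1 = m - k - 1 := by ring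
    have i2 : m - k - 1 + n = n + m - k - 1 := by ring
    rw [i1, i2]
    split_ifs
    · rw [map_sub]; module
    · simp
  rcases eq_or_ne I J with rfl | hIJ
  · simp only [if_true] at term
    have g1 := hasFinsum_current I (n + m) v
    have g2 := (HasFinsum.of_equiv (Equiv.addRight n)).2 g1
    have g3 : HasFinsum (fun k : ℤ => ((contraction (psi I (n + m - k - 1)) (psiStar I k)
          - contraction (psi I (m - k - 1)) (psiStar I (k + n))) • v))
        (if n + m = 0 then (n : ℂ) • v else 0) := by
      split_ifs with hnm
      · refine ((hasFinsum_step_difference n).map ((LinearMap.id (R := ℂ) (M := ℂ)).smulRight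
          v)).congr fun k => ?_
        simp only [LinearMap.smulRight_apply, LinearMap.id_apply]
        congr 1
        rw [contraction_psi_star, contraction_psi_star]
        congr 1 <;> exact if_congr (by simp only [true_and]; omega) rfl rfl
      · refine HasFinsum.zero.congr fun k => ?_
        rw [contraction_psi_star, contraction_psi_star, if_neg (by omega), if_neg (by omega),
          sub_zero, zero_smul]
    rw [h3.unique (((g1.sub g2).add g3).congr term), sub_self, zero_add]
    simp
  · simp only [hIJ, if_false] at term
    rw [h3.unique (HasFinsum.zero.congr term), if_neg (by simp [hIJ])]

theorem isHeisenberg_current : IsHeisenberg currentMap where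
  comm := current_comm
  nil v := by
    obtain ⟨K, hK⟩ := fermiOp_eventually_zero v
    refine ⟨2 * K + 1, fun I n hn => (hasFinsum_current I n v).unique
      (HasFinsum.zero.congr fun k => current_eq_zero hK I (by exact_mod_cast hn) k)⟩

theorem current_one {I : Fin 2} {n : ℤ} (hn : 0 ≤ n) : current I n 1 = 0 := by
  refine (hasFinsum_current I n 1).unique (HasFinsum.zero.congr fun k => ?_)
  by_cases h : 0 ≤ k
  · exact normalOrdered_apply_eq_zero (x := psiStar I k) (by simp) h (fermiOp_one h)
  · have h' : 0 ≤ (psi I (n - k - 1)).2.2 := by change 0 ≤ n - k - 1; omega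
    exact normalOrdered_apply_eq_zero (x := psi I (n - k - 1)) (by simp) h' (fermiOp_one h')

end Halperin

namespace Halperin

/-! ### Quadratic expressions in the currents of one layer -/

section Quadratic

variable (I : Fin 2) {n k : ℤ} (w : Fermi)

/-- The product of two currents as a sum of products of pairs. -/
theorem hasFinsum_current_current (n l : ℤ) :
    HasFinsum (fun x : ℤ × ℤ => normalOrdered [psi I (n - x.2 - 1), psiStar I x.2]
      (normalOrdered [psi I (l - x.1 - 1), psiStar I x.1] w)) (current I n (current I l w)) := by
  have h1 := hasFinsum_current I l w
  have h := HasFinsum.uncurry (f := fun x : ℤ × ℤ =>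
    normalOrdered [psi I (n - x.2 - 1), psiStar I x.2]
      (normalOrdered [psi I (l - x.1 - 1), psiStar I x.1] w)) h1.1 (fun a ha b => by
        have : normalOrdered [psi I (l - a - 1), psiStar I a] w = 0 := by simpa using ha
        simp [this])
    (fun a => hasFinsum_current I n (normalOrdered [psi I (l - a - 1), psiStar I a] w))
  have h2 := (h1.map (currentMap I n)).eq
  simp only [currentMap_apply] at h2
  rwa [h2] at h

/-- The remainder of the product of two currents after normal ordering. -/
def wickRemainder (l : ℤ) (c : ℤ) : Fermi :=
  normalOrdered [psi I (-c - 1), psiStar I (c + l)] w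
    + normalOrdered [psiStar I (-c - 1), psi I (c + l)] w

theorem exists_wickRemainder_eq_zero (l : ℤ) :
    ∃ K : ℕ, ∀ c : ℤ, K ≤ c → wickRemainder I w l c = 0 := by
  obtain ⟨K, hK⟩ := fermiOp_eventually_zero w
  refine ⟨K + l.natAbs, fun c hc => ?_⟩
  have h0 : (K : ℤ) ≤ c + l := by omega
  unfold wickRemainder
  rw [normalOrdered_apply_eq_zero (x := psiStar I (c + l)) (by simp)
      (by change 0 ≤ c + l; omega) (hK _ h0),
    normalOrdered_apply_eq_zero (x := psi I (c + l)) (by simp)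
      (by change 0 ≤ c + l; omega) (hK _ h0), add_zero]

/-- Wick's theorem applied to each term of the product of two currents: only ψ* with ψ and ψ with ψ*
can contract. Each of the two single contractions leaves a one-parameter family of pairs, and
together they form `wickRemainder`. -/
theorem hasFinsum_normalOrdered_four (hk : k ≠ 0) (n : ℤ) :
    HasFinsum (fun x : ℤ × ℤ => normalOrdered [psi I (-n - x.2 - 1), psiStar I x.2,
      psi I (n + k - x.1 - 1), psiStar I x.1] w)
      (current I (-n) (current I (n + k) w) - ∑ᶠ i : ℕ, wickRemainder I w k (n + i)) := by
  have h0 := hasFinsum_current_current I w (-n) (n + k)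
  obtain ⟨K, hK⟩ := fermiOp_eventually_zero w
  have f1 : HasFinsum (fun i : ℕ => normalOrdered [psi I (-(n + i) - 1), psiStar I (n + i + k)] w)
      (∑ᶠ i : ℕ, normalOrdered [psi I (-(n + i) - 1), psiStar I (n + i + k)] w) := by
    refine HasFinsum.of_subset (Set.finite_Iic (K + (n + k).natAbs)) fun i hi => ?_
    simp only [Set.mem_Iic, not_le] at hi
    exact normalOrdered_apply_eq_zero (x := psiStar I (n + i + k)) (by simp)
      (by change 0 ≤ n + i + k; omega) (hK _ (by change (K : ℤ) ≤ n + i + k; omega))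
  have f2 : HasFinsum (fun i : ℕ => normalOrdered [psiStar I (-(n + i) - 1), psi I (n + i + k)] w)
      (∑ᶠ i : ℕ, normalOrdered [psiStar I (-(n + i) - 1), psi I (n + i + k)] w) := by
    refine HasFinsum.of_subset (Set.finite_Iic (K + (n + k).natAbs)) fun i hi => ?_
    simp only [Set.mem_Iic, not_le] at hi
    exact normalOrdered_apply_eq_zero (x := psi I (n + i + k)) (by simp)
      (by change 0 ≤ n + i + k; omega) (hK _ (by change (K : ℤ) ≤ n + i + k; omega))
  have g1 : HasFinsum (fun x : ℤ × ℤ => contraction (psiStar I x.2) (psi I (n + k - x.1 - 1)) •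
      normalOrdered [psi I (-n - x.2 - 1), psiStar I x.1] w)
      (∑ᶠ i : ℕ, normalOrdered [psi I (-(n + i) - 1), psiStar I (n + i + k)] w) := by
    -- The contraction requires the mode of ψ* to be some i ≥ 0 and ties the other summation index
    -- to it, so the contracted terms are parametrized by i.
    refine (HasFinsum.of_injective (g := fun i : ℕ => ((n + i + k, (i : ℤ)) : ℤ × ℤ))
      (fun a b hab => by simpa using (Prod.ext_iff.1 hab).2) ?_).1 (f1.congr fun i => ?_)
    · rintro ⟨a, b⟩ hab
      rw [contraction_star_psi, if_neg, zero_smul]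
      rintro ⟨hb, -, h⟩
      exact hab ⟨b.toNat, Prod.ext (by simp only at hb h ⊢; omega) (by simp only at hb ⊢; omega)⟩
    · rw [contraction_star_psi, if_pos ⟨by simp, rfl, by ring⟩, one_smul]
      congr 4
      simp only; ring
  have g2 : HasFinsum (fun x : ℤ × ℤ => contraction (psi I (-n - x.2 - 1)) (psiStar I x.1) •
      normalOrdered [psiStar I x.2, psi I (n + k - x.1 - 1)] w)
      (∑ᶠ i : ℕ, normalOrdered [psiStar I (-(n + i) - 1), psi I (n + i + k)] w) := by
    refine (HasFinsum.of_injective (g := fun i : ℕ => ((-i - 1, -(n + i) - 1) : ℤ × ℤ))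
      (fun a b hab => by have := (Prod.ext_iff.1 hab).1; simp only at this; omega) ?_).1
      (f2.congr fun i => ?_)
    · rintro ⟨a, b⟩ hab
      rw [contraction_psi_star, if_neg, zero_smul]
      rintro ⟨hb, -, h⟩
      exact hab ⟨(-n - b - 1).toNat, Prod.ext (by simp only at hb h ⊢; omega)
        (by simp only at hb ⊢; omega)⟩
    · rw [contraction_psi_star, if_pos ⟨by simp only; omega, rfl, by simp only; ring⟩, one_smul]
      congr 5
      simp only; ring
  refine ((h0.sub (g1.add g2)).of_eq ?_).congr fun x => ?_
  · congr 1
    exact ((f1.add f2).congr fun i => rfl).eq.symm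
  · have := congrArg (fun T : Module.End ℂ Fermi => T w) (pair_mul_pair (psi I (-n - x.2 - 1))
      (psiStar I x.2) (psi I (n + k - x.1 - 1)) (psiStar I x.1))
    simp only [Module.End.mul_apply, LinearMap.add_apply,
      LinearMap.smul_apply, Module.End.one_apply, contraction_psi_psi, contraction_star_star,
      zero_smul, sub_zero, zero_mul] at this
    -- Both contractions at once would force k = 0.
    have hz : contraction (psi I (-n - x.2 - 1)) (psiStar I x.1)
        * contraction (psiStar I x.2) (psi I (n + k - x.1 - 1)) = 0 := by
      rw [contraction_psi_star, contraction_star_psi]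
      split_ifs <;> first | omega | simp
    rw [hz, zero_smul, add_zero] at this
    rw [this]
    abel

/-- A remainder with index c arises from every n ≥ s and i ≥ 0 with n + i = c, that is c + 1 - s
times. With ρ = c + ½ these are the weights ρ + ½ for s = 0 and ρ - ½ for s = 1. The bound s ≤ 1
keeps c + 1 - s nonnegative. -/
theorem hasFinsum_count {V : Type} [AddCommGroup V] [Module ℂ V] {R : ℤ → V} {K : ℕ}
    (hR : ∀ c : ℤ, K ≤ c → R c = 0) {s : ℕ} (hs : s ≤ 1) :
    HasFinsum (fun x : ℕ × ℕ => R ((x.1 + s : ℕ) + x.2))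
      (∑ᶠ c : ℕ, ((c : ℂ) + 1 - s) • R c) := by
  have h1 : HasFinsum (fun x : ℕ × ℕ => if x.2 + s ≤ x.1 then R x.1 else 0)
      (∑ᶠ c : ℕ, ((c : ℂ) + 1 - s) • R c) := by
    refine HasFinsum.uncurry (Set.finite_Iic K) (fun c hc i => ?_) fun c => ?_
    · simp only [Set.mem_Iic, not_le] at hc
      simp [hR c (by omega)]
    · refine (HasFinsum.finset (Finset.range (c + 1 - s)) fun i hi => if_neg (by
        simp only [Finset.mem_range] at hi
        simp only; omega)).of_eq ?_
      rw [Finset.sum_congr rfl (g := fun _ => R c) fun i hi => if_pos (by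
        have := Finset.mem_range.1 hi
        simp only; omega), Finset.sum_const, Finset.card_range, ← Nat.cast_smul_eq_nsmul ℂ,
        Nat.cast_sub (by omega)]
      push_cast
      rfl
  refine ((HasFinsum.of_injective (g := fun x : ℕ × ℕ => (x.1 + s + x.2, x.2)) ?_ ?_).2 h1).congr
    fun x => ?_
  · rintro ⟨a, b⟩ ⟨c, d⟩ h
    simp only [Prod.mk.injEq] at h ⊢
    omega
  · rintro ⟨a, b⟩ h
    refine if_neg fun h' => h ⟨(a - b - s, b), Prod.ext ?_ rfl⟩
    simp only at h' ⊢
    omega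
  · rw [if_pos (by simp only; omega)]
    push_cast
    rfl

/-- Normal ordering of `∑_{n ≥ s} a_{-n} a_{n+k}`. -/
theorem finsum_current_current (hk : k ≠ 0) {s : ℕ} (hs : s ≤ 1) :
    ∑ᶠ t : ℕ, current I (-(t + s : ℕ)) (current I ((t + s : ℕ) + k) w)
      = (∑ᶠ (i : ℤ) (j : ℤ) (g : ℤ) (h : ℤ),
        if i + j + g + h + 2 = k ∧ i + j + 1 ≤ -(s : ℤ) then
          normalOrdered [psi I i, psiStar I j, psi I g, psiStar I h] w else 0)
        + ∑ᶠ c : ℕ, ((c : ℂ) + 1 - s) • wickRemainder I w k c := by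
  obtain ⟨K, hK⟩ := exists_wickRemainder_eq_zero I w k
  obtain ⟨L, hL⟩ := fermiOp_eventually_zero w
  have hfin : (Set.Iic (K + 2 * L + 1 + k.natAbs) : Set ℕ).Finite := Set.finite_Iic _
  have r1 := (hasFinsum_count hK hs).curry
  have vanish : ∀ t : ℕ, t ∉ Set.Iic (K + 2 * L + 1 + k.natAbs) →
      ∀ h : ℤ, normalOrdered [psi I ((t + s : ℕ) + k - h - 1), psiStar I h] w = 0 := by
    intro t ht h
    simp only [Set.mem_Iic, not_le] at ht
    exact current_eq_zero hL I (by push_cast; omega) h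
  have r2 : HasFinsum (fun t : ℕ => current I (-(t + s : ℕ)) (current I ((t + s : ℕ) + k) w))
      (∑ᶠ t : ℕ, current I (-(t + s : ℕ)) (current I ((t + s : ℕ) + k) w)) := by
    refine HasFinsum.of_subset hfin fun t ht => ?_
    rw [(hasFinsum_current I _ w).unique (HasFinsum.zero.congr (vanish t ht)),
      ← currentMap_apply, map_zero]
  have r3 := r2.sub r1
  have r4 : HasFinsum (fun x : ℕ × (ℤ × ℤ) => normalOrdered [psi I (-(x.1 + s : ℕ) - x.2.2 - 1),
      psiStar I x.2.2, psi I ((x.1 + s : ℕ) + k - x.2.1 - 1), psiStar I x.2.1] w)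
      (∑ᶠ t : ℕ, (current I (-(t + s : ℕ)) (current I ((t + s : ℕ) + k) w)
        - ∑ᶠ i : ℕ, wickRemainder I w k ((t + s : ℕ) + i))) := by
    refine HasFinsum.uncurry hfin (fun t ht x => ?_) fun t =>
      hasFinsum_normalOrdered_four I w hk (t + s : ℕ)
    simp only [Set.mem_Iic, not_le] at ht
    by_cases h : (L : ℤ) ≤ x.1
    · exact normalOrdered_apply_eq_zero (x := psiStar I x.1) (by simp) (by change 0 ≤ x.1; omega)
        (hL _ h)
    · exact normalOrdered_apply_eq_zero (x := psi I ((t + s : ℕ) + k - x.1 - 1)) (by simp)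
        (by change 0 ≤ ((t + s : ℕ) : ℤ) + k - x.1 - 1; push_cast; omega)
        (hL _ (by change (L : ℤ) ≤ ((t + s : ℕ) : ℤ) + k - x.1 - 1; push_cast; omega))
  rw [r3.eq] at r4
  have r5 : HasFinsum (fun x : ℤ × ℤ × ℤ × ℤ =>
      if x.1 + x.2.1 + x.2.2.1 + x.2.2.2 + 2 = k ∧ x.1 + x.2.1 + 1 ≤ -(s : ℤ) then
        normalOrdered [psi I x.1, psiStar I x.2.1, psi I x.2.2.1, psiStar I x.2.2.2] w else 0)
      (∑ᶠ t : ℕ, current I (-(t + s : ℕ)) (current I ((t + s : ℕ) + k) w)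
        - ∑ᶠ c : ℕ, ((c : ℂ) + 1 - s) • wickRemainder I w k c) := by
    -- The total mode of the first pair, i + j + 1, equals -(t + s). Thus t ≥ 0 is the inequality on
    -- i + j, and the total mode k of all four fermions is the equation.
    refine (HasFinsum.of_injective (g := fun x : ℕ × (ℤ × ℤ) => ((-(x.1 + s : ℕ) - x.2.2 - 1,
      x.2.2, (x.1 + s : ℕ) + k - x.2.1 - 1, x.2.1) : ℤ × ℤ × ℤ × ℤ)) ?_ ?_).1 (r4.congr fun x => ?_)
    · rintro ⟨a, b, c⟩ ⟨a', b', c'⟩ h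
      simp only [Prod.mk.injEq] at h ⊢
      push_cast at h
      omega
    · rintro ⟨i, j, g, h⟩ hn
      refine if_neg fun h' => hn ⟨((-(i + j + 1) - s).toNat, h, j), ?_⟩
      simp only [Prod.mk.injEq, true_and, and_true] at h' ⊢
      push_cast
      omega
    · exact if_pos (by push_cast; constructor <;> omega)
  rw [← sub_eq_iff_eq_add, ← r5.curry.eq]
  refine finsum_congr fun i => ?_
  rw [← (r5.fiber i).curry.eq]
  refine finsum_congr fun j => ?_
  exact ((r5.fiber i).fiber j).curry.eq.symm

end Quadratic

/-! ### The fermionic form of the interaction -/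

theorem hasFinsum_current_shift (I : Fin 2) (m : ℤ) (v : Fermi) :
    HasFinsum (fun b : ℤ => normalOrdered [psi I (-b - 1), psiStar I (m + b)] v)
      (current I m v) :=
  ((HasFinsum.of_equiv (Equiv.addLeft m)).2 (hasFinsum_current I m v)).congr fun b => by
    simp only [Equiv.coe_addLeft]
    congr 4
    ring

theorem anti_of_layer_ne {x y : Fermion} (h : x.1 ≠ y.1) : anti x y = 0 :=
  if_neg fun h' => h (by rw [h']; rfl)

theorem normalOrdered_four_two {I J : Fin 2} (hIJ : I ≠ J) (i j g h a b : ℤ) (v : Fermi) :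
    normalOrdered [psi I i, psiStar I j, psi I g, psiStar I h, psi J a, psiStar J b] v
      = normalOrdered [psi I i, psiStar I j, psi I g, psiStar I h]
        (normalOrdered [psi J a, psiStar J b] v) := by
  have := normalOrdered_append (l₁ := [psi I i, psiStar I j, psi I g, psiStar I h])
    (l₂ := [psi J a, psiStar J b]) fun x hx y hy => anti_of_layer_ne (by
      simp only [List.mem_cons, List.not_mem_nil, or_false] at hx hy
      rcases hx with rfl | rfl | rfl | rfl <;> rcases hy with rfl | rfl <;> exact hIJ)
  exact congrArg (fun T : Module.End ℂ Fermi => T v) this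

theorem normalOrdered_two_two {I J : Fin 2} (hIJ : I ≠ J) {x y : Fermion} (hx : x.1 = I)
    (hy : y.1 = I) (a b : ℤ) (v : Fermi) :
    normalOrdered [x, y, psi J a, psiStar J b] v
      = normalOrdered [x, y] (normalOrdered [psi J a, psiStar J b] v) := by
  have := normalOrdered_append (l₁ := [x, y])
    (l₂ := [psi J a, psiStar J b]) fun x' hx' y' hy' => anti_of_layer_ne (by
      have h1 : x'.1 = I := by
        simp only [List.mem_cons, List.not_mem_nil, or_false] at hx'
        rcases hx' with rfl | rfl <;> assumption
      have h2 : y'.1 = J := by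
        simp only [List.mem_cons, List.not_mem_nil, or_false] at hy'
        rcases hy' with rfl | rfl <;> rfl
      rwa [h1, h2])
  exact congrArg (fun T : Module.End ℂ Fermi => T v) this

theorem finsum_four_two {I J : Fin 2} (hIJ : I ≠ J) (l i j g h : ℤ) (v : Fermi) (P Q : Prop)
    [Decidable (P ∧ Q)] :
    (if P ∧ Q then normalOrdered [psi I i, psiStar I j, psi I g, psiStar I h] (current J l v) else 0)
      = ∑ᶠ (b : ℤ) (_ : P) (_ : Q), normalOrdered [psi I i, psiStar I j, psi I g, psiStar I h,
        psi J (-b - 1), psiStar J (l + b)] v := by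
  by_cases hP : P <;> by_cases hQ : Q
  · simp only [hP, hQ, and_self, if_true, finsum_true]
    refine (((hasFinsum_current_shift J l v).map _).congr fun b => ?_).eq.symm
    exact normalOrdered_four_two hIJ _ _ _ _ _ _ v
  · simp [hP, hQ]
  · simp [hP, hQ]
  · simp [hP, hQ]

theorem finsum_two_two {I J : Fin 2} (hIJ : I ≠ J) (l k c : ℤ) (a : ℂ) (v : Fermi) :
    a • wickRemainder I (current J l v) k c = ∑ᶠ b : ℤ, a •
      (normalOrdered [psi I (-c - 1), psiStar I (c + k), psi J (-b - 1), psiStar J (l + b)] v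
        + normalOrdered [psiStar I (-c - 1), psi I (c + k), psi J (-b - 1), psiStar J (l + b)] v) := by
  refine ((((((hasFinsum_current_shift J l v).map (normalOrdered
    [psi I (-c - 1), psiStar I (c + k)])).add ((hasFinsum_current_shift J l v).map (normalOrdered
    [psiStar I (-c - 1), psi I (c + k)]))).smul a)).congr fun b => ?_).eq.symm
  rw [normalOrdered_two_two hIJ rfl rfl, normalOrdered_two_two hIJ rfl rfl]

/-- The normal ordered form of `∑_{n ≥ s} a^I_{-n} a^I_{n+k} a^J_l`. -/
theorem finsum_current_current_current {I J : Fin 2} (hIJ : I ≠ J) {k : ℤ} (hk : k ≠ 0) {s : ℕ}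
    (hs : s ≤ 1) (l : ℤ) (v : Fermi) :
    ∑ᶠ t : ℕ, current I (-(t + s : ℕ)) (current I ((t + s : ℕ) + k) (current J l v))
      = (∑ᶠ (i : ℤ) (j : ℤ) (g : ℤ) (h : ℤ) (b : ℤ) (_ : i + j + g + h + 2 = k)
          (_ : i + j + 1 ≤ -(s : ℤ)), normalOrdered [psi I i, psiStar I j, psi I g, psiStar I h,
            psi J (-b - 1), psiStar J (l + b)] v)
        + ∑ᶠ (c : ℕ) (b : ℤ), ((c : ℂ) + 1 - s) •
          (normalOrdered [psi I (-c - 1), psiStar I (c + k), psi J (-b - 1), psiStar J (l + b)] v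
            + normalOrdered [psiStar I (-c - 1), psi I (c + k),
              psi J (-b - 1), psiStar J (l + b)] v) := by
  rw [finsum_current_current I (current J l v) hk hs]
  congr 1
  · refine finsum_congr fun i => finsum_congr fun j => finsum_congr fun g => finsum_congr fun h => ?_
    exact finsum_four_two hIJ _ _ _ _ _ v _ _
  · exact finsum_congr fun c => finsum_two_two hIJ l k c _ v

theorem finsum_pnat_add {f g : ℕ+ → Fermi} {K : ℕ} (hf : ∀ m : ℕ+, K ≤ m → f m = 0)
    (hg : ∀ m : ℕ+, K ≤ m → g m = 0) : ∑ᶠ m, (f m + g m) = ∑ᶠ m, f m + ∑ᶠ m, g m := by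
  have hfin : {n : ℕ+ | (n : ℕ) ≤ K}.Finite :=
    (Set.finite_Iic K).preimage PNat.coe_injective.injOn
  refine ((HasFinsum.of_subset hfin fun m hm => hf m ?_).add
    (HasFinsum.of_subset hfin fun m hm => hg m ?_)).eq <;>
  · have : ¬ (m : ℕ) ≤ K := hm
    omega

/-- The normal ordering formula with s = 0, k = -m and l = m. Vanishing for large m is checked
separately for the quartic and the quadratic part, because a sum can be split only when both parts
have finite support. -/
theorem int1_current (q r : ℝ) (v : Fermi) : int1 current q r v = fermiInt1 q r v := by
  unfold int1 fermiInt1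
  congr 1
  have h1 := (isHeisenberg_current.finsum_int1' v).eq
  simp only [currentMap_apply] at h1
  rw [h1]
  obtain ⟨K, hK⟩ := fermiOp_eventually_zero v
  have hz : ∀ m : ℕ+, 2 * K + 1 ≤ (m : ℕ) → ∀ b : ℤ,
      normalOrdered [psi 1 (-b - 1), psiStar 1 (m + b)] v = 0 := by
    intro m hm b
    have := current_eq_zero hK 1 (n := m) (by exact_mod_cast hm) (m + b)
    rwa [show (m : ℤ) - (m + b) - 1 = -b - 1 by ring] at this
  rw [← finsum_pnat_add (K := 2 * K + 1)]
  · refine finsum_congr fun m => ?_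
    have h2 := finsum_current_current_current (I := 0) (J := 1) (by decide) (k := -(m : ℤ))
      (by have := m.pos; omega) (s := 0) (by omega) m v
    simp only [Nat.cast_zero, neg_zero, sub_zero, add_zero, ← sub_eq_add_neg] at h2 ⊢
    exact h2
  · intro m hm
    simp [normalOrdered_four_two (I := 0) (J := 1) (by decide), hz m hm]
  · intro m hm
    simp [normalOrdered_two_two (I := 0) (J := 1) (by decide) (x := psi 0 _) (y := psiStar 0 _)
      rfl rfl, normalOrdered_two_two (I := 0) (J := 1) (by decide) (x := psiStar 0 _)
      (y := psi 0 _) rfl rfl, hz m hm]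

theorem int2_current (p r : ℝ) (v : Fermi) : int2 current p r v = fermiInt2 p r v := by
  unfold int2 fermiInt2
  congr 2
  have hH := isHeisenberg_current
  obtain ⟨K, hK⟩ := fermiOp_eventually_zero v
  -- The layer-1 current commutes with both layer-2 currents and is moved to the right, so that it
  -- acts first. The index n > 0 becomes t + 1, hence s = 1 below and the strict inequality on i +
  -- j.
  have h1 : ∑ᶠ t : ℕ+ × ℕ+, current 0 (-t.2) (current 1 (-t.1) (current 1 (t.1 + t.2) v))
      = ∑ᶠ m : ℕ+, ∑ᶠ t : ℕ, current 1 (-(t + 1 : ℕ)) (current 1 ((t + 1 : ℕ) + m)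
        (current 0 (-m) v)) := by
    have h2 := (HasFinsum.of_equiv (Equiv.prodComm ℕ+ ℕ+)).2 (hH.finsum_int2 v)
    rw [show (∑ᶠ t : ℕ+ × ℕ+, current 0 (-t.2) (current 1 (-t.1) (current 1 (t.1 + t.2) v))) = _
      from h2.curry.eq.symm]
    refine finsum_congr fun m => ?_
    rw [← finsum_comp_equiv Equiv.pnatEquivNat]
    refine finsum_congr fun n => ?_
    have hn : ((Equiv.pnatEquivNat n + 1 : ℕ) : ℤ) = n := by
      simp [PNat.natPred_add_one]
    simp only [hn, Equiv.prodComm_apply, Prod.swap]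
    change currentMap 0 (-m) (currentMap 1 (-n) (currentMap 1 (n + m) v))
      = currentMap 1 (-n) (currentMap 1 (n + m) (currentMap 0 (-m) v))
    rw [hH.swap (by simp), hH.swap (I := 0) (J := 1) (by simp)]
  rw [h1]
  -- As i + j ≤ -2, the other two modes satisfy g + h ≥ m, so one of them is at least K.
  have hz : ∀ m : ℕ+, 2 * K + 1 ≤ (m : ℕ) → ∀ i j g h b : ℤ, i + j + g + h + 2 = m → 
      i + j + 1 < 0 → normalOrdered [psi 1 i, psiStar 1 j, psi 1 g, psiStar 1 h,
        psi 0 (-b - 1), psiStar 0 (-m + b)] v = 0 := by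
    intro m hm i j g h b h1 h2
    by_cases hg : (K : ℤ) ≤ g
    · exact normalOrdered_apply_eq_zero (x := psi 1 g) (by simp) (by change 0 ≤ g; omega) (hK _ hg)
    · exact normalOrdered_apply_eq_zero (x := psiStar 1 h) (by simp) (by change 0 ≤ h; omega)
        (hK _ (by change (K : ℤ) ≤ h; omega))
  rw [← finsum_pnat_add (K := 2 * K + 1)]
  · refine finsum_congr fun m => ?_
    have h2 := finsum_current_current_current (I := 1) (J := 0) (by decide) (k := (m : ℤ))
      (by have := m.pos; omega) (s := 1) (by omega) (-m) v
    rw [h2]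
    congr 1
    · refine finsum_congr fun i => finsum_congr fun j => finsum_congr fun g => finsum_congr fun h =>
        finsum_congr fun b => finsum_congr fun _ => finsum_congr_Prop ?_ fun _ => rfl
      simp only [Nat.cast_one, eq_iff_iff]
      omega
    · simp
  · intro m hm
    refine (finsum_congr fun i => (finsum_congr fun j => (finsum_congr fun g =>
      (finsum_congr fun h => (finsum_congr fun b => ?_).trans finsum_zero).trans
        finsum_zero).trans finsum_zero).trans finsum_zero).trans finsum_zero
    by_cases h1 : i + j + g + h + 2 = m <;> by_cases h2 : i + j + 1 < 0
    · simp [hz m hm i j g h b h1 h2]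
    · simp [h2]
    · simp [h1]
    · simp [h1]
  · intro m hm
    refine (finsum_congr fun c => (finsum_congr fun b => ?_).trans finsum_zero).trans finsum_zero
    have hc : (K : ℤ) ≤ c + m := by omega
    rw [normalOrdered_apply_eq_zero (x := psiStar 1 (c + m)) (by simp)
      (by change (0 : ℤ) ≤ c + m; omega) (hK _ hc),
      normalOrdered_apply_eq_zero (x := psi 1 (c + m)) (by simp)
      (by change (0 : ℤ) ≤ c + m; omega) (hK _ hc), add_zero, smul_zero]

/-! ### Bosonization -/

theorem eq_C_of_pderiv_eq_zero {σ : Type*} {v : MvPolynomial σ ℂ}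
    (h : ∀ k, MvPolynomial.pderiv k v = 0) : v = MvPolynomial.C (v.coeff 0) := by
  classical
  ext m
  rw [MvPolynomial.coeff_C]
  split_ifs with hm
  · rw [hm]
  · obtain ⟨i, hi⟩ := Finsupp.ne_iff.1 (Ne.symm hm)
    have := congrArg (MvPolynomial.coeff (m - Finsupp.single i 1)) (h i)
    rw [MvPolynomial.coeff_pderiv, MvPolynomial.coeff_zero,
      Finsupp.sub_add_single_one_cancel (by simpa using hi)] at this
    exact (mul_eq_zero.1 this).resolve_right (Nat.cast_add_one_ne_zero _)

/-- Induction on the degree, by means of the partial derivatives. -/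
theorem pderiv_induction {σ : Type*} {P : MvPolynomial σ ℂ → Prop} (h0 : P 0)
    (h : ∀ v, (∀ k, P (MvPolynomial.pderiv k v)) → P v) (v : MvPolynomial σ ℂ) : P v := by
  have key : ∀ n : ℕ, ∀ v : MvPolynomial σ ℂ, (∀ m, v.coeff m ≠ 0 → m.degree < n) → P v := by
    intro n
    induction n with
    | zero =>
      intro v hv
      have : v = 0 := by
        ext m
        by_contra hm
        exact absurd (hv m hm) (by omega)
      rwa [this]
    | succ n ih =>
      intro v hv
      refine h v fun k => ih _ fun m hm => ?_
      rw [MvPolynomial.coeff_pderiv] at hm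
      have := hv _ (left_ne_zero_of_mul hm)
      rw [map_add, Finsupp.degree_single] at this
      omega
  refine key (v.totalDegree + 1) v fun m hm => ?_
  have := MvPolynomial.le_totalDegree (MvPolynomial.mem_support_iff.2 hm)
  rw [Finsupp.degree_apply]
  simp only [Finsupp.sum] at this
  omega

/-- Evaluation of polynomials asks for a commutative target; it is provided by the subalgebra
generated by the commuting elements f i. -/
theorem exists_aeval_of_commute {σ A : Type*} [Ring A] [Algebra ℂ A] (f : σ → A)
    (h : ∀ i j, f i * f j = f j * f i) :
    ∃ g : MvPolynomial σ ℂ →ₐ[ℂ] A, ∀ i, g (MvPolynomial.X i) = f i := by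
  have hc : IsMulCommutative (Algebra.adjoin ℂ (Set.range f)) :=
    Algebra.isMulCommutative_adjoin ℂ (by rintro _ ⟨i, rfl⟩ _ ⟨j, rfl⟩; exact h i j)
  let _ : CommRing (Algebra.adjoin ℂ (Set.range f)) :=
    { (inferInstance : Ring (Algebra.adjoin ℂ (Set.range f))) with
      mul_comm := fun a b => hc.is_comm.comm a b }
  let f' : σ → Algebra.adjoin ℂ (Set.range f) := fun i =>
    ⟨f i, Algebra.subset_adjoin (Set.mem_range_self i)⟩
  exact ⟨(Algebra.adjoin ℂ (Set.range f)).val.comp (MvPolynomial.aeval f'), fun i => by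
    simp [f']⟩

/-- Φ(v) is the polynomial v in the negative currents, applied to the vacuum. Negative modes are
intertwined by construction. For the others one inducts on v: they kill the vacuum and obey the same
commutation relations on both sides. -/
theorem exists_bosonization : ∃ Φ : Fock →ₗ[ℂ] Fermi, Function.Injective Φ ∧ Φ 1 = 1 ∧
    ∀ I n v, Φ (bose I n v) = current I n (Φ v) := by
  have hH := isHeisenberg_current
  obtain ⟨g, hg⟩ := exists_aeval_of_commute (fun k : Fin 2 × ℕ+ => currentMap k.1 (-k.2))
    fun i j => LinearMap.ext fun v => hH.swap (by
      have := i.2.pos; have := j.2.pos; omega) v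
  let Φ : Fock →ₗ[ℂ] Fermi := (LinearMap.applyₗ (1 : Fermi)).comp g.toLinearMap
  have hΦ : ∀ v, Φ v = g v 1 := fun v => rfl
  have h1 : Φ 1 = 1 := by rw [hΦ, map_one g]; rfl
  have hX : ∀ k v, Φ (v * MvPolynomial.X k) = current k.1 (-k.2) (Φ v) := by
    intro k v
    rw [hΦ, mul_comm, map_mul, hg]
    rfl
  have hnonneg : ∀ I, ∀ n : ℤ, 0 ≤ n → ∀ v, Φ (bose I n v) = current I n (Φ v) := by
    intro I n hn v
    induction v using MvPolynomial.induction_on with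
    | C a =>
      have hC : (MvPolynomial.C a : Fock) = a • 1 := by rw [MvPolynomial.smul_eq_C_mul, mul_one]
      have hb : bose I n (1 : Fock) = 0 := by
        rcases int_cases n with ⟨m, rfl⟩ | rfl | ⟨m, rfl⟩
        · simp [bose, mode_pos]
        · exact bose_zero I 1
        · have := m.pos; omega
      have hb' : bose I n (a • (1 : Fock)) = a • bose I n 1 := map_smul (mode 0 I n) a 1
      rw [hC, hb', hb, smul_zero, map_zero, map_smul, h1, ← currentMap_apply, map_smul,
        currentMap_apply, current_one hn, smul_zero]
    | add u v hu hv =>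
      have hb' : bose I n (u + v) = bose I n u + bose I n v := map_add (mode 0 I n) u v
      rw [hb', map_add, hu, hv, map_add]
      exact (map_add (currentMap I n) _ _).symm
    | mul_X v k hv =>
      have hc := mode_comm 0 I k.1 n (-k.2) v
      have hc' := current_comm I k.1 n (-k.2) (Φ v)
      rw [mode_neg, mul_comm] at hc
      rw [hX]
      have e1 : bose I n (v * MvPolynomial.X k) = bose I n v * MvPolynomial.X k
          + if I = k.1 ∧ n + -(k.2 : ℤ) = 0 then (n : ℂ) • v else 0 := by
        rw [← hc, mode_neg]
        change _ = _ + (bose I n (v * MvPolynomial.X k) - MvPolynomial.X (k.1, k.2) * bose I n v)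
        rw [mul_comm (MvPolynomial.X _)]
        abel
      rw [e1, map_add, hX, hv, eq_add_of_sub_eq' hc', apply_ite Φ, map_smul, map_zero]
  have hall : ∀ I n v, Φ (bose I n v) = current I n (Φ v) := by
    intro I n v
    rcases le_or_gt 0 n with hn | hn
    · exact hnonneg I n hn v
    · rcases int_cases n with ⟨m, rfl⟩ | rfl | ⟨m, rfl⟩
      · have := m.pos; omega
      · omega
      · rw [← hX (I, m) v]
        congr 1
        exact (mode_neg 0 I m v).trans (mul_comm _ _)
  refine ⟨Φ, ?_, h1, hall⟩
  rw [injective_iff_map_eq_zero]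
  -- The kernel is stable under the positive modes, that is under all partial derivatives. By
  -- induction the derivatives of a kernel element vanish, so it is a constant, and Φ 1 = 1 makes
  -- that constant zero.
  refine pderiv_induction (fun _ => rfl) fun v ih hv => ?_
  have hder : ∀ k, MvPolynomial.pderiv k v = 0 := fun k => ih k (by
    have := hall k.1 k.2 v
    rw [hv, ← currentMap_apply, map_zero] at this
    have h2 : bose k.1 k.2 v = (k.2 : ℂ) • MvPolynomial.pderiv k v := mode_pos 0 k.1 k.2 v
    rw [h2, map_smul] at this
    exact (smul_eq_zero.1 this).resolve_left (by exact_mod_cast k.2.pos.ne'))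
  have hv' := eq_C_of_pderiv_eq_zero hder
  rw [hv', ← mul_one (MvPolynomial.C _), ← MvPolynomial.smul_eq_C_mul, map_smul, h1] at hv
  rw [hv', (smul_eq_zero.1 hv).resolve_right one_ne_zero, map_zero]

theorem exists_fermionization (p q r : ℝ) : ∃ Φ : Fock →ₗ[ℂ] Fermi,
    Function.Injective Φ ∧ Φ 1 = 1 ∧ (∀ I n v, Φ (bose I n v) = current I n (Φ v)) ∧
    ∀ v, Φ (interaction bose p q r v) = fermiInt1 q r (Φ v) + fermiInt2 p r (Φ v) := by
  obtain ⟨Φ, hinj, h1, hΦ⟩ := exists_bosonization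
  refine ⟨Φ, hinj, h1, hΦ, fun v => ?_⟩
  rw [← int1_current, ← int2_current, interaction, map_add]
  congr 1
  · exact (isHeisenberg_mode 0).map_int1 (B := currentMap) Φ hΦ q r v
  · exact (isHeisenberg_mode 0).map_int2 (B := currentMap) Φ hΦ p r v

end Halperin

namespace Halperin

open MvPolynomial

/-! ### Symmetric functions as polynomials in the power sums -/

/-- The chain rule. -/
theorem hasFinsum_derivation_aeval {σ A : Type*} [CommRing A] [Algebra ℂ A]
    (D : Derivation ℂ A A) (g : σ → A) (f : MvPolynomial σ ℂ) :
    HasFinsum (fun n => aeval g (pderiv n f) * D (g n)) (D (aeval g f)) := by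
  classical
  induction f using MvPolynomial.induction_on with
  | C a => simpa using HasFinsum.zero
  | add u v hu hv =>
    rw [map_add, map_add]
    exact (hu.add hv).congr fun n => by rw [map_add, map_add, add_mul]
  | mul_X v k hv =>
    have h1 := HasFinsum.single (f := fun n => aeval g v * aeval g (pderiv n (X k : MvPolynomial σ ℂ)) * D (g n)) k
      fun n hn => by rw [pderiv_X_of_ne hn.symm, map_zero, mul_zero, zero_mul]
    refine ((h1.add (hv.map (AddMonoidHom.mulLeft (g k)))).of_eq ?_).congr fun n => ?_
    · rw [map_mul, aeval_X, Derivation.leibniz, pderiv_X_self, map_one, mul_one]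
      rfl
    · rw [Derivation.leibniz, map_add, smul_eq_mul, smul_eq_mul, map_mul, map_mul, aeval_X, add_mul,
        AddMonoidHom.coe_mulLeft, mul_assoc (g k)]

/-- The symmetric polynomial, in variables indexed by `ι`, of a polynomial in the power sums. -/
def psumHom (ι : Type) [Fintype ι] : MvPolynomial ℕ+ ℂ →ₐ[ℂ] MvPolynomial ι ℂ :=
  aeval fun n => psum ι ℂ n

theorem psumHom_X (ι : Type) [Fintype ι] (n : ℕ+) : psumHom ι (X n) = psum ι ℂ n := aeval_X _ _

theorem pderiv_psum {ι : Type} [Fintype ι] (i : ι) (n : ℕ) :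
    pderiv i (psum ι ℂ n) = (n : MvPolynomial ι ℂ) * X i ^ (n - 1) := by
  classical
  simp [psum, pderiv_X, Pi.single_apply]

/-- The weight of a monomial in the power sums. -/
def pweight : (ℕ+ →₀ ℕ) →+ ℕ := Finsupp.weight fun n : ℕ+ => (n : ℕ)

theorem pweight_single (k : ℕ+) : pweight (Finsupp.single k 1) = k := by
  simp [pweight, Finsupp.weight_single]

/-- Algebraic independence of the power sums in N variables, up to weight N. The induction is on the
degree in the power sums: all derivatives are shown to be zero, which leaves a constant. -/
theorem eq_zero_of_toSymm_eq_zero {N : ℕ} (f : MvPolynomial ℕ+ ℂ)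
    (hf : ∀ d, f.coeff d ≠ 0 → pweight d ≤ N) (h : toSymm N f = 0) : f = 0 := by
  revert hf h
  refine pderiv_induction (P := fun f => (∀ d, f.coeff d ≠ 0 → pweight d ≤ N) →
    toSymm N f = 0 → f = 0) (fun _ _ => rfl) (fun f ih hf h => ?_) f
  have hbound : ∀ k d, (pderiv k f).coeff d ≠ 0 → pweight d + k ≤ N := fun k d hd => by
    rw [coeff_pderiv] at hd
    have := hf _ (left_ne_zero_of_mul hd)
    rwa [map_add, pweight_single] at this
  have hN : ∀ k : ℕ+, pderiv k f ≠ 0 → (k : ℕ) ≤ N := fun k hk => by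
    obtain ⟨d, hd⟩ := MvPolynomial.ne_zero_iff.1 hk
    have := hbound k d hd
    omega
  -- Differentiating the vanishing polynomial in x_j gives ∑_n n x_j^{n-1} (∂_n f)(p) = 0 for each
  -- j. This is a Vandermonde system with distinct nodes x_j, and the weight bound restricts it to n
  -- ≤ N.
  have hvan : (fun i : Fin N => toSymm N (pderiv i.1.succPNat f) * ((i.1 + 1 : ℕ) : MvPolynomial _ ℂ))
      = 0 := by
    refine Matrix.eq_zero_of_forall_index_sum_pow_mul_eq_zero (f := fun j : Fin N =>
      (X j : MvPolynomial (Fin N) ℂ)) (X_injective) fun j => ?_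
    have h1 := hasFinsum_derivation_aeval (pderiv j) (fun n : ℕ+ => psum (Fin N) ℂ n) f
    have h2 := (HasFinsum.of_injective (g := fun i : Fin N => i.1.succPNat) (fun a b hab => by
      have := congrArg PNat.val hab
      simpa [Fin.ext_iff] using this) (fun k hk => by
      have : pderiv k f = 0 := by
        by_contra hne
        have hkN := hN k hne
        have hkp := k.pos
        refine hk ⟨⟨k - 1, by omega⟩, PNat.eq ?_⟩
        simp only [Nat.succPNat_coe]
        omega
      rw [this, map_zero, zero_mul])).2 h1
    rw [show aeval (fun n : ℕ+ => psum (Fin N) ℂ n) f = 0 from h, map_zero] at h2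
    rw [← (HasFinsum.fintype _).unique h2]
    refine Finset.sum_congr rfl fun i _ => ?_
    rw [pderiv_psum]
    simp only [Nat.succPNat_coe, Nat.succ_eq_add_one, Nat.add_sub_cancel]
    change _ = toSymm N _ * _
    ring
  have hder : ∀ k, pderiv k f = 0 := fun k => by
    by_contra hne
    have hkN := hN k hne
    have hkp := k.pos
    refine hne (ih k (fun d hd => by have := hbound k d hd; omega) ?_)
    have := congrFun hvan ⟨k - 1, by omega⟩
    have hk : ((k : ℕ) - 1).succPNat = k := PNat.eq (by simp only [Nat.succPNat_coe]; omega)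
    simp only [hk, Pi.zero_apply] at this
    exact (mul_eq_zero.1 this).resolve_right (Nat.cast_ne_zero.2 (Nat.succ_ne_zero _))
  have hC := eq_C_of_pderiv_eq_zero hder
  rw [hC, toSymm, aeval_C, MvPolynomial.algebraMap_eq, C_eq_zero] at h
  rw [hC, h, map_zero]

/-! ### Coefficients of symmetric polynomials -/

/-- The parts of `lam` are the nonzero exponents of `e`. -/
def HasShape {ι : Type} [Fintype ι] (e : ι →₀ ℕ) {n : ℕ} (lam : n.Partition) : Prop :=
  ∀ k, 0 < k → Fintype.card {i // e i = k} = lam.parts.count k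

theorem HasShape.parts_eq {ι : Type} [Fintype ι] {e : ι →₀ ℕ} {n m : ℕ} {lam : n.Partition}
    {mu : m.Partition} (h : HasShape e lam) (h' : HasShape e mu) : lam.parts = mu.parts := by
  ext k
  rcases Nat.eq_zero_or_pos k with rfl | hk
  · rw [Multiset.count_eq_zero_of_notMem fun h => (lam.parts_pos h).false,
      Multiset.count_eq_zero_of_notMem fun h => (mu.parts_pos h).false]
  · rw [← h k hk, ← h' k hk]

theorem hasShape_ofSym {ι : Type} [Fintype ι] [DecidableEq ι] {n : ℕ} (s : Sym ι n) :
    HasShape (Multiset.toFinsupp s.1) (Nat.Partition.ofSym s) := by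
  intro k hk
  rw [Fintype.card_subtype]
  simp only [Multiset.toFinsupp_apply, Nat.Partition.ofSym]
  rw [Multiset.count_map]
  change _ = (s.1.toFinset.filter fun a => k = s.1.count a).card
  congr 1
  ext i
  constructor
  · intro h
    have h' : s.1.count i = k := (Finset.mem_filter.1 h).2
    exact Finset.mem_filter.2 ⟨Multiset.mem_toFinset.2 (Multiset.count_pos.1 (h' ▸ hk)), h'.symm⟩
  · exact fun h => Finset.mem_filter.2 ⟨Finset.mem_univ _, (Finset.mem_filter.1 h).2.symm⟩

theorem exists_hasShape {ι : Type} [Fintype ι] {n : ℕ} {e : ι →₀ ℕ} (he : e.degree = n) :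
    ∃ lam : n.Partition, HasShape e lam := by
  classical
  refine ⟨Nat.Partition.ofSym ⟨Finsupp.toMultiset e, by rwa [Finsupp.card_toMultiset]⟩, ?_⟩
  have := hasShape_ofSym (⟨Finsupp.toMultiset e, by rwa [Finsupp.card_toMultiset]⟩ : Sym ι n)
  rwa [Finsupp.toMultiset_toFinsupp] at this

theorem HasShape.degree_eq {ι : Type} [Fintype ι] {e : ι →₀ ℕ} {n : ℕ} {lam : n.Partition}
    (h : HasShape e lam) : e.degree = n := by
  obtain ⟨mu, hmu⟩ := exists_hasShape (rfl : e.degree = _)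
  rw [← lam.parts_sum, h.parts_eq hmu, mu.parts_sum]

theorem HasShape.unique {ι : Type} [Fintype ι] {e : ι →₀ ℕ} {n : ℕ} {lam mu : n.Partition}
    (h : HasShape e lam) (h' : HasShape e mu) : lam = mu :=
  Nat.Partition.ext (h.parts_eq h')

theorem coeff_msymm {ι : Type} [Fintype ι] [DecidableEq ι] {n : ℕ} (mu : n.Partition) (e : ι →₀ ℕ)
    [Decidable (HasShape e mu)] :
    coeff e (msymm ι ℂ mu) = if HasShape e mu then 1 else 0 := by
  have hm : ∀ s : Sym ι n, (s.1.map X).prod = monomial (Multiset.toFinsupp s.1) (1 : ℂ) := by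
    intro s
    induction s.1 using Multiset.induction_on with
    | empty => simp
    | cons a t ih =>
      rw [Multiset.map_cons, Multiset.prod_cons, ih, X, monomial_mul, one_mul,
        ← Multiset.singleton_add, map_add, Multiset.toFinsupp_singleton]
  rw [msymm, coeff_sum]
  simp only [hm, coeff_monomial]
  split_ifs with h
  · have hs : ∀ h', Nat.Partition.ofSym (⟨Finsupp.toMultiset e, h'⟩ : Sym ι n) = mu := fun h' =>
      (by simpa using hasShape_ofSym (⟨Finsupp.toMultiset e, h'⟩ : Sym ι n) :
        HasShape e _).unique h
    have hc : (Finsupp.toMultiset e).card = n := by rw [Finsupp.card_toMultiset]; exact h.degree_eq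
    rw [Finset.sum_eq_single ⟨⟨Finsupp.toMultiset e, hc⟩, hs hc⟩, if_pos (by simp)]
    · rintro s - hne
      refine if_neg fun h' => hne (Subtype.ext (Subtype.ext ?_))
      exact (Multiset.toFinsupp_toMultiset s.1.1).symm.trans (congrArg Finsupp.toMultiset h')
    · simp
  · refine Finset.sum_eq_zero fun s _ => if_neg fun h' => h ?_
    have := hasShape_ofSym s.1
    rwa [h', s.2] at this

/-! ### Coefficients do not depend on the choice of variables -/

theorem coeff_killCompl {ι κ : Type} {j : ι → κ} (hj : Function.Injective j)
    (F : MvPolynomial κ ℂ) (e : ι →₀ ℕ) :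
    coeff e (killCompl hj F) = coeff (e.mapDomain j) F := by
  classical
  induction F using MvPolynomial.induction_on' with
  | add u v hu hv => rw [map_add, coeff_add, coeff_add, hu, hv]
  | monomial s a =>
    by_cases hs : (s.support : Set κ) ⊆ Set.range j
    · have : s = (s.comapDomain j hj.injOn).mapDomain j :=
        (Finsupp.mapDomain_comapDomain j hj s hs).symm
      rw [this, killCompl_monomial_mapDomain, coeff_monomial, coeff_monomial]
      simp only [(Finsupp.mapDomain_injective hj).eq_iff]
    · rw [killCompl_monomial_eq_zero_of_not_subset hj _ hs, coeff_zero, coeff_monomial, if_neg]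
      rintro rfl
      refine hs fun k hk => ?_
      have := Finsupp.mapDomain_support hk
      simp only [Finset.mem_image] at this
      obtain ⟨i, -, rfl⟩ := this
      exact ⟨i, rfl⟩

theorem killCompl_psumHom {ι κ : Type} [Fintype ι] [Fintype κ] {j : ι → κ}
    (hj : Function.Injective j) (f : MvPolynomial ℕ+ ℂ) :
    killCompl hj (psumHom κ f) = psumHom ι f := by
  suffices h : (killCompl hj).comp (psumHom κ) = psumHom ι from DFunLike.congr_fun h f
  refine MvPolynomial.algHom_ext fun n => ?_
  rw [AlgHom.comp_apply, psumHom_X, psumHom_X, psum, psum, map_sum]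
  symm
  refine Fintype.sum_of_injective j hj _ _ (fun k hk => ?_) fun i => ?_
  · rw [map_pow, killCompl, aeval_X, dif_neg hk, zero_pow n.ne_zero]
  · rw [map_pow, ← rename_X j, killCompl_rename_app]

/-- Setting the variables with exponent zero to zero changes neither coefficient and maps power sums
to power sums. What remains are two sets of variables with the same multiset of positive exponents,
matched by the bijection σ. -/
theorem coeff_psumHom_congr {ι κ : Type} [Fintype ι] [Fintype κ] {n : ℕ} {lam : n.Partition}
    {e : ι →₀ ℕ} {e' : κ →₀ ℕ} (h : HasShape e lam) (h' : HasShape e' lam)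
    (f : MvPolynomial ℕ+ ℂ) : coeff e (psumHom ι f) = coeff e' (psumHom κ f) := by
  classical
  let α := {i // e i ≠ 0}
  let α' := {i // e' i ≠ 0}
  have hcard : ∀ k, Nonempty ({a : α // e a.1 = k} ≃ {a : α' // e' a.1 = k}) := by
    intro k
    rcases Nat.eq_zero_or_pos k with rfl | hk
    · have h1 : IsEmpty {a : α // e a.1 = 0} := ⟨fun a => a.1.2 a.2⟩
      have h2 : IsEmpty {a : α' // e' a.1 = 0} := ⟨fun a => a.1.2 a.2⟩
      exact ⟨Equiv.equivOfIsEmpty _ _⟩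
    · have e1 : {a : α // e a.1 = k} ≃ {i // e i = k} :=
        Equiv.subtypeSubtypeEquivSubtype (p := fun i => e i ≠ 0) (q := fun i => e i = k)
          fun hx => by rw [hx]; exact hk.ne'
      have e2 : {a : α' // e' a.1 = k} ≃ {i // e' i = k} :=
        Equiv.subtypeSubtypeEquivSubtype (p := fun i => e' i ≠ 0) (q := fun i => e' i = k)
          fun hx => by rw [hx]; exact hk.ne'
      exact ⟨e1.trans ((Fintype.equivOfCardEq ((h k hk).trans (h' k hk).symm)).trans e2.symm)⟩
  let σ : α ≃ α' := Equiv.ofFiberEquiv fun k => (hcard k).some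
  have hσ : ∀ a, e' (σ a).1 = e a.1 := fun a =>
    Equiv.ofFiberEquiv_map (f := fun a : α => e a.1) (g := fun a : α' => e' a.1) _ a
  let e₀ : α →₀ ℕ := Finsupp.equivFunOnFinite.symm fun a => e a.1
  have hj : Function.Injective fun a : α => (σ a).1 := Subtype.val_injective.comp σ.injective
  have h1 : e = e₀.mapDomain Subtype.val := by
    ext i
    by_cases hi : e i = 0
    · rw [hi, Finsupp.mapDomain_of_notMem_range]
      rintro ⟨a, rfl⟩
      exact a.2 hi
    · exact (Finsupp.mapDomain_apply Subtype.val_injective e₀ (⟨i, hi⟩ : α)).symm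
  have h2 : e' = e₀.mapDomain fun a : α => (σ a).1 := by
    ext i
    by_cases hi : e' i = 0
    · rw [hi, Finsupp.mapDomain_of_notMem_range]
      rintro ⟨a, rfl⟩
      exact (σ a).2 hi
    · have := Finsupp.mapDomain_apply hj e₀ (σ.symm ⟨i, hi⟩)
      rw [Equiv.apply_symm_apply] at this
      rw [this]
      change _ = e (σ.symm ⟨i, hi⟩).1
      rw [← hσ, Equiv.apply_symm_apply]
  rw [h1, h2, ← coeff_killCompl Subtype.val_injective, ← coeff_killCompl hj, killCompl_psumHom,
    killCompl_psumHom]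

/-- The exponent vector of a partition. -/
def partExponent {n : ℕ} (lam : n.Partition) : lam.parts.ToType →₀ ℕ :=
  Finsupp.equivFunOnFinite.symm fun x => x.1

theorem hasShape_partExponent {n : ℕ} (lam : n.Partition) : HasShape (partExponent lam) lam := by
  intro k _
  rw [Fintype.card_subtype]
  conv_rhs => rw [← Multiset.map_univ_coe lam.parts]
  rw [Multiset.count_map]
  change (Finset.univ.filter _).card = (Finset.univ.filter _).card
  congr 1
  ext x
  simp [partExponent, eq_comm]

/-- The coefficient of `m_lam` in a symmetric function. -/
def monoCoeff {n : ℕ} (lam : n.Partition) : MvPolynomial ℕ+ ℂ →ₗ[ℂ] ℂ :=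
  (lcoeff ℂ (partExponent lam)).comp (psumHom lam.parts.ToType).toLinearMap

theorem coeff_psumHom {ι : Type} [Fintype ι] {n : ℕ} {lam : n.Partition} {e : ι →₀ ℕ}
    (h : HasShape e lam) (f : MvPolynomial ℕ+ ℂ) : coeff e (psumHom ι f) = monoCoeff lam f :=
  coeff_psumHom_congr h (hasShape_partExponent lam) f

/-! ### The monomial symmetric functions -/

/-- The symmetric functions of degree `n`. -/
def symmDeg (n : ℕ) : Submodule ℂ (MvPolynomial ℕ+ ℂ) :=
  weightedHomogeneousSubmodule ℂ (fun k : ℕ+ => (k : ℕ)) n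

theorem mem_symmDeg {n : ℕ} {f : MvPolynomial ℕ+ ℂ} :
    f ∈ symmDeg n ↔ ∀ d, f.coeff d ≠ 0 → pweight d = n :=
  ⟨fun h _ hd => h hd, fun h d hd => h d hd⟩

theorem isHomogeneous_psum (ι : Type) [Fintype ι] (n : ℕ) : (psum ι ℂ n).IsHomogeneous n :=
  IsHomogeneous.sum _ _ _ fun i _ => isHomogeneous_X_pow i n

theorem isHomogeneous_psumHom (ι : Type) [Fintype ι] {n : ℕ} {f : MvPolynomial ℕ+ ℂ}
    (hf : f ∈ symmDeg n) : (psumHom ι f).IsHomogeneous n := by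
  rw [f.as_sum, map_sum]
  refine IsHomogeneous.sum _ _ _ fun d hd => ?_
  rw [psumHom, aeval_monomial, ← mem_symmDeg.1 hf d (mem_support_iff.1 hd),
    ← zero_add (pweight d)]
  refine (isHomogeneous_C ι (coeff d f)).mul ?_
  rw [pweight, Finsupp.weight_apply]
  refine IsHomogeneous.prod _ _ _ fun k _ => ?_
  change (psum ι ℂ k ^ d k).IsHomogeneous (d k * k)
  rw [mul_comm]
  exact (isHomogeneous_psum ι k).pow _

theorem toSymm_eq_sum {n : ℕ} {f : MvPolynomial ℕ+ ℂ} (hf : f ∈ symmDeg n) (N : ℕ) :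
    toSymm N f = ∑ mu : n.Partition, monoCoeff mu f • msymm (Fin N) ℂ mu := by
  classical
  ext e
  rw [coeff_sum]
  simp only [coeff_smul, coeff_msymm, smul_eq_mul, mul_ite, mul_one, mul_zero]
  change coeff e (psumHom (Fin N) f) = _
  by_cases he : e.degree = n
  · obtain ⟨lam, hlam⟩ := exists_hasShape he
    rw [coeff_psumHom hlam, Finset.sum_eq_single lam, if_pos hlam]
    · exact fun mu _ hmu => if_neg fun h => hmu (h.unique hlam)
    · simp
  · rw [(isHomogeneous_psumHom (Fin N) hf).coeff_eq_zero he, Finset.sum_eq_zero]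
    exact fun mu _ => if_neg fun h => he h.degree_eq

theorem eq_zero_of_monoCoeff {n : ℕ} {f : MvPolynomial ℕ+ ℂ} (hf : f ∈ symmDeg n)
    (h : ∀ mu : n.Partition, monoCoeff mu f = 0) : f = 0 :=
  eq_zero_of_toSymm_eq_zero (N := n) f (fun d hd => (mem_symmDeg.1 hf d hd).le) (by
    rw [toSymm_eq_sum hf]
    simp [h])

theorem eq_of_monoCoeff {n : ℕ} {f g : MvPolynomial ℕ+ ℂ} (hf : f ∈ symmDeg n) (hg : g ∈ symmDeg n)
    (h : ∀ mu : n.Partition, monoCoeff mu f = monoCoeff mu g) : f = g :=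
  sub_eq_zero.1 (eq_zero_of_monoCoeff (sub_mem hf hg) fun mu => by rw [map_sub, h, sub_self])

theorem toSymm_ext {f g : MvPolynomial ℕ+ ℂ} (h : ∀ N, toSymm N f = toSymm N g) : f = g := by
  refine sub_eq_zero.1 (eq_zero_of_toSymm_eq_zero (N := (f - g).support.sup pweight) _
    (fun d hd => Finset.le_sup (f := pweight) (mem_support_iff.2 hd)) ?_)
  rw [map_sub, h, sub_self]

/-- The exponents of the product of power sums of a partition. -/
def powerExponent {n : ℕ} (lam : n.Partition) : ℕ+ →₀ ℕ :=
  Multiset.toFinsupp (lam.parts.map Nat.toPNat')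

theorem powerExponent_apply {n : ℕ} (lam : n.Partition) (k : ℕ+) :
    powerExponent lam k = lam.parts.count (k : ℕ) := by
  rw [powerExponent, Multiset.toFinsupp_apply, Multiset.count_map, Multiset.count_eq_card_filter_eq]
  congr 1
  refine Multiset.filter_congr fun a ha => ?_
  have := lam.parts_pos ha
  constructor
  · intro h
    rw [h]
    simp only [Nat.toPNat', Nat.succPNat_coe, Nat.succ_pred_eq_of_pos this]
  · intro h
    rw [← h]
    exact (PNat.coe_toPNat' k).symm

theorem powerExponent_injective (n : ℕ) :
    Function.Injective (powerExponent : n.Partition → ℕ+ →₀ ℕ) := by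
  intro lam mu h
  refine Nat.Partition.ext (Multiset.ext.2 fun k => ?_)
  rcases Nat.eq_zero_or_pos k with rfl | hk
  · rw [Multiset.count_eq_zero_of_notMem fun h => (lam.parts_pos h).false,
      Multiset.count_eq_zero_of_notMem fun h => (mu.parts_pos h).false]
  · have := powerExponent_apply lam ⟨k, hk⟩
    rw [h] at this
    exact this.symm.trans (powerExponent_apply mu ⟨k, hk⟩)

theorem pweight_powerExponent {n : ℕ} (lam : n.Partition) : pweight (powerExponent lam) = n := by
  have h : ∀ m : Multiset ℕ+, pweight (Multiset.toFinsupp m) = (m.map (↑)).sum := by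
    intro m
    induction m using Multiset.induction_on with
    | empty => simp
    | cons a t ih =>
      rw [← Multiset.singleton_add, map_add, map_add, ih, Multiset.toFinsupp_singleton,
        pweight_single, Multiset.map_add, Multiset.sum_add]
      simp
  rw [powerExponent, h, Multiset.map_map]
  refine Eq.trans ?_ lam.parts_sum
  congr 1
  refine (Multiset.map_congr rfl fun a ha => ?_).trans (Multiset.map_id _)
  have := lam.parts_pos ha
  simp only [Function.comp_apply, Nat.toPNat', Nat.succPNat_coe, Nat.succ_pred_eq_of_pos this, id]

theorem monomial_mem_symmDeg {n : ℕ} (lam : n.Partition) :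
    monomial (powerExponent lam) (1 : ℂ) ∈ symmDeg n :=
  isWeightedHomogeneous_monomial _ _ _ (pweight_powerExponent lam)

theorem exists_monomialSymm {n : ℕ} (lam : n.Partition) :
    ∃ f ∈ symmDeg n, ∀ mu : n.Partition, monoCoeff mu f = if mu = lam then 1 else 0 := by
  classical
  let S : (n.Partition → ℂ) →ₗ[ℂ] MvPolynomial ℕ+ ℂ :=
    Fintype.linearCombination ℂ fun mu => monomial (powerExponent mu) (1 : ℂ)
  have hS : ∀ c, S c = ∑ mu, c mu • monomial (powerExponent mu) (1 : ℂ) := fun c => rfl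
  have hmem : ∀ c, S c ∈ symmDeg n := fun c => by
    rw [hS]
    exact sum_mem fun mu _ => Submodule.smul_mem _ _ (monomial_mem_symmDeg mu)
  let T : (n.Partition → ℂ) →ₗ[ℂ] (n.Partition → ℂ) := (LinearMap.pi monoCoeff).comp S
  -- Products of power sums and monomial coefficients are both indexed by the partitions of n. A
  -- square system with trivial kernel is solvable, so the monomial symmetric functions are obtained
  -- without inverting the transition matrix.
  have hT : Function.Injective T := by
    rw [injective_iff_map_eq_zero]
    intro c hc
    have h0 := eq_zero_of_monoCoeff (hmem c) fun mu => congrFun hc mu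
    funext mu
    have := congrArg (coeff (powerExponent mu)) h0
    rw [hS, coeff_sum, Finset.sum_eq_single mu] at this
    · simpa using this
    · intro nu _ hne
      rw [coeff_smul, coeff_monomial, if_neg fun h => hne (powerExponent_injective n h), smul_zero]
    · simp
  obtain ⟨c, hc⟩ := LinearMap.injective_iff_surjective.1 hT (Pi.single lam 1)
  refine ⟨S c, hmem c, fun mu => ?_⟩
  have := congrFun hc mu
  rwa [Pi.single_apply] at this

/-- The monomial symmetric function `m_lam`, in power sums. -/
def monomialSymm {n : ℕ} (lam : n.Partition) : MvPolynomial ℕ+ ℂ :=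
  (exists_monomialSymm lam).choose

theorem monomialSymm_mem {n : ℕ} (lam : n.Partition) : monomialSymm lam ∈ symmDeg n :=
  (exists_monomialSymm lam).choose_spec.1

theorem monoCoeff_monomialSymm {n : ℕ} (mu lam : n.Partition) :
    monoCoeff mu (monomialSymm lam) = if mu = lam then 1 else 0 :=
  (exists_monomialSymm lam).choose_spec.2 mu

theorem toSymm_monomialSymm {n : ℕ} (lam : n.Partition) (N : ℕ) :
    toSymm N (monomialSymm lam) = msymm (Fin N) ℂ lam := by
  classical
  rw [toSymm_eq_sum (monomialSymm_mem lam)]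
  simp [monoCoeff_monomialSymm]

theorem eq_sum_monomialSymm {n : ℕ} {f : MvPolynomial ℕ+ ℂ} (hf : f ∈ symmDeg n) :
    f = ∑ mu : n.Partition, monoCoeff mu f • monomialSymm mu := by
  classical
  refine eq_of_monoCoeff hf (sum_mem fun mu _ => Submodule.smul_mem _ _ (monomialSymm_mem mu))
    fun mu => ?_
  simp [monoCoeff_monomialSymm]

/-! ### Complex conjugation of the coefficients -/

/-- Complex conjugation of the coefficients. -/
def conjPoly {σ : Type} : MvPolynomial σ ℂ →+* MvPolynomial σ ℂ := map (starRingEnd ℂ)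

theorem coeff_conjPoly {σ : Type} (f : MvPolynomial σ ℂ) (d : σ →₀ ℕ) :
    coeff d (conjPoly f) = starRingEnd ℂ (coeff d f) := coeff_map _ _ _

theorem psumHom_conjPoly (ι : Type) [Fintype ι] (f : MvPolynomial ℕ+ ℂ) :
    psumHom ι (conjPoly f) = conjPoly (psumHom ι f) := by
  induction f using MvPolynomial.induction_on with
  | C a => simp [conjPoly, psumHom, MvPolynomial.algebraMap_eq]
  | add u v hu hv => rw [map_add, map_add, map_add, map_add, hu, hv]
  | mul_X v k hv =>
    rw [map_mul, map_mul, map_mul, map_mul, hv]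
    congr 1
    simp [conjPoly, psumHom_X, psum]

theorem monoCoeff_conjPoly {n : ℕ} (lam : n.Partition) (f : MvPolynomial ℕ+ ℂ) :
    monoCoeff lam (conjPoly f) = starRingEnd ℂ (monoCoeff lam f) := by
  change coeff _ (psumHom _ (conjPoly f)) = _
  rw [psumHom_conjPoly, coeff_conjPoly]
  rfl

theorem conjPoly_mem {n : ℕ} {f : MvPolynomial ℕ+ ℂ} (hf : f ∈ symmDeg n) :
    conjPoly f ∈ symmDeg n :=
  mem_symmDeg.2 fun d hd => mem_symmDeg.1 hf d fun h => hd (by rw [coeff_conjPoly, h, map_zero])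

end Halperin

namespace Halperin

open MvPolynomial

/-! ### The scalar product -/

section Product

variable (α : ℂ)

/-- The norm of a product of power sums. -/
def powerNorm (d : ℕ+ →₀ ℕ) : ℂ := d.prod fun n k => (α * n) ^ k * (k.factorial : ℂ)

theorem jackProduct_eq_sum {f : MvPolynomial ℕ+ ℂ} (g : MvPolynomial ℕ+ ℂ)
    {A : Finset (ℕ+ →₀ ℕ)} (hA : f.support ⊆ A) :
    jackProduct α f g = ∑ d ∈ A, f.coeff d * g.coeff d * powerNorm α d :=
  Finset.sum_subset hA fun d _ hd => by rw [notMem_support_iff.1 hd, zero_mul, zero_mul]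

/-- The scalar product as a bilinear map. -/
def jackForm : MvPolynomial ℕ+ ℂ →ₗ[ℂ] MvPolynomial ℕ+ ℂ →ₗ[ℂ] ℂ :=
  LinearMap.mk₂ ℂ (jackProduct α)
    (fun f f' g => by
      classical
      rw [jackProduct_eq_sum α g (A := f.support ∪ f'.support) support_add,
        jackProduct_eq_sum α g (A := f.support ∪ f'.support) Finset.subset_union_left,
        jackProduct_eq_sum α g (A := f.support ∪ f'.support) Finset.subset_union_right,
        ← Finset.sum_add_distrib]
      exact Finset.sum_congr rfl fun d _ => by rw [coeff_add]; ring)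
    (fun c f g => by
      rw [jackProduct_eq_sum α g support_smul, jackProduct_eq_sum α g subset_rfl, smul_eq_mul,
        Finset.mul_sum]
      exact Finset.sum_congr rfl fun d _ => by rw [coeff_smul, smul_eq_mul]; ring)
    (fun f g g' => by
      rw [jackProduct, jackProduct, jackProduct, ← Finset.sum_add_distrib]
      exact Finset.sum_congr rfl fun d _ => by rw [coeff_add]; ring)
    (fun c f g => by
      rw [jackProduct, jackProduct, smul_eq_mul, Finset.mul_sum]
      exact Finset.sum_congr rfl fun d _ => by rw [coeff_smul, smul_eq_mul]; ring)

theorem jackForm_apply (f g : MvPolynomial ℕ+ ℂ) : jackForm α f g = jackProduct α f g := rfl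

theorem jackForm_comm (f g : MvPolynomial ℕ+ ℂ) : jackForm α f g = jackForm α g f := by
  classical
  rw [jackForm_apply, jackForm_apply,
    jackProduct_eq_sum α g (A := f.support ∪ g.support) Finset.subset_union_left,
    jackProduct_eq_sum α f (A := f.support ∪ g.support) Finset.subset_union_right]
  exact Finset.sum_congr rfl fun d _ => by ring

theorem jackForm_monomial (d : ℕ+ →₀ ℕ) (a : ℂ) (g : MvPolynomial ℕ+ ℂ) :
    jackForm α (monomial d a) g = a * g.coeff d * powerNorm α d := by
  classical
  rw [jackForm_apply, jackProduct_eq_sum α g support_monomial_subset, Finset.sum_singleton,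
    coeff_monomial, if_pos rfl]

theorem powerNorm_add_single (d : ℕ+ →₀ ℕ) (n : ℕ+) :
    powerNorm α (Finsupp.single n 1 + d) = α * n * (d n + 1) * powerNorm α d := by
  classical
  have h1 : ∀ e : ℕ+ →₀ ℕ, e.support ⊆ insert n d.support →
      powerNorm α e = ((α * n) ^ e n * ((e n).factorial : ℂ))
        * ∏ m ∈ d.support.erase n, (α * m) ^ e m * ((e m).factorial : ℂ) := by
    intro e he
    rw [powerNorm, Finsupp.prod_of_support_subset _ he _ (by simp),
      ← Finset.mul_prod_erase _ _ (Finset.mem_insert_self n _)]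
    congr 1
    refine Finset.prod_congr ?_ fun _ _ => rfl
    ext m
    simp only [Finset.mem_erase, Finset.mem_insert]
    tauto
  rw [h1 _ (Finsupp.support_add.trans (Finset.union_subset
      (Finsupp.support_single_subset.trans (by simp)) (Finset.subset_insert _ _))),
    h1 d (Finset.subset_insert _ _)]
  have h2 : ∏ m ∈ d.support.erase n, (α * m) ^ (Finsupp.single n 1 + d : ℕ+ →₀ ℕ) m
        * (((Finsupp.single n 1 + d : ℕ+ →₀ ℕ) m).factorial : ℂ)
      = ∏ m ∈ d.support.erase n, (α * m) ^ d m * ((d m).factorial : ℂ) := by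
    refine Finset.prod_congr rfl fun m hm => ?_
    rw [Finsupp.add_apply, Finsupp.single_eq_of_ne (Finset.ne_of_mem_erase hm), zero_add]
  rw [h2, Finsupp.add_apply, Finsupp.single_eq_same, add_comm 1 (d n), Nat.factorial_succ, pow_succ]
  push_cast
  ring

/-- Multiplication by `p_n` is adjoint to `α n ∂/∂p_n`. -/
theorem jackForm_X_mul (n : ℕ+) (f g : MvPolynomial ℕ+ ℂ) :
    jackForm α (X n * f) g = α * n * jackForm α f (pderiv n g) := by
  induction f using MvPolynomial.induction_on' with
  | add u v hu hv =>
    rw [mul_add, map_add, map_add, LinearMap.add_apply, LinearMap.add_apply, hu, hv, mul_add]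
  | monomial d a =>
    rw [X, monomial_mul, one_mul, jackForm_monomial, jackForm_monomial, coeff_pderiv,
      powerNorm_add_single, add_comm d]
    ring

theorem jackForm_mul_X (n : ℕ+) (f g : MvPolynomial ℕ+ ℂ) :
    jackForm α f (X n * g) = α * n * jackForm α (pderiv n f) g := by
  rw [jackForm_comm, jackForm_X_mul, jackForm_comm]

end Product

/-- The scalar product is bilinear over ℂ and has isotropic vectors; positivity is recovered by
pairing f with its complex conjugate. -/
theorem jackForm_conjPoly_ne_zero {α : ℝ} (hα : 0 < α) {f : MvPolynomial ℕ+ ℂ} (hf : f ≠ 0) :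
    jackForm (α : ℂ) f (conjPoly f) ≠ 0 := by
  have h1 : jackForm (α : ℂ) f (conjPoly f) = ((∑ d ∈ f.support, ‖f.coeff d‖ ^ 2
      * d.prod fun n k => (α * n) ^ k * (k.factorial : ℝ) : ℝ) : ℂ) := by
    rw [jackForm_apply, jackProduct]
    push_cast
    refine Finset.sum_congr rfl fun d _ => ?_
    rw [coeff_conjPoly, Complex.mul_conj']
    congr 1
    simp [Finsupp.prod]
  rw [h1, Complex.ofReal_ne_zero]
  refine (Finset.sum_pos (fun d hd => ?_) (Finset.nonempty_of_ne_empty fun h =>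
    hf (support_eq_empty.1 h))).ne'
  refine mul_pos (pow_pos (norm_pos_iff.2 (mem_support_iff.1 hd)) 2)
    (Finset.prod_pos fun n _ => ?_)
  have : (0 : ℝ) < n := by exact_mod_cast n.pos
  positivity

/-- Conjugation does not change which monomial functions occur in f. If f is orthogonal to those, it
is orthogonal to its own conjugate. -/
theorem eq_zero_of_orthogonal {α : ℝ} (hα : 0 < α) {n : ℕ} {f : MvPolynomial ℕ+ ℂ}
    (hf : f ∈ symmDeg n) (h : ∀ mu : n.Partition, monoCoeff mu f ≠ 0 →
      jackForm (α : ℂ) f (monomialSymm mu) = 0) : f = 0 := by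
  by_contra hne
  refine jackForm_conjPoly_ne_zero hα hne ?_
  rw [eq_sum_monomialSymm (conjPoly_mem hf), map_sum]
  refine Finset.sum_eq_zero fun mu _ => ?_
  rw [map_smul, monoCoeff_conjPoly]
  by_cases h0 : monoCoeff mu f = 0
  · rw [h0, map_zero, zero_smul]
  · rw [h mu h0, smul_zero]

/-! ### Existence and uniqueness of the Jack symmetric functions -/

theorem rows_injective (n : ℕ) : Function.Injective (rows : n.Partition → List ℕ) := by
  intro lam mu h
  refine Nat.Partition.ext ?_
  rw [← Multiset.sort_eq lam.parts (· ≥ ·), ← Multiset.sort_eq mu.parts (· ≥ ·)]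
  exact congrArg _ h

theorem isJack_iff {α : ℂ} {n : ℕ} {lam : n.Partition} {P : MvPolynomial ℕ+ ℂ} :
    IsJack α lam P ↔ P ∈ symmDeg n ∧ monoCoeff lam P = 1 ∧
      (∀ mu : n.Partition, rows lam < rows mu → monoCoeff mu P = 0) ∧
      ∀ mu : n.Partition, rows mu < rows lam → jackForm α P (monomialSymm mu) = 0 := by
  classical
  constructor
  · rintro ⟨⟨c, h1, h2, h3⟩, h4⟩
    have hP : P = ∑ mu, c mu • monomialSymm mu := toSymm_ext fun N => by
      simp [h3, map_sum, toSymm_monomialSymm]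
    have hc : ∀ mu, monoCoeff mu P = c mu := fun mu => by
      rw [hP]
      simp [monoCoeff_monomialSymm]
    refine ⟨?_, ?_, fun mu hmu => ?_, fun mu hmu => ?_⟩
    · rw [hP]
      exact sum_mem fun mu _ => Submodule.smul_mem _ _ (monomialSymm_mem mu)
    · rw [hc, h1]
    · rw [hc, h2 mu hmu]
    · exact h4 mu hmu _ (toSymm_monomialSymm mu)
  · rintro ⟨h1, h2, h3, h4⟩
    refine ⟨⟨fun mu => monoCoeff mu P, h2, h3, toSymm_eq_sum h1⟩, fun mu hmu g hg => ?_⟩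
    rw [toSymm_ext fun N => (hg N).trans (toSymm_monomialSymm mu N).symm]
    exact h4 mu hmu

/-- P_λ is m_λ minus its projection to the span of the smaller monomial functions. For uniqueness,
the difference of two solutions lies in that span and is orthogonal to it. -/
theorem existsUnique_isJack {α : ℝ} (hα : 0 < α) {n : ℕ} (lam : n.Partition) :
    ∃! P, IsJack (α : ℂ) lam P := by
  classical
  let ι := {mu : n.Partition // rows mu < rows lam}
  let S : (ι → ℂ) →ₗ[ℂ] MvPolynomial ℕ+ ℂ :=
    Fintype.linearCombination ℂ fun mu => monomialSymm mu.1
  have hS : ∀ c, S c = ∑ mu, c mu • monomialSymm mu.1 := fun c => rfl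
  have hmem : ∀ c, S c ∈ symmDeg n := fun c => by
    rw [hS]
    exact sum_mem fun mu _ => Submodule.smul_mem _ _ (monomialSymm_mem _)
  have hcoeff : ∀ c (mu : ι), monoCoeff mu.1 (S c) = c mu := fun c mu => by
    rw [hS, map_sum, Finset.sum_eq_single mu]
    · simp [monoCoeff_monomialSymm]
    · intro nu _ hne
      rw [map_smul, monoCoeff_monomialSymm, if_neg fun h => hne (Subtype.ext h.symm), smul_zero]
    · simp
  have hcoeff0 : ∀ c (mu : n.Partition), ¬ rows mu < rows lam → monoCoeff mu (S c) = 0 := by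
    intro c mu hmu
    rw [hS, map_sum, Finset.sum_eq_zero]
    intro nu _
    rw [map_smul, monoCoeff_monomialSymm, if_neg, smul_zero]
    rintro rfl
    exact hmu nu.2
  let T : (ι → ℂ) →ₗ[ℂ] (ι → ℂ) :=
    (LinearMap.pi fun mu : ι => (jackForm (α : ℂ)).flip (monomialSymm mu.1)).comp S
  have hTS : ∀ c mu, T c mu = jackForm (α : ℂ) (S c) (monomialSymm mu.1) := fun c mu => rfl
  clear_value T S
  -- T is the Gram matrix of the smaller monomial functions. A vector in its kernel would be
  -- orthogonal to all of its own constituents.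
  have hT : Function.Injective T := by
    rw [injective_iff_map_eq_zero]
    intro c hc
    have h0 : S c = 0 := eq_zero_of_orthogonal hα (hmem c) fun mu hmu => by
      have hlt : rows mu < rows lam := by
        by_contra h
        exact hmu (hcoeff0 c mu h)
      exact (hTS c ⟨mu, hlt⟩).symm.trans (congrFun hc ⟨mu, hlt⟩)
    funext mu
    rw [← hcoeff c mu, h0, map_zero, Pi.zero_apply]
  obtain ⟨c, hc⟩ := LinearMap.injective_iff_surjective.1 hT fun mu =>
    jackForm (α : ℂ) (monomialSymm lam) (monomialSymm mu.1)
  refine ⟨monomialSymm lam - S c, isJack_iff.2 ⟨sub_mem (monomialSymm_mem lam) (hmem c), ?_,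
    fun mu hmu => ?_, fun mu hmu => ?_⟩, fun P hP => ?_⟩
  · rw [map_sub, hcoeff0 c lam (lt_irrefl _), monoCoeff_monomialSymm, if_pos rfl, sub_zero]
  · rw [map_sub, hcoeff0 c mu hmu.asymm, monoCoeff_monomialSymm, if_neg, sub_zero]
    rintro rfl
    exact lt_irrefl _ hmu
  · rw [map_sub, LinearMap.sub_apply, sub_eq_zero]
    exact (congrFun hc ⟨mu, hmu⟩).symm.trans (hTS c ⟨mu, hmu⟩)
  · obtain ⟨h1, h2, h3, h4⟩ := isJack_iff.1 hP
    refine sub_eq_zero.1 (eq_zero_of_orthogonal hα (sub_mem h1 (sub_mem (monomialSymm_mem lam)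
      (hmem c))) fun mu hmu => ?_)
    have hlt : rows mu < rows lam := by
      rcases lt_trichotomy (rows mu) (rows lam) with h | h | h
      · exact h
      · refine absurd ?_ hmu
        rw [rows_injective n h, map_sub, map_sub, h2, hcoeff0 c lam (lt_irrefl _),
          monoCoeff_monomialSymm, if_pos rfl]
        ring
      · refine absurd ?_ hmu
        rw [map_sub, map_sub, h3 mu h, hcoeff0 c mu h.asymm, monoCoeff_monomialSymm, if_neg]
        · ring
        · rintro rfl
          exact lt_irrefl _ h
    rw [map_sub, LinearMap.sub_apply, h4 mu hlt, map_sub, LinearMap.sub_apply, sub_eq_zero, eq_comm,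
      sub_eq_zero]
    exact ((hTS c ⟨mu, hlt⟩).symm.trans (congrFun hc ⟨mu, hlt⟩)).symm

theorem isJack_jack {α : ℝ} (hα : 0 < α) {n : ℕ} (lam : n.Partition) :
    IsJack (α : ℂ) lam (jack (α : ℂ) lam) :=
  Classical.epsilon_spec (existsUnique_isJack hα lam).exists

end Halperin

namespace Halperin

open MvPolynomial

/-! ### The Laughlin Hamiltonian on symmetric functions -/

/-- `∑ (1 - β) n² p_n ∂_n + ∑ (β (n + m) p_n p_m ∂_{n+m} + n m p_{n+m} ∂_n ∂_m)`. -/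
def jackHam (β : ℂ) (f : MvPolynomial ℕ+ ℂ) : MvPolynomial ℕ+ ℂ :=
  ∑ᶠ n : ℕ+, ((1 - β) * (n : ℂ) ^ 2) • (X n * pderiv n f)
  + ∑ᶠ t : ℕ+ × ℕ+, ((β * ((t.1 : ℂ) + t.2)) • (X t.1 * X t.2 * pderiv (t.1 + t.2) f)
    + ((t.1 : ℂ) * t.2) • (X (t.1 + t.2) * pderiv t.1 (pderiv t.2 f)))

theorem exists_pderiv_bound (f : MvPolynomial ℕ+ ℂ) :
    ∃ K : ℕ, ∀ n : ℕ+, K ≤ n → pderiv n f = 0 := by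
  refine ⟨f.vars.sup (fun k => (k : ℕ)) + 1, fun n hn => pderiv_eq_zero_of_notMem_vars fun h => ?_⟩
  have : (n : ℕ) ≤ f.vars.sup (fun k => (k : ℕ)) := Finset.le_sup (f := fun k : ℕ+ => (k : ℕ)) h
  omega

theorem finite_pnat_le (K : ℕ) : {n : ℕ+ | (n : ℕ) ≤ K}.Finite :=
  (Set.finite_Iic K).preimage PNat.coe_injective.injOn

theorem hasFinsum_pderiv {W : Type*} [AddCommGroup W] (f : MvPolynomial ℕ+ ℂ)
    (L : ℕ+ → MvPolynomial ℕ+ ℂ →+ W) :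
    HasFinsum (fun n => L n (pderiv n f)) (∑ᶠ n, L n (pderiv n f)) := by
  obtain ⟨K, hK⟩ := exists_pderiv_bound f
  refine HasFinsum.of_subset (finite_pnat_le K) fun n hn => ?_
  rw [hK n (le_of_lt (not_le.1 hn)), map_zero]

theorem hasFinsum_pderiv_add {W : Type*} [AddCommGroup W] (f : MvPolynomial ℕ+ ℂ)
    (L : ℕ+ × ℕ+ → MvPolynomial ℕ+ ℂ →+ W) :
    HasFinsum (fun t => L t (pderiv (t.1 + t.2) f)) (∑ᶠ t, L t (pderiv (t.1 + t.2) f)) := by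
  obtain ⟨K, hK⟩ := exists_pderiv_bound f
  exact IsHeisenberg.finsum_pair K fun t ht => by rw [hK _ (by simpa using ht), map_zero]

theorem hasFinsum_pderiv_pderiv {W : Type*} [AddCommGroup W] (f : MvPolynomial ℕ+ ℂ)
    (L : ℕ+ × ℕ+ → MvPolynomial ℕ+ ℂ →+ W) :
    HasFinsum (fun t => L t (pderiv t.1 (pderiv t.2 f)))
      (∑ᶠ t, L t (pderiv t.1 (pderiv t.2 f))) := by
  obtain ⟨K, hK⟩ := exists_pderiv_bound f
  refine IsHeisenberg.finsum_pair (2 * K) fun t ht => ?_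
  by_cases h2 : K ≤ (t.2 : ℕ)
  · rw [hK _ h2, map_zero, map_zero]
  · rw [pderiv_comm', hK t.1 (by omega), map_zero, map_zero]

section Parts

variable (β : ℂ) (f : MvPolynomial ℕ+ ℂ)

theorem hasFinsum_jackHam_number :
    HasFinsum (fun n : ℕ+ => ((1 - β) * (n : ℂ) ^ 2) • (X n * pderiv n f))
      (∑ᶠ n : ℕ+, ((1 - β) * (n : ℂ) ^ 2) • (X n * pderiv n f)) := by
  have h := hasFinsum_pderiv f fun n => (((1 - β) * (n : ℂ) ^ 2) •
    LinearMap.mulLeft ℂ (X n : MvPolynomial ℕ+ ℂ)).toAddMonoidHom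
  simpa only [LinearMap.toAddMonoidHom_coe, LinearMap.smul_apply, LinearMap.mulLeft_apply] using h

theorem hasFinsum_jackHam_split :
    HasFinsum (fun t : ℕ+ × ℕ+ =>
      (β * ((t.1 : ℂ) + t.2)) • (X t.1 * X t.2 * pderiv (t.1 + t.2) f))
      (∑ᶠ t : ℕ+ × ℕ+, (β * ((t.1 : ℂ) + t.2)) • (X t.1 * X t.2 * pderiv (t.1 + t.2) f)) :=
  hasFinsum_pderiv_add f fun t => ((β * ((t.1 : ℂ) + t.2)) •
    LinearMap.mulLeft ℂ (X t.1 * X t.2 : MvPolynomial ℕ+ ℂ)).toAddMonoidHom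

theorem hasFinsum_jackHam_merge :
    HasFinsum (fun t : ℕ+ × ℕ+ =>
      ((t.1 : ℂ) * t.2) • (X (t.1 + t.2) * pderiv t.1 (pderiv t.2 f)))
      (∑ᶠ t : ℕ+ × ℕ+, ((t.1 : ℂ) * t.2) • (X (t.1 + t.2) * pderiv t.1 (pderiv t.2 f))) :=
  hasFinsum_pderiv_pderiv f fun t => (((t.1 : ℂ) * t.2) •
    LinearMap.mulLeft ℂ (X (t.1 + t.2) : MvPolynomial ℕ+ ℂ)).toAddMonoidHom

theorem jackHam_eq : jackHam β f =
    ∑ᶠ n : ℕ+, ((1 - β) * (n : ℂ) ^ 2) • (X n * pderiv n f)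
    + (∑ᶠ t : ℕ+ × ℕ+, (β * ((t.1 : ℂ) + t.2)) • (X t.1 * X t.2 * pderiv (t.1 + t.2) f)
      + ∑ᶠ t : ℕ+ × ℕ+, ((t.1 : ℂ) * t.2) • (X (t.1 + t.2) * pderiv t.1 (pderiv t.2 f))) := by
  rw [jackHam, ((hasFinsum_jackHam_split β f).add (hasFinsum_jackHam_merge f)).eq]

/-- The three parts of the Hamiltonian under a linear map. -/
theorem map_jackHam {W : Type*} [AddCommGroup W] [Module ℂ W] (L : MvPolynomial ℕ+ ℂ →ₗ[ℂ] W) :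
    L (jackHam β f) =
      ∑ᶠ n : ℕ+, ((1 - β) * (n : ℂ) ^ 2) • L (X n * pderiv n f)
      + (∑ᶠ t : ℕ+ × ℕ+, (β * ((t.1 : ℂ) + t.2)) • L (X t.1 * X t.2 * pderiv (t.1 + t.2) f)
        + ∑ᶠ t : ℕ+ × ℕ+, ((t.1 : ℂ) * t.2) • L (X (t.1 + t.2) * pderiv t.1 (pderiv t.2 f))) := by
  rw [jackHam_eq, map_add, map_add, ← ((hasFinsum_jackHam_number β f).map L).eq,
    ← ((hasFinsum_jackHam_split β f).map L).eq, ← ((hasFinsum_jackHam_merge f).map L).eq]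
  simp only [map_smul]

end Parts

theorem jackHam_add (β : ℂ) (f g : MvPolynomial ℕ+ ℂ) :
    jackHam β (f + g) = jackHam β f + jackHam β g := by
  rw [jackHam_eq β (f + g)]
  simp only [map_add, mul_add (X _), mul_add (X _ * X _), smul_add]
  rw [((hasFinsum_jackHam_number β f).add (hasFinsum_jackHam_number β g)).eq,
    ((hasFinsum_jackHam_split β f).add (hasFinsum_jackHam_split β g)).eq,
    ((hasFinsum_jackHam_merge f).add (hasFinsum_jackHam_merge g)).eq, jackHam_eq, jackHam_eq]
  abel

theorem jackHam_smul (β c : ℂ) (f : MvPolynomial ℕ+ ℂ) : jackHam β (c • f) = c • jackHam β f := by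
  have h := map_jackHam β f (LinearMap.lsmul ℂ (MvPolynomial ℕ+ ℂ) c)
  rw [LinearMap.lsmul_apply] at h
  rw [h, jackHam_eq]
  simp only [Derivation.map_smul, mul_smul_comm, LinearMap.lsmul_apply]

/-- The Hamiltonian as a linear map. -/
def jackHamₗ (β : ℂ) : Module.End ℂ (MvPolynomial ℕ+ ℂ) where
  toFun := jackHam β
  map_add' := jackHam_add β
  map_smul' := jackHam_smul β

/-- Multiplication by p_n is adjoint to α n ∂_n. The number term is self-adjoint; the splitting term
carries one derivative and two multiplications and the merging term the reverse, so they are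
exchanged, and the powers of α match exactly when α β = 1. -/
theorem jackHam_selfAdjoint {α β : ℂ} (h : α * β = 1) (f g : MvPolynomial ℕ+ ℂ) :
    jackForm α (jackHam β f) g = jackForm α f (jackHam β g) := by
  have e := map_jackHam β f ((jackForm α).flip g)
  rw [LinearMap.flip_apply] at e
  rw [e, map_jackHam, add_comm (∑ᶠ t : ℕ+ × ℕ+, _) (∑ᶠ t : ℕ+ × ℕ+, _)]
  congr 1
  · refine finsum_congr fun n => ?_
    rw [LinearMap.flip_apply, jackForm_X_mul, jackForm_mul_X]
  · congr 1
    · refine finsum_congr fun t => ?_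
      rw [LinearMap.flip_apply, jackForm_X_mul, mul_assoc (X t.1), jackForm_mul_X, jackForm_mul_X,
        pderiv_comm' t.1, PNat.add_coe]
      simp only [smul_eq_mul]
      push_cast
      linear_combination (-(α * (t.1 : ℂ) * t.2 * (t.1 + t.2))
        * jackForm α (pderiv t.2 (pderiv t.1 f)) (pderiv (t.1 + t.2) g)) * h
    · refine finsum_congr fun t => ?_
      rw [LinearMap.flip_apply, jackForm_mul_X, mul_assoc, jackForm_X_mul, jackForm_X_mul,
        pderiv_comm' t.2, PNat.add_coe]
      simp only [smul_eq_mul]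
      push_cast
      linear_combination ((α * (t.1 : ℂ) * t.2 * (t.1 + t.2))
        * jackForm α (pderiv (t.1 + t.2) f) (pderiv t.1 (pderiv t.2 g))) * h

/-- The Laughlin Hamiltonian of a layer, on functions of the creation operators of that layer. -/
theorem laughlinHam_map {p : ℝ} (hp : 0 < p) {I : Fin 2} (L : MvPolynomial ℕ+ ℂ →ₗ[ℂ] Fock)
    (hX : ∀ k f, L (X k * f) = (2 / ((Real.sqrt p : ℝ) : ℂ)) • (X (I, k) * L f))
    (hD : ∀ k f, pderiv (I, k) (L f) = (2 / ((Real.sqrt p : ℝ) : ℂ)) • L (pderiv k f))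
    (f : MvPolynomial ℕ+ ℂ) : laughlinHam bose p I (L f) = L (jackHam (p / 2) f) := by
  have hs : ((Real.sqrt p : ℝ) : ℂ) ≠ 0 := by
    exact_mod_cast (Real.sqrt_pos.2 hp).ne'
  have hss : ((Real.sqrt p : ℝ) : ℂ) * ((Real.sqrt p : ℝ) : ℂ) = p := by
    exact_mod_cast Real.mul_self_sqrt hp.le
  -- In terms of p_n the modes are a_{-n} = (√p/2) p_n and a_n = (2/√p) n ∂_n. The splitting term
  -- then has coefficient (p/2)(n + m) and the merging term n m.
  have hneg : ∀ (n : ℕ+) f, bose I (-n) (L f) = (((Real.sqrt p : ℝ) : ℂ) / 2) • L (X n * f) := by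
    intro n f
    rw [hX, smul_smul, div_mul_div_cancel₀' hs, div_self two_ne_zero, one_smul]
    exact mode_neg 0 I n _
  have hpos : ∀ (n : ℕ+) f, bose I n (L f)
      = ((n : ℂ) * (2 / ((Real.sqrt p : ℝ) : ℂ))) • L (pderiv n f) := by
    intro n f
    rw [← smul_smul, ← hD]
    exact mode_pos 0 I n _
  have hsmul : ∀ (n : ℤ) (c : ℂ) (w : Fock), bose I n (c • w) = c • bose I n w := fun n c w =>
    map_smul (mode 0 I n) c w
  have hH := isHeisenberg_mode 0
  have h1 : HasFinsum (fun n : ℕ+ => (n : ℂ) • bose I (-n) (bose I n (L f))) _ :=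
    hH.finsum_number_smul I I (fun n => (n : ℂ)) (L f)
  have h2 : HasFinsum (fun t : ℕ+ × ℕ+ => bose I (-t.1) (bose I (-t.2)
    (bose I (t.1 + t.2) (L f)))) _ := hH.finsum_split I I I (L f)
  have h3 : HasFinsum (fun t : ℕ+ × ℕ+ => bose I (-t.1 - t.2) (bose I t.1
    (bose I t.2 (L f)))) _ := hH.finsum_merge I I I (L f)
  rw [map_jackHam, laughlinHam]
  congr 1
  · rw [h1.eq, ← (h1.smul (1 - (p : ℂ) / 2)).eq]
    refine finsum_congr fun n => ?_
    rw [hpos, hsmul, hneg]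
    simp only [smul_smul]
    congr 1
    field_simp
  · rw [(h2.add (h3.smul (1 / 2 : ℂ))).eq, smul_add, ← (h2.smul _).eq,
      ← ((h3.smul (1 / 2 : ℂ)).smul _).eq]
    congr 1
    · refine finsum_congr fun t => ?_
      rw [show (t.1 : ℤ) + t.2 = ((t.1 + t.2 : ℕ+) : ℤ) by push_cast; rfl, hpos, hsmul, hsmul, hneg,
        hsmul, hneg, ← mul_assoc, PNat.add_coe]
      simp only [smul_smul]
      congr 1
      push_cast
      field_simp
      linear_combination ((t.1 : ℂ) + t.2) * hss
    · refine finsum_congr fun t => ?_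
      rw [show -(t.1 : ℤ) - t.2 = -((t.1 + t.2 : ℕ+) : ℤ) by push_cast; ring, hpos, hsmul, hsmul,
        hpos, hsmul, hneg]
      simp only [smul_smul]
      congr 1
      field_simp

end Halperin

namespace Halperin

open MvPolynomial

/-! ### The Hamiltonian in finitely many variables -/

section Variables

variable {ι : Type} [Fintype ι] [DecidableEq ι]

/-- The Euler derivation `x_i ∂/∂x_i`. -/
def eulerDer (i : ι) : Derivation ℂ (MvPolynomial ι ℂ) (MvPolynomial ι ℂ) :=
  (X i : MvPolynomial ι ℂ) • pderiv i

theorem eulerDer_apply (i : ι) (F : MvPolynomial ι ℂ) : eulerDer i F = X i * pderiv i F := rfl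

theorem eulerDer_monomial (i : ι) (e : ι →₀ ℕ) (a : ℂ) :
    eulerDer i (monomial e a) = (e i : ℂ) • monomial e a := by
  rw [eulerDer_apply, X_mul_pderiv_monomial, Nat.cast_smul_eq_nsmul]

theorem eulerDer_X_pow (i : ι) (n : ℕ) :
    eulerDer i (X i ^ n : MvPolynomial ι ℂ) = (n : ℂ) • X i ^ n := by
  rw [X_pow_eq_monomial, eulerDer_monomial, Finsupp.single_eq_same]

theorem eulerDer_psum (i : ι) (n : ℕ+) :
    eulerDer i (psum ι ℂ n) = (n : ℂ) • X i ^ (n : ℕ) := by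
  rw [eulerDer_apply, pderiv_psum, Nat.cast_smul_eq_nsmul, nsmul_eq_mul]
  obtain ⟨m, hm⟩ : ∃ m, (n : ℕ) = m + 1 := ⟨n - 1, by have := n.pos; omega⟩
  rw [hm, Nat.add_sub_cancel, pow_succ]
  ring

variable (f : MvPolynomial ℕ+ ℂ)

theorem hasFinsum_eulerDer (i : ι) :
    HasFinsum (fun n : ℕ+ => (n : ℂ) • (X i ^ (n : ℕ) * psumHom ι (pderiv n f)))
      (eulerDer i (psumHom ι f)) :=
  (hasFinsum_derivation_aeval (eulerDer i) (fun n : ℕ+ => psum ι ℂ n) f).congr fun n => by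
    rw [eulerDer_psum, mul_smul_comm, mul_comm]
    rfl

theorem hasFinsum_psumHom_pderiv (c : ℕ+ → MvPolynomial ι ℂ) :
    HasFinsum (fun n : ℕ+ => c n * psumHom ι (pderiv n f))
      (∑ᶠ n : ℕ+, c n * psumHom ι (pderiv n f)) := by
  obtain ⟨K, hK⟩ := exists_pderiv_bound f
  refine HasFinsum.of_subset (finite_pnat_le K) fun n hn => ?_
  rw [hK n (le_of_lt (not_le.1 hn)), map_zero, mul_zero]

theorem hasFinsum_psum_sum {c : ι → ℕ+ → MvPolynomial ι ℂ} {s : ι → MvPolynomial ι ℂ}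
    (h : ∀ i, HasFinsum (c i) (s i)) : HasFinsum (fun n => ∑ i, c i n) (∑ i, s i) :=
  HasFinsum.finset_sum _ fun i _ => h i

theorem sum_eulerDer_eulerDer :
    ∑ i : ι, eulerDer i (eulerDer i (psumHom ι f))
      = ∑ᶠ n : ℕ+, ((n : ℂ) ^ 2) • (psum ι ℂ n * psumHom ι (pderiv n f))
        + ∑ᶠ t : ℕ+ × ℕ+, ((t.1 : ℂ) * t.2) •
          (psum ι ℂ (t.1 + t.2) * psumHom ι (pderiv t.1 (pderiv t.2 f))) := by
  obtain ⟨K, hK⟩ := exists_pderiv_bound f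
  have hA : ∀ i : ι, HasFinsum (fun n : ℕ+ => ((n : ℂ) ^ 2) •
      (X i ^ (n : ℕ) * psumHom ι (pderiv n f))) (∑ᶠ n : ℕ+, ((n : ℂ) ^ 2) •
      (X i ^ (n : ℕ) * psumHom ι (pderiv n f))) := fun i =>
    ((hasFinsum_psumHom_pderiv f fun n => ((n : ℂ) ^ 2) • X i ^ (n : ℕ)).self.congr fun n => by
      rw [smul_mul_assoc]).self
  have hB : ∀ i : ι, HasFinsum (fun n : ℕ+ => (n : ℂ) •
      (X i ^ (n : ℕ) * eulerDer i (psumHom ι (pderiv n f))))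
      (∑ᶠ n : ℕ+, (n : ℂ) • (X i ^ (n : ℕ) * eulerDer i (psumHom ι (pderiv n f)))) := fun i =>
    HasFinsum.of_subset (finite_pnat_le K) fun n hn => by
      rw [hK n (le_of_lt (not_le.1 hn)), map_zero, map_zero, mul_zero, smul_zero]
  have hC : ∀ i : ι, HasFinsum (fun t : ℕ+ × ℕ+ => ((t.1 : ℂ) * t.2) • (X i ^ ((t.1 : ℕ) + t.2)
      * psumHom ι (pderiv t.1 (pderiv t.2 f))))
      (∑ᶠ n : ℕ+, (n : ℂ) • (X i ^ (n : ℕ) * eulerDer i (psumHom ι (pderiv n f)))) := fun i =>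
    HasFinsum.uncurry (finite_pnat_le K) (fun n hn m => by
        dsimp only
        rw [pderiv_comm', hK n (le_of_lt (not_le.1 hn)), map_zero, map_zero, mul_zero, smul_zero])
      fun n => (((hasFinsum_eulerDer (pderiv n f) i).map
        (AddMonoidHom.mulLeft (X i ^ (n : ℕ)))).smul (n : ℂ)).congr fun m => by
          dsimp only
          rw [AddMonoidHom.coe_mulLeft, mul_smul_comm, smul_smul, pow_add, mul_assoc, pderiv_comm']
  have hE : ∀ i : ι, eulerDer i (eulerDer i (psumHom ι f))
      = ∑ᶠ n : ℕ+, ((n : ℂ) ^ 2) • (X i ^ (n : ℕ) * psumHom ι (pderiv n f))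
        + ∑ᶠ n : ℕ+, (n : ℂ) • (X i ^ (n : ℕ) * eulerDer i (psumHom ι (pderiv n f))) := fun i => by
    refine (((hasFinsum_eulerDer f i).map (eulerDer i)).congr fun n => ?_).unique
      (((hA i).add (hB i)).congr fun n => rfl)
    rw [Derivation.map_smul, Derivation.leibniz, eulerDer_X_pow, smul_eq_mul, smul_eq_mul, mul_smul_comm,
      smul_add, smul_smul, ← sq, add_comm, mul_comm (psumHom ι _)]
  rw [Finset.sum_congr rfl fun i _ => hE i, Finset.sum_add_distrib]
  congr 1
  · refine ((hasFinsum_psum_sum hA).congr fun n => ?_).eq.symm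
    rw [← Finset.smul_sum, ← Finset.sum_mul, psum]
  · refine ((HasFinsum.finset_sum Finset.univ fun i _ => hC i).congr fun t => ?_).eq.symm
    rw [← Finset.smul_sum, ← Finset.sum_mul, psum]

/-! ### The pair operator and division by x_i - x_j -/

theorem geom_sum_mul_sub {R : Type*} [CommRing R] (x y : R) (d : ℕ) :
    (∑ t ∈ Finset.range d, x ^ (d - t) * y ^ t) * (x - y) = x * (x ^ d - y ^ d) := by
  have h := geom_sum₂_mul y x d
  have h2 : ∑ t ∈ Finset.range d, x ^ (d - t) * y ^ t
      = x * ∑ t ∈ Finset.range d, y ^ t * x ^ (d - 1 - t) := by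
    rw [Finset.mul_sum]
    refine Finset.sum_congr rfl fun t ht => ?_
    have ht' := Finset.mem_range.1 ht
    rw [show d - t = d - 1 - t + 1 by omega, pow_succ]
    ring
  rw [h2]
  linear_combination -x * h

/-- The operator `x_i / (x_i - x_j) (x_i ∂_i - x_j ∂_j)` on symmetric functions. -/
def pairOp (i j : ι) : MvPolynomial ι ℂ →ₗ[ℂ] MvPolynomial ι ℂ :=
  (basisMonomials ι ℂ).constr ℂ fun e => ((e i - e j : ℕ) : ℂ) •
    (monomial (e - Finsupp.single i (e i - e j)) 1
      * ∑ t ∈ Finset.range (e i - e j), X i ^ (e i - e j - t) * X j ^ t)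

theorem pairOp_monomial (i j : ι) (e : ι →₀ ℕ) :
    pairOp i j (monomial e (1 : ℂ)) = ((e i - e j : ℕ) : ℂ) •
      ((monomial (e - Finsupp.single i (e i - e j)) 1 : MvPolynomial ι ℂ)
        * ∑ t ∈ Finset.range (e i - e j), X i ^ (e i - e j - t) * (X j : MvPolynomial ι ℂ) ^ t) := by
  have := (basisMonomials ι ℂ).constr_basis ℂ (fun e => ((e i - e j : ℕ) : ℂ) •
    ((monomial (e - Finsupp.single i (e i - e j)) 1 : MvPolynomial ι ℂ)
      * ∑ t ∈ Finset.range (e i - e j), X i ^ (e i - e j - t) * X j ^ t)) e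
  rwa [coe_basisMonomials] at this

theorem pairOp_monomial_of_le {i j : ι} {e : ι →₀ ℕ} (h : e i ≤ e j) :
    pairOp i j (monomial e 1) = 0 := by
  rw [pairOp_monomial, Nat.sub_eq_zero_of_le h, Nat.cast_zero, zero_smul]

theorem pairOp_self (i : ι) : pairOp i i = 0 :=
  (basisMonomials ι ℂ).ext fun e => by
    rw [coe_basisMonomials, LinearMap.zero_apply]
    exact pairOp_monomial_of_le le_rfl

/-- Why `pairOp` may discard monomials with e_i ≤ e_j: in a symmetric polynomial they come with
their mirror images, and the monomial with the larger exponent at i carries the whole quotient. With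
d = e_i - e_j the right side is d x_i (x_i^d - x_j^d) times a common monomial, and the geometric sum
divides it by x_i - x_j. -/
theorem pairOp_swap_monomial {i j : ι} (hij : i ≠ j) (e : ι →₀ ℕ) (he : e j ≤ e i) :
    (X i - X j) * pairOp i j (monomial e 1 + monomial (e.mapDomain (Equiv.swap i j)) 1)
      = X i * (eulerDer i (monomial e 1 + monomial (e.mapDomain (Equiv.swap i j)) 1)
        - eulerDer j (monomial e 1 + monomial (e.mapDomain (Equiv.swap i j)) 1)) := by
  have hs : ∀ k, e.mapDomain (Equiv.swap i j) k = e (Equiv.swap i j k) := fun k => by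
    rw [Finsupp.mapDomain_equiv_apply, Equiv.symm_swap]
  set d := e i - e j with hd
  set e₀ := e - Finsupp.single i d with he₀
  have h1 : e = e₀ + Finsupp.single i d := by
    ext k
    rcases eq_or_ne k i with rfl | hk
    · simp [he₀]; omega
    · simp [he₀, Finsupp.single_eq_of_ne hk]
  have h2 : e.mapDomain (Equiv.swap i j) = e₀ + Finsupp.single j d := by
    ext k
    rw [hs]
    rcases eq_or_ne k i with rfl | hk
    · simp [he₀, Finsupp.single_eq_of_ne hij]; omega
    · rcases eq_or_ne k j with rfl | hk'
      · simp [he₀, Finsupp.single_eq_of_ne hk]; omega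
      · simp [he₀, Finsupp.single_eq_of_ne hk, Finsupp.single_eq_of_ne hk',
          Equiv.swap_apply_of_ne_of_ne hk hk']
  have m1 : (monomial e 1 : MvPolynomial ι ℂ) = monomial e₀ 1 * X i ^ d := by
    rw [X_pow_eq_monomial, monomial_mul, one_mul, ← h1]
  have m2 : (monomial (e.mapDomain (Equiv.swap i j)) 1 : MvPolynomial ι ℂ)
      = monomial e₀ 1 * X j ^ d := by
    rw [X_pow_eq_monomial, monomial_mul, one_mul, ← h2]
  have hsi := hs i
  have hsj := hs j
  rw [Equiv.swap_apply_left] at hsi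
  rw [Equiv.swap_apply_right] at hsj
  have hg := geom_sum_mul_sub (X i : MvPolynomial ι ℂ) (X j) d
  have hdc : ((d : ℕ) : ℂ) = e i - e j := by rw [hd, Nat.cast_sub he]
  rw [map_add, pairOp_monomial_of_le (e := e.mapDomain _) (by rw [hsi, hsj]; exact he), add_zero,
    pairOp_monomial, ← hd, ← he₀, map_add, map_add, eulerDer_monomial, eulerDer_monomial,
    eulerDer_monomial, eulerDer_monomial, hsi, hsj, m1, m2, hdc]
  simp only [smul_eq_C_mul, map_sub]
  linear_combination ((C (e i : ℂ) - C (e j : ℂ)) * monomial e₀ 1) * hg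

theorem pairOp_add_swap {i j : ι} (hij : i ≠ j) (F : MvPolynomial ι ℂ) :
    (X i - X j) * pairOp i j (F + rename (Equiv.swap i j) F)
      = X i * (eulerDer i (F + rename (Equiv.swap i j) F)
        - eulerDer j (F + rename (Equiv.swap i j) F)) := by
  induction F using MvPolynomial.induction_on' with
  | add u v hu hv =>
    simp only [map_add] at hu hv ⊢
    linear_combination hu + hv
  | monomial e a =>
    have h1 : (monomial e a : MvPolynomial ι ℂ) = a • monomial e 1 := by
      rw [smul_monomial, smul_eq_mul, mul_one]
    have h2 : (X i - X j) * pairOp i j (monomial e 1 + monomial (e.mapDomain (Equiv.swap i j)) 1)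
      = X i * (eulerDer i (monomial e 1 + monomial (e.mapDomain (Equiv.swap i j)) 1)
        - eulerDer j (monomial e 1 + monomial (e.mapDomain (Equiv.swap i j)) 1)) := by
      rcases le_total (e j) (e i) with h | h
      · exact pairOp_swap_monomial hij e h
      · have h3 := pairOp_swap_monomial hij (e.mapDomain (Equiv.swap i j)) (by
          rw [Finsupp.mapDomain_equiv_apply, Finsupp.mapDomain_equiv_apply, Equiv.symm_swap,
            Equiv.swap_apply_left, Equiv.swap_apply_right]
          exact h)
        rwa [← Finsupp.mapDomain_comp, show (Equiv.swap i j : ι → ι) ∘ Equiv.swap i j = id from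
          funext fun k => Equiv.swap_apply_self i j k, Finsupp.mapDomain_id, add_comm] at h3
    rw [h1, map_smul, ← smul_add, rename_monomial, map_smul, Derivation.map_smul,
      Derivation.map_smul, mul_smul_comm, h2, ← smul_sub, mul_smul_comm]

theorem pairOp_symm {i j : ι} (hij : i ≠ j) {F : MvPolynomial ι ℂ}
    (hF : rename (Equiv.swap i j) F = F) :
    (X i - X j) * pairOp i j F = X i * (eulerDer i F - eulerDer j F) := by
  have h := pairOp_add_swap hij F
  rw [hF, ← two_smul ℂ F, map_smul, Derivation.map_smul, Derivation.map_smul, ← smul_sub, mul_smul_comm,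
    mul_smul_comm] at h
  exact (smul_right_injective _ (two_ne_zero' ℂ)) h

theorem rename_psumHom (σ : Equiv.Perm ι) : rename σ (psumHom ι f) = psumHom ι f := by
  suffices h : (rename σ : MvPolynomial ι ℂ →ₐ[ℂ] _).comp (psumHom ι) = psumHom ι from
    DFunLike.congr_fun h f
  refine MvPolynomial.algHom_ext fun n => ?_
  rw [AlgHom.comp_apply, psumHom_X, rename_psum]

/-- `∑_{t < n} x_i^{n-t} x_j^t`. -/
def geomPair (i j : ι) (n : ℕ) : MvPolynomial ι ℂ :=
  ∑ t ∈ Finset.range n, X i ^ (n - t) * X j ^ t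

theorem hasFinsum_pairOp_of_ne {i j : ι} (hij : i ≠ j) :
    HasFinsum (fun n : ℕ+ => (n : ℂ) • (geomPair i j n * psumHom ι (pderiv n f)))
      (pairOp i j (psumHom ι f)) := by
  have h1 : HasFinsum (fun n : ℕ+ => (n : ℂ) • (geomPair i j n * psumHom ι (pderiv n f))) _ :=
    (hasFinsum_psumHom_pderiv f fun n => (n : ℂ) • geomPair i j n).congr fun n => by
      rw [smul_mul_assoc]
  refine h1.of_eq ?_
  have hne : (X i - X j : MvPolynomial ι ℂ) ≠ 0 := sub_ne_zero.2 fun h => hij (X_injective h)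
  refine mul_left_cancel₀ hne ?_
  rw [pairOp_symm hij (rename_psumHom f _)]
  refine (h1.map (AddMonoidHom.mulLeft (X i - X j : MvPolynomial ι ℂ))).unique
    ((((hasFinsum_eulerDer f i).sub (hasFinsum_eulerDer f j)).map
      (AddMonoidHom.mulLeft (X i : MvPolynomial ι ℂ))).congr fun n => ?_)
  have hg := geom_sum_mul_sub (X i : MvPolynomial ι ℂ) (X j) n
  simp only [AddMonoidHom.coe_mulLeft, smul_eq_C_mul, geomPair]
  linear_combination (C (n : ℂ) * psumHom ι (pderiv n f)) * hg

/-- On the diagonal `pairOp` is zero whereas the geometric sum is n x_i^n. The correction allows the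
double sum over i and j to run unrestricted. -/
theorem hasFinsum_pairOp (i j : ι) :
    HasFinsum (fun n : ℕ+ => (n : ℂ) • (geomPair i j n * psumHom ι (pderiv n f))
      - if i = j then ((n : ℂ) ^ 2) • (X i ^ (n : ℕ) * psumHom ι (pderiv n f)) else 0)
      (pairOp i j (psumHom ι f)) := by
  rcases eq_or_ne i j with rfl | hij
  · rw [pairOp_self]
    refine HasFinsum.zero.congr fun n => ?_
    have : geomPair i i n = (n : ℂ) • (X i ^ (n : ℕ) : MvPolynomial ι ℂ) := by
      rw [geomPair, Finset.sum_congr rfl (g := fun _ => (X i ^ (n : ℕ) : MvPolynomial ι ℂ))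
        fun t ht => by
          rw [← pow_add, Nat.sub_add_cancel (Finset.mem_range.1 ht).le],
        Finset.sum_const, Finset.card_range, Nat.cast_smul_eq_nsmul]
    rw [if_pos rfl, this, smul_mul_assoc, smul_smul, sq, sub_self]
  · exact (hasFinsum_pairOp_of_ne f hij).congr fun n => by rw [if_neg hij, sub_zero]

theorem sum_geomPair (n : ℕ) : ∑ i : ι, ∑ j : ι, geomPair i j (n + 1)
    = ∑ k ∈ Finset.range n, psum ι ℂ (n - k) * psum ι ℂ (k + 1)
      + (Fintype.card ι : ℂ) • psum ι ℂ (n + 1) := by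
  have h : ∑ i : ι, ∑ j : ι, geomPair i j (n + 1)
      = ∑ k ∈ Finset.range (n + 1), psum ι ℂ (n + 1 - k) * psum ι ℂ k := by
    simp only [geomPair, psum, Finset.sum_mul_sum]
    rw [Finset.sum_comm]
    rw [Finset.sum_congr rfl fun j _ => Finset.sum_comm, Finset.sum_comm]
    refine Finset.sum_congr rfl fun k _ => Finset.sum_comm
  rw [h, Finset.sum_range_succ', Nat.sub_zero, psum_zero, smul_eq_C_mul, map_natCast, mul_comm]
  congr 1
  exact Finset.sum_congr rfl fun k _ => by rw [Nat.add_sub_add_right]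

theorem hasFinsum_psum_mul_psum :
    HasFinsum (fun n : ℕ+ => (n : ℂ) • ((∑ k ∈ Finset.range (n - 1 : ℕ),
      psum ι ℂ (n - 1 - k : ℕ) * psum ι ℂ (k + 1)) * psumHom ι (pderiv n f)))
      (∑ᶠ t : ℕ+ × ℕ+, ((t.1 : ℂ) + t.2) •
        (psum ι ℂ t.1 * psum ι ℂ t.2 * psumHom ι (pderiv (t.1 + t.2) f))) := by
  have h1 : HasFinsum (fun t : ℕ+ × ℕ+ => ((t.1 : ℂ) + t.2) •
      (psum ι ℂ t.1 * psum ι ℂ t.2 * psumHom ι (pderiv (t.1 + t.2) f))) _ :=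
    hasFinsum_pderiv_add f fun t => ((((t.1 : ℂ) + t.2) •
      LinearMap.mulLeft ℂ (psum ι ℂ t.1 * psum ι ℂ t.2)).comp
        (psumHom ι).toLinearMap).toAddMonoidHom
  have h2 := (HasFinsum.of_injective (f := fun x : ℕ+ × ℕ => if x.2 < (x.1 - 1 : ℕ) then
      (x.1 : ℂ) • (psum ι ℂ (x.1 - 1 - x.2 : ℕ) * psum ι ℂ (x.2 + 1)
        * psumHom ι (pderiv x.1 f)) else 0)
    (g := fun t : ℕ+ × ℕ+ => ((t.1 + t.2, (t.2 : ℕ) - 1) : ℕ+ × ℕ)) ?_ ?_).1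
    (h1.congr fun t => ?_)
  · refine h2.curry.congr fun n => ?_
    rw [Finset.sum_mul, Finset.smul_sum,
      (HasFinsum.finset (Finset.range (n - 1 : ℕ)) fun k hk => ?_).eq]
    · exact Finset.sum_congr rfl fun k hk => (if_pos (Finset.mem_range.1 hk)).symm
    · exact if_neg fun h => hk (Finset.mem_range.2 h)
  · rintro ⟨a, b⟩ ⟨c, d⟩ h
    have h1 := congrArg (fun x : ℕ+ × ℕ => (x.1 : ℕ)) h
    have h2 := congrArg (fun x : ℕ+ × ℕ => x.2) h
    simp only [PNat.add_coe] at h1 h2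
    have hb := b.pos
    have hd := d.pos
    exact Prod.ext (PNat.eq (by simp only; omega)) (PNat.eq (by simp only; omega))
  · rintro ⟨n, k⟩ h
    refine if_neg fun hk => h ⟨(⟨n - 1 - k, Nat.sub_pos_of_lt hk⟩, k.succPNat), ?_⟩
    refine Prod.ext (PNat.eq ?_) ?_
    · change ((n : ℕ) - 1 - k) + (k + 1) = n
      omega
    · simp
  · have ha := t.1.pos
    have hb := t.2.pos
    refine (if_pos ?_).trans ?_
    · change (t.2 : ℕ) - 1 < (t.1 : ℕ) + t.2 - 1
      omega
    · rw [PNat.add_coe, show (t.1 : ℕ) + t.2 - 1 - (t.2 - 1) = t.1 by omega,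
        show (t.2 : ℕ) - 1 + 1 = t.2 by omega, Nat.cast_add]

/-- The Hamiltonian on symmetric polynomials in finitely many variables. -/
theorem psumHom_jackHam (β : ℂ) : psumHom ι (jackHam β f) =
    ∑ i : ι, eulerDer i (eulerDer i (psumHom ι f))
      + β • (∑ i : ι, ∑ j : ι, pairOp i j (psumHom ι f)
        - (Fintype.card ι : ℂ) • ∑ i : ι, eulerDer i (psumHom ι f)) := by
  have h := map_jackHam β f (psumHom ι).toLinearMap
  simp only [AlgHom.toLinearMap_apply, map_mul, psumHom_X] at h
  have hE : HasFinsum (fun n : ℕ+ => (n : ℂ) • (psum ι ℂ n * psumHom ι (pderiv n f)))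
      (∑ i : ι, eulerDer i (psumHom ι f)) :=
    (hasFinsum_psum_sum fun i => hasFinsum_eulerDer f i).congr fun n => by
      rw [← Finset.smul_sum, ← Finset.sum_mul, psum]
  have hQ : HasFinsum (fun n : ℕ+ => ((n : ℂ) ^ 2) • (psum ι ℂ n * psumHom ι (pderiv n f))) 
      (∑ᶠ n : ℕ+, ((n : ℂ) ^ 2) • (psum ι ℂ n * psumHom ι (pderiv n f))) :=
    ((hasFinsum_psumHom_pderiv f fun n => ((n : ℂ) ^ 2) • psum ι ℂ n).self.congr fun n => by
      rw [smul_mul_assoc]).self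
  have hP : HasFinsum (fun n : ℕ+ => (n : ℂ) • ((∑ i : ι, ∑ j : ι, geomPair i j n)
      * psumHom ι (pderiv n f)) - ((n : ℂ) ^ 2) • (psum ι ℂ n * psumHom ι (pderiv n f)))
      (∑ i : ι, ∑ j : ι, pairOp i j (psumHom ι f)) :=
    (hasFinsum_psum_sum fun i => hasFinsum_psum_sum fun j => hasFinsum_pairOp f i j).congr
      fun n => by
        simp only [Finset.sum_sub_distrib, Finset.sum_ite_eq, Finset.mem_univ, if_true,
          ← Finset.smul_sum, ← Finset.sum_mul, psum]
  -- The splitting term is isolated from the pair operators. The surplus ∑ n² p_n ∂_n multiplied by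
  -- β completes the coefficient 1 - β of the number term to 1, as needed for ∑ D_i².
  have key : ∑ᶠ t : ℕ+ × ℕ+, ((t.1 : ℂ) + t.2) •
        (psum ι ℂ t.1 * psum ι ℂ t.2 * psumHom ι (pderiv (t.1 + t.2) f))
      = ∑ i : ι, ∑ j : ι, pairOp i j (psumHom ι f)
        - (Fintype.card ι : ℂ) • ∑ i : ι, eulerDer i (psumHom ι f)
        + ∑ᶠ n : ℕ+, ((n : ℂ) ^ 2) • (psum ι ℂ n * psumHom ι (pderiv n f)) := by
    refine (hasFinsum_psum_mul_psum f).unique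
      (((hP.sub (hE.smul (Fintype.card ι : ℂ))).add hQ).congr fun n => ?_)
    obtain ⟨m, hm⟩ : ∃ m, (n : ℕ) = m + 1 := ⟨n - 1, by have := n.pos; omega⟩
    rw [hm, sum_geomPair, Nat.add_sub_cancel]
    simp only [smul_eq_C_mul]
    ring
  have hT : HasFinsum (fun t : ℕ+ × ℕ+ => ((t.1 : ℂ) + t.2) •
      (psum ι ℂ t.1 * psum ι ℂ t.2 * psumHom ι (pderiv (t.1 + t.2) f))) _ :=
    hasFinsum_pderiv_add f fun t => ((((t.1 : ℂ) + t.2) •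
      LinearMap.mulLeft ℂ (psum ι ℂ t.1 * psum ι ℂ t.2)).comp
        (psumHom ι).toLinearMap).toAddMonoidHom
  rw [h, sum_eulerDer_eulerDer]
  simp only [mul_smul, PNat.add_coe]
  rw [(hQ.smul (1 - β)).eq, (hT.self.smul β).eq, key]
  module

end Variables

end Halperin

namespace Halperin

open MvPolynomial

/-! ### Triangularity on monomial symmetric functions -/

/-- Decreasing lists are compared at the largest value whose multiplicities differ: up to there they
agree, and the list with fewer copies is smaller. -/
theorem list_lt_of_count {l l' : List ℕ} (hl : l.Pairwise (· ≥ ·)) (hl' : l'.Pairwise (· ≥ ·))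
    (T : ℕ) (hT : l'.count T < l.count T) (h : ∀ k, T < k → l'.count k = l.count k) : l' < l := by
  induction l generalizing l' with
  | nil => simp at hT
  | cons a s ih =>
    cases l' with
    | nil => exact List.nil_lt_cons _ _
    | cons b s' =>
      rw [List.pairwise_cons] at hl hl'
      have hTa : T ≤ a := by
        have : T ∈ a :: s := List.count_pos_iff.1 (by omega)
        rcases List.mem_cons.1 this with h1 | h1
        · exact h1.le
        · exact hl.1 _ h1
      rcases lt_trichotomy b a with hba | rfl | hba
      · exact List.cons_lt_cons_iff.2 (Or.inl hba)
      · refine List.cons_lt_cons_iff.2 (Or.inr ⟨rfl, ih hl.2 hl'.2 ?_ fun k hk => ?_⟩)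
        · rw [List.count_cons, List.count_cons] at hT
          omega
        · have := h k hk
          rw [List.count_cons, List.count_cons] at this
          omega
      · have h1 := h b (by omega)
        have h2 : (a :: s).count b = 0 := List.count_eq_zero_of_not_mem fun h2 => by
          rcases List.mem_cons.1 h2 with h3 | h3
          · omega
          · have := hl.1 _ h3
            omega
        rw [h2, List.count_cons_self] at h1
        omega

theorem rows_lt_of_count {n : ℕ} {lam mu : n.Partition} (T : ℕ)
    (hT : lam.parts.count T < mu.parts.count T)
    (h : ∀ k, T < k → lam.parts.count k = mu.parts.count k) : rows lam < rows mu := by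
  have hc : ∀ (nu : n.Partition) (k : ℕ), (rows nu).count k = nu.parts.count k := fun nu k => by
    rw [← Multiset.coe_count, rows, Multiset.sort_eq]
  refine list_lt_of_count (Multiset.pairwise_sort _ _) (Multiset.pairwise_sort _ _) T ?_ fun k hk => ?_
  · rwa [hc, hc]
  · rw [hc, hc, h k hk]

section Variables

variable {ι : Type} [Fintype ι] [DecidableEq ι]

/-- Moving boxes from a longer row to a shorter one lowers the shape. -/
theorem rows_lt_of_move {n : ℕ} {lam mu : n.Partition} {e e' : ι →₀ ℕ} (he : HasShape e mu)
    (he' : HasShape e' lam) {i j : ι} (hij : i ≠ j) {t : ℕ} (ht : 0 < t) (hti : t < e i - e j)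
    (hi : e' i = e i - t) (hj : e' j = e j + t) (h : ∀ k, k ≠ i → k ≠ j → e' k = e k) :
    rows lam < rows mu := by
  -- Both changed entries are at most e_i before the move and strictly below e_i after it. So
  -- multiplicities above e_i are unchanged, and the one at e_i drops because row i has left it.
  have key : ∀ k, e' k ≠ e k → e k ≤ e i ∧ e' k < e i := fun k hk => by
    by_cases h1 : k = i
    · subst h1; omega
    · by_cases h2 : k = j
      · subst h2; omega
      · exact absurd (h k h1 h2) hk
  refine rows_lt_of_count (e i) ?_ fun k hk => ?_
  · rw [← he' (e i) (by omega), ← he (e i) (by omega), Fintype.card_subtype, Fintype.card_subtype]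
    refine Finset.card_lt_card (Finset.ssubset_iff_of_subset (fun k hk => ?_) |>.2 ⟨i, ?_, ?_⟩)
    · have hk' := (Finset.mem_filter.1 hk).2
      refine Finset.mem_filter.2 ⟨Finset.mem_univ _, ?_⟩
      by_contra h1
      have := key k (by omega)
      omega
    · simp
    · simp only [Finset.mem_filter, Finset.mem_univ, true_and]
      omega
  · rw [← he' k (by omega), ← he k (by omega), Fintype.card_subtype, Fintype.card_subtype]
    congr 1
    refine Finset.filter_congr fun x _ => ?_
    by_cases h1 : e' x = e x
    · rw [h1]
    · have := key x h1
      constructor <;> intro <;> omega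

theorem coeff_pairOp_monomial (i j : ι) (e e' : ι →₀ ℕ) :
    coeff e' (pairOp i j (monomial e (1 : ℂ))) = ((e i - e j : ℕ) : ℂ) *
      ∑ t ∈ Finset.range (e i - e j), if e - Finsupp.single i (e i - e j)
        + (Finsupp.single i (e i - e j - t) + Finsupp.single j t) = e' then 1 else 0 := by
  rw [pairOp_monomial, coeff_smul, smul_eq_mul, Finset.mul_sum, coeff_sum]
  congr 1
  refine Finset.sum_congr rfl fun t _ => ?_
  rw [X_pow_eq_monomial, X_pow_eq_monomial, monomial_mul, monomial_mul, one_mul, one_mul,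
    coeff_monomial]

theorem move_apply {i j : ι} (hij : i ≠ j) (e : ι →₀ ℕ) {t : ℕ} (ht : t < e i - e j) :
    let e' := e - Finsupp.single i (e i - e j)
        + (Finsupp.single i (e i - e j - t) + Finsupp.single j t)
    e' i = e i - t ∧ e' j = e j + t ∧ ∀ k, k ≠ i → k ≠ j → e' k = e k := by
  refine ⟨?_, ?_, fun k hi hj => ?_⟩
  · simp [Finsupp.single_eq_of_ne hij]; omega
  · simp [Finsupp.single_eq_of_ne hij.symm]
  · simp [Finsupp.single_eq_of_ne hi, Finsupp.single_eq_of_ne hj]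

theorem coeff_pairOp_self (i j : ι) (e : ι →₀ ℕ) :
    coeff e (pairOp i j (monomial e (1 : ℂ))) = ((e i - e j : ℕ) : ℂ) := by
  rw [coeff_pairOp_monomial]
  rcases Nat.eq_zero_or_pos (e i - e j) with h | h
  · rw [h, Nat.cast_zero, zero_mul]
  have hij : i ≠ j := fun hij => by subst hij; omega
  rw [Finset.sum_eq_single 0, if_pos, mul_one]
  · ext k
    have hm := move_apply hij e h
    by_cases h1 : k = i
    · subst h1; exact hm.1
    · by_cases h2 : k = j
      · subst h2; exact hm.2.1
      · exact hm.2.2 k h1 h2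
  · intro t ht ht0
    refine if_neg fun h1 => ht0 ?_
    have hm := (move_apply hij e (Finset.mem_range.1 ht)).2.1
    rw [h1] at hm
    omega
  · exact fun h1 => absurd (Finset.mem_range.2 h) h1

/-- In the geometric sum the term t = 0 reproduces the monomial e; every other one moves t boxes
from row i to the shorter row j. -/
theorem rows_lt_of_coeff_pairOp {n : ℕ} {lam mu : n.Partition} {e e' : ι →₀ ℕ}
    (he : HasShape e mu) (he' : HasShape e' lam) (hne : e' ≠ e) {i j : ι}
    (h : coeff e' (pairOp i j (monomial e (1 : ℂ))) ≠ 0) : rows lam < rows mu := by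
  rw [coeff_pairOp_monomial] at h
  have hd : 0 < e i - e j := Nat.pos_of_ne_zero fun h0 => h (by rw [h0, Nat.cast_zero, zero_mul])
  have hij : i ≠ j := fun hij => by subst hij; omega
  obtain ⟨t, ht, h1⟩ := Finset.exists_ne_zero_of_sum_ne_zero (right_ne_zero_of_mul h)
  have h2 := (ite_ne_right_iff.1 h1).1
  have ht' := Finset.mem_range.1 ht
  obtain ⟨hi, hj, hk⟩ := move_apply hij e ht'
  rw [h2] at hi hj hk
  have ht0 : 0 < t := Nat.pos_of_ne_zero fun h0 => hne (by
    subst h0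
    ext k
    by_cases h1 : k = i
    · subst h1; exact hi
    · by_cases h2 : k = j
      · subst h2; exact hj
      · exact hk k h1 h2)
  exact rows_lt_of_move he he' hij ht0 ht' hi hj hk

/-- The Hamiltonian on symmetric polynomials. -/
def symmHam (ι : Type) [Fintype ι] [DecidableEq ι] (β : ℂ) : Module.End ℂ (MvPolynomial ι ℂ) :=
  ∑ i : ι, (eulerDer i).toLinearMap ∘ₗ (eulerDer i).toLinearMap
    + β • (∑ i : ι, ∑ j : ι, pairOp i j - (Fintype.card ι : ℂ) • ∑ i : ι, (eulerDer i).toLinearMap)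

theorem symmHam_apply (β : ℂ) (F : MvPolynomial ι ℂ) : symmHam ι β F =
    ∑ i : ι, eulerDer i (eulerDer i F)
      + β • (∑ i : ι, ∑ j : ι, pairOp i j F - (Fintype.card ι : ℂ) • ∑ i : ι, eulerDer i F) := by
  simp [symmHam, LinearMap.sum_apply]

theorem psumHom_jackHam_eq (β : ℂ) (f : MvPolynomial ℕ+ ℂ) :
    psumHom ι (jackHam β f) = symmHam ι β (psumHom ι f) := by
  rw [psumHom_jackHam, symmHam_apply]

theorem coeff_symmHam_monomial (β : ℂ) (e e' : ι →₀ ℕ) :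
    coeff e' (symmHam ι β (monomial e 1)) =
      (if e = e' then ∑ i, (e i : ℂ) ^ 2 - β * (Fintype.card ι * ∑ i, (e i : ℂ)) else 0)
      + β * ∑ i : ι, ∑ j : ι, coeff e' (pairOp i j (monomial e (1 : ℂ))) := by
  rw [symmHam_apply]
  simp only [eulerDer_monomial, Derivation.map_smul, coeff_add, coeff_smul, coeff_sub, coeff_sum,
    coeff_monomial, smul_eq_mul]
  split_ifs
  · simp only [mul_one, sq]
    ring
  · simp only [mul_zero, Finset.sum_const_zero]
    ring

theorem coeff_linearMap (T : Module.End ℂ (MvPolynomial ι ℂ)) (F : MvPolynomial ι ℂ)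
    (e' : ι →₀ ℕ) :
    coeff e' (T F) = ∑ e ∈ F.support, coeff e F * coeff e' (T (monomial e 1)) := by
  conv_lhs => rw [F.as_sum, map_sum, coeff_sum]
  refine Finset.sum_congr rfl fun e _ => ?_
  rw [← mul_one (coeff e F), ← smul_eq_mul (coeff e F), ← smul_monomial, map_smul, coeff_smul,
    smul_eq_mul, smul_eq_mul, mul_one]

end Variables

theorem hasShape_of_coeff_ne_zero {ι : Type} [Fintype ι] {n : ℕ} {mu : n.Partition} {e : ι →₀ ℕ}
    (h : coeff e (psumHom ι (monomialSymm mu)) ≠ 0) : HasShape e mu := by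
  classical
  have hd : e.degree = n := by
    by_contra hd
    exact h ((isHomogeneous_psumHom ι (monomialSymm_mem mu)).coeff_eq_zero hd)
  obtain ⟨nu, hnu⟩ := exists_hasShape hd
  rw [coeff_psumHom hnu, monoCoeff_monomialSymm] at h
  rwa [← (ite_ne_right_iff.1 h).1]

theorem rows_lt_of_monoCoeff_jackHam {β : ℂ} {n : ℕ} {lam mu : n.Partition} (hne : lam ≠ mu)
    (h : monoCoeff lam (jackHam β (monomialSymm mu)) ≠ 0) : rows lam < rows mu := by
  classical
  change coeff _ (psumHom _ _) ≠ 0 at h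
  rw [psumHom_jackHam_eq, coeff_linearMap] at h
  obtain ⟨e, -, h1⟩ := Finset.exists_ne_zero_of_sum_ne_zero h
  have he := hasShape_of_coeff_ne_zero (left_ne_zero_of_mul h1)
  have hne' : partExponent lam ≠ e := fun h2 => hne ((h2 ▸ hasShape_partExponent lam).unique he)
  have h3 := right_ne_zero_of_mul h1
  rw [coeff_symmHam_monomial, if_neg hne'.symm, zero_add] at h3
  obtain ⟨i, -, h4⟩ := Finset.exists_ne_zero_of_sum_ne_zero (right_ne_zero_of_mul h3)
  obtain ⟨j, -, h5⟩ := Finset.exists_ne_zero_of_sum_ne_zero h4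
  exact rows_lt_of_coeff_pairOp he (hasShape_partExponent lam) hne' h5

/-! ### The diagonal entries and the energy -/

theorem sum_partExponent {n : ℕ} (lam : n.Partition) {R : Type*} [AddCommMonoid R] (f : ℕ → R) :
    ∑ x, f (partExponent lam x) = (lam.parts.map f).sum := by
  rw [← Multiset.map_univ lam.parts f]
  rfl

theorem column_eq_sum {n : ℕ} (lam : n.Partition) (k : ℕ) :
    column lam k = ∑ x, if k ≤ partExponent lam x then 1 else 0 := by
  rw [sum_partExponent lam fun i => if k ≤ i then 1 else 0, column]
  induction lam.parts using Multiset.induction_on with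
  | empty => simp
  | cons a t ih =>
    rw [Multiset.map_cons, Multiset.sum_cons, ← ih, Multiset.filter_cons]
    split_ifs <;> simp [add_comm]

theorem min_eq_sum {n a b : ℕ} (ha : a ≤ n) :
    min a b = ∑ k ∈ Finset.Icc 1 n, (if k ≤ a then 1 else 0) * (if k ≤ b then 1 else 0) := by
  simp only [← ite_and, mul_boole]
  rw [Finset.sum_boole]
  have : (Finset.Icc 1 n).filter (fun k => k ≤ b ∧ k ≤ a) = Finset.Icc 1 (min a b) := by
    ext k
    simp only [Finset.mem_filter, Finset.mem_Icc, le_min_iff]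
    omega
  rw [this]
  simp

/-- The minimum of two rows counts the columns that meet both; exchanging sums counts, for each
column, the pairs of its boxes. -/
theorem sum_min_partExponent {n : ℕ} (lam : n.Partition) :
    ∑ x, ∑ y, min (partExponent lam x) (partExponent lam y)
      = ∑ k ∈ Finset.Icc 1 n, column lam k ^ 2 := by
  have hle : ∀ x, partExponent lam x ≤ n := fun x => by
    conv_rhs => rw [← lam.parts_sum]
    exact Multiset.le_sum_of_mem (Multiset.coe_mem)
  rw [Finset.sum_congr rfl fun x _ => Finset.sum_congr rfl fun y _ => min_eq_sum (hle x),
    Finset.sum_congr rfl fun x _ => Finset.sum_comm, Finset.sum_comm]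
  refine Finset.sum_congr rfl fun k _ => ?_
  rw [sq, column_eq_sum, Finset.sum_mul_sum]

/-- With one variable for each part of λ, pair (i, j) contributes max(λ_i - λ_j, 0) = λ_i - min(λ_i,
λ_j). The sum of the λ_i cancels the term with the number of variables, and the minima give the
squares of the columns. -/
theorem monoCoeff_jackHam_self (p : ℝ) {n : ℕ} (lam : n.Partition) :
    monoCoeff lam (jackHam (p / 2) (monomialSymm lam)) = layerEnergy p lam := by
  classical
  change coeff _ (psumHom _ _) = _
  set e := partExponent lam with he
  have hc : coeff e (psumHom lam.parts.ToType (monomialSymm lam)) = 1 := by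
    rw [coeff_psumHom (hasShape_partExponent lam), monoCoeff_monomialSymm, if_pos rfl]
  rw [psumHom_jackHam_eq, coeff_linearMap, Finset.sum_eq_single e, hc, one_mul,
    coeff_symmHam_monomial, if_pos rfl]
  · have h1 : ∑ i, (e i : ℂ) ^ 2 = ((lam.parts.map fun i => (i : ℝ) ^ 2).sum : ℝ) := by
      simp only [Multiset.bind_def, Multiset.pure_def, Multiset.bind_singleton, Multiset.map_map,
        Function.comp_def]
      rw [← sum_partExponent lam fun i => (i : ℝ) ^ 2]
      push_cast
      rfl
    have h2 : ∀ i j, coeff e (pairOp i j (monomial e (1 : ℂ)))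
        = (e i : ℂ) - ((min (e i) (e j) : ℕ) : ℂ) := fun i j => by
      rw [coeff_pairOp_self, eq_sub_iff_add_eq, ← Nat.cast_add]
      congr 1
      omega
    have h3 := congrArg (Nat.cast : ℕ → ℂ) (sum_min_partExponent lam)
    rw [← he] at h3
    simp only [Nat.cast_sum] at h3
    simp only [h1, h2, Finset.sum_sub_distrib, h3, Finset.sum_const, Finset.card_univ,
      nsmul_eq_mul, ← Finset.mul_sum, layerEnergy]
    push_cast
    ring
  -- The other monomials of m_λ have the same shape and cannot contribute, because an off-diagonal
  -- entry strictly lowers the shape.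
  · intro e' he' hne
    have hs := hasShape_of_coeff_ne_zero (mem_support_iff.1 he')
    rw [coeff_symmHam_monomial, if_neg hne, Finset.sum_eq_zero, mul_zero, add_zero, mul_zero]
    intro i _
    refine Finset.sum_eq_zero fun j _ => ?_
    by_contra h
    exact lt_irrefl _ (rows_lt_of_coeff_pairOp hs (hasShape_partExponent lam) hne.symm h)
  · intro h
    rw [notMem_support_iff.1 h, zero_mul]

/-! ### Jack functions as eigenvectors -/

theorem symmDeg_pderiv {n : ℕ} {f : MvPolynomial ℕ+ ℂ} (hf : f ∈ symmDeg n) (k : ℕ+) :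
    pderiv k f = 0 ∨ ∃ m, m + k = n ∧ pderiv k f ∈ symmDeg m := by
  by_cases hk : (k : ℕ) ≤ n
  · refine Or.inr ⟨n - k, Nat.sub_add_cancel hk, mem_symmDeg.2 fun d hd => ?_⟩
    rw [coeff_pderiv] at hd
    have := mem_symmDeg.1 hf _ (left_ne_zero_of_mul hd)
    rw [map_add, pweight_single] at this
    omega
  · refine Or.inl (MvPolynomial.ext _ _ fun d => ?_)
    by_contra hd
    rw [coeff_pderiv, coeff_zero] at hd
    have := mem_symmDeg.1 hf _ (left_ne_zero_of_mul hd)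
    rw [map_add, pweight_single] at this
    omega

theorem symmDeg_mul {m n : ℕ} {f g : MvPolynomial ℕ+ ℂ} (hf : f ∈ symmDeg m) (hg : g ∈ symmDeg n) :
    f * g ∈ symmDeg (m + n) := IsWeightedHomogeneous.mul hf hg

theorem symmDeg_X (k : ℕ+) : (X k : MvPolynomial ℕ+ ℂ) ∈ symmDeg k :=
  isWeightedHomogeneous_X _ _ k

theorem jackHam_mem (β : ℂ) {n : ℕ} {f : MvPolynomial ℕ+ ℂ} (hf : f ∈ symmDeg n) :
    jackHam β f ∈ symmDeg n := by
  have key : ∀ {n : ℕ} {f g : MvPolynomial ℕ+ ℂ} (k : ℕ+), f ∈ symmDeg n → g ∈ symmDeg k →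
      g * pderiv k f ∈ symmDeg n := fun {n f g} k hf hg => by
    rcases symmDeg_pderiv hf k with h | ⟨m, rfl, h⟩
    · rw [h, mul_zero]
      exact zero_mem _
    · rw [add_comm]
      exact symmDeg_mul hg h
  refine add_mem (finsum_induction (· ∈ symmDeg n) (zero_mem _) (fun _ _ => add_mem) fun k =>
    Submodule.smul_mem _ _ (key k hf (symmDeg_X k)))
    (finsum_induction (· ∈ symmDeg n) (zero_mem _) (fun _ _ => add_mem) fun t =>
      add_mem (Submodule.smul_mem _ _ (key _ hf (symmDeg_mul (symmDeg_X _) (symmDeg_X _))))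
        (Submodule.smul_mem _ _ ?_))
  rcases symmDeg_pderiv hf t.2 with h | ⟨m, rfl, h⟩
  · rw [h, map_zero, mul_zero]
    exact zero_mem _
  rcases symmDeg_pderiv h t.1 with h' | ⟨l, rfl, h'⟩
  · rw [h', mul_zero]
    exact zero_mem _
  · rw [add_assoc, add_comm l]
    exact symmDeg_mul (symmDeg_X _) h'

/-- The Jack functions are eigenvectors of the Hamiltonian. -/
theorem jackHam_jack {p : ℝ} (hp : 0 < p) {n : ℕ} (lam : n.Partition) :
    jackHam (p / 2) (jack (2 / (p : ℂ)) lam)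
      = (layerEnergy p lam : ℂ) • jack (2 / (p : ℂ)) lam := by
  have hα : (0 : ℝ) < 2 / p := div_pos two_pos hp
  have hcast : ((2 / p : ℝ) : ℂ) = 2 / (p : ℂ) := by push_cast; rfl
  have hp' : (p : ℂ) ≠ 0 := by exact_mod_cast hp.ne'
  have hJ := isJack_jack hα lam
  rw [hcast] at hJ
  obtain ⟨hP, hP1, hP2, hP3⟩ := isJack_iff.1 hJ
  set P := jack (2 / (p : ℂ)) lam
  set E : ℂ := (layerEnergy p lam : ℂ) with hE
  have hle : ∀ nu : n.Partition, nu ≠ lam → monoCoeff nu P ≠ 0 → rows nu < rows lam :=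
    fun nu h1 h2 => lt_of_le_of_ne (not_lt.1 fun h => h2 (hP2 nu h)) fun h =>
      h1 (rows_injective n h)
  have hH : ∀ f ∈ symmDeg n, ∀ mu : n.Partition, monoCoeff mu (jackHam (p / 2) f)
      = ∑ nu : n.Partition, monoCoeff nu f * monoCoeff mu (jackHam (p / 2) (monomialSymm nu)) :=
    fun f hf mu => by
      have h := congrArg (fun g => monoCoeff mu (jackHamₗ (p / 2) g)) (eq_sum_monomialSymm hf)
      simp only [map_sum, map_smul, smul_eq_mul] at h
      exact h
  have hQ : jackHam (p / 2) P - E • P ∈ symmDeg n :=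
    sub_mem (jackHam_mem _ hP) (Submodule.smul_mem _ _ hP)
  -- The difference HP - EP contains only monomial functions smaller than m_λ: H is triangular, and
  -- its diagonal entry E cancels the leading term. It remains to check orthogonality to these.
  refine sub_eq_zero.1 (eq_zero_of_orthogonal hα hQ fun mu hmu => ?_)
  have hlt : rows mu < rows lam := by
    rw [map_sub, map_smul, hH P hP] at hmu
    by_contra hnot
    refine hmu ?_
    have hz : ∀ nu : n.Partition, nu ≠ lam →
        monoCoeff nu P * monoCoeff mu (jackHam (p / 2) (monomialSymm nu)) = 0 := fun nu hnu => by
      by_contra h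
      have h1 := hle nu hnu (left_ne_zero_of_mul h)
      have h2 := right_ne_zero_of_mul h
      by_cases h3 : mu = nu
      · exact hnot (h3 ▸ h1)
      · exact hnot ((rows_lt_of_monoCoeff_jackHam h3 h2).trans h1)
    rw [Finset.sum_eq_single lam (fun nu _ => hz nu) fun h => absurd (Finset.mem_univ _) h, hP1,
      one_mul]
    by_cases h : mu = lam
    · rw [h, monoCoeff_jackHam_self, hP1, smul_eq_mul, mul_one, sub_self]
    · have h1 : monoCoeff mu P = 0 := by
        by_contra h1
        exact hnot (hle mu h h1)
      have h2 : monoCoeff mu (jackHam (p / 2) (monomialSymm lam)) = 0 := by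
        by_contra h2
        exact hnot (rows_lt_of_monoCoeff_jackHam h h2)
      rw [h1, h2, smul_zero, sub_zero]
  -- Self-adjointness moves H onto m_μ. By triangularity H m_μ involves only m_ν with ν ≤ μ < λ, and
  -- P is orthogonal to all of them.
  rw [map_sub, map_smul, LinearMap.sub_apply, LinearMap.smul_apply, hcast, hP3 mu hlt, smul_zero,
    sub_zero, jackHam_selfAdjoint (by field_simp),
    eq_sum_monomialSymm (jackHam_mem _ (monomialSymm_mem mu)), map_sum]
  refine Finset.sum_eq_zero fun nu _ => ?_
  rw [map_smul]
  by_cases h : monoCoeff nu (jackHam (p / 2) (monomialSymm mu)) = 0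
  · rw [h, zero_smul]
  · rw [hP3 nu, smul_zero]
    by_cases h1 : nu = mu
    · exact h1 ▸ hlt
    · exact (rows_lt_of_monoCoeff_jackHam h1 h).trans hlt

end Halperin

namespace Halperin

open MvPolynomial TensorProduct

/-! ### The basis of Jack functions -/

theorem monoCoeff_eq_zero_of_mem {m n : ℕ} (hmn : m ≠ n) {f : MvPolynomial ℕ+ ℂ}
    (hf : f ∈ symmDeg m) (lam : n.Partition) : monoCoeff lam f = 0 :=
  (isHomogeneous_psumHom _ hf).coeff_eq_zero fun h =>
    hmn (h.symm.trans (hasShape_partExponent lam).degree_eq)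

/-- In a relation, the coefficient of m_λ for the largest λ that occurs in a given degree sees P_λ
alone. -/
theorem linearIndependent_jack {α : ℝ} (hα : 0 < α) :
    LinearIndependent ℂ fun s : Σ d : ℕ, d.Partition => jack (α : ℂ) s.2 := by
  classical
  rw [linearIndependent_iff']
  intro S g h i hi
  by_contra hne
  obtain ⟨⟨n, lam⟩, hs, hmax⟩ := Finset.exists_max_image
    (S.filter fun s => s.1 = i.1 ∧ g s ≠ 0) (fun s => rows s.2)
    ⟨i, Finset.mem_filter.2 ⟨hi, rfl, hne⟩⟩
  obtain ⟨hS, hn, hg⟩ := Finset.mem_filter.1 hs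
  have h1 := congrArg (monoCoeff lam) h
  rw [map_sum, map_zero, Finset.sum_eq_single ⟨n, lam⟩, map_smul,
    (isJack_iff.1 (isJack_jack hα lam)).2.1, smul_eq_mul, mul_one] at h1
  · exact hg h1
  · rintro ⟨m, mu⟩ hm hne'
    have hJ := isJack_iff.1 (isJack_jack hα mu)
    rw [map_smul]
    by_cases hmn : m = n
    · subst hmn
      by_cases hg' : g ⟨m, mu⟩ = 0
      · rw [hg', zero_smul]
      · have hle := hmax ⟨m, mu⟩ (Finset.mem_filter.2 ⟨hm, hn, hg'⟩)
        rw [hJ.2.2.1 lam (lt_of_le_of_ne hle fun h => hne' (by rw [rows_injective m h])), smul_zero]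
    · rw [monoCoeff_eq_zero_of_mem hmn hJ.1, smul_zero]
  · exact fun h => absurd hS h

theorem monomialSymm_mem_span_jack {α : ℝ} (hα : 0 < α) {n : ℕ} (lam : n.Partition) :
    monomialSymm lam ∈ Submodule.span ℂ
      (Set.range fun s : Σ d : ℕ, d.Partition => jack (α : ℂ) s.2) := by
  classical
  by_contra hlam
  obtain ⟨mu, hmu, hmin⟩ := Finset.exists_min_image (Finset.univ.filter fun mu : n.Partition =>
    monomialSymm mu ∉ Submodule.span ℂ
      (Set.range fun s : Σ d : ℕ, d.Partition => jack (α : ℂ) s.2)) rows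
    ⟨lam, Finset.mem_filter.2 ⟨Finset.mem_univ _, hlam⟩⟩
  refine (Finset.mem_filter.1 hmu).2 ?_
  have hJ := isJack_iff.1 (isJack_jack hα mu)
  have h := eq_sum_monomialSymm hJ.1
  rw [← Finset.add_sum_erase _ _ (Finset.mem_univ mu), hJ.2.1, one_smul, ← sub_eq_iff_eq_add] at h
  rw [← h]
  refine sub_mem (Submodule.subset_span ⟨⟨n, mu⟩, rfl⟩) (sum_mem fun nu hnu => ?_)
  by_cases h0 : monoCoeff nu (jack (α : ℂ) mu) = 0
  · rw [h0, zero_smul]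
    exact zero_mem _
  · refine Submodule.smul_mem _ _ ?_
    by_contra hnot
    have hle := hmin nu (Finset.mem_filter.2 ⟨Finset.mem_univ _, hnot⟩)
    exact h0 (hJ.2.2.1 nu (lt_of_le_of_ne hle fun h =>
      Finset.ne_of_mem_erase hnu (rows_injective n h.symm)))

theorem span_jack {α : ℝ} (hα : 0 < α) :
    ⊤ ≤ Submodule.span ℂ (Set.range fun s : Σ d : ℕ, d.Partition => jack (α : ℂ) s.2) := by
  intro f _
  rw [f.as_sum]
  refine sum_mem fun d _ => ?_
  have hd : monomial d (coeff d f) ∈ symmDeg (pweight d) :=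
    isWeightedHomogeneous_monomial _ _ _ rfl
  rw [eq_sum_monomialSymm hd]
  exact sum_mem fun mu _ => Submodule.smul_mem _ _ (monomialSymm_mem_span_jack hα mu)

/-- The basis of Jack functions. -/
def jackBasis {α : ℝ} (hα : 0 < α) :
    Module.Basis (Σ d : ℕ, d.Partition) ℂ (MvPolynomial ℕ+ ℂ) :=
  Module.Basis.mk (linearIndependent_jack hα) (span_jack hα)

theorem jackBasis_apply {α : ℝ} (hα : 0 < α) (s : Σ d : ℕ, d.Partition) :
    jackBasis hα s = jack (α : ℂ) s.2 := Module.Basis.mk_apply _ _ _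

/-! ### The layers of the Fock space -/

/-- Symmetric functions as states of layer `I`. -/
def layerHom (c : ℂ) (I : Fin 2) : MvPolynomial ℕ+ ℂ →ₐ[ℂ] Fock :=
  aeval fun k => c • (X (I, k) : Fock)

theorem layerHom_X (c : ℂ) (I : Fin 2) (k : ℕ+) : layerHom c I (X k) = c • X (I, k) := aeval_X _ _

theorem pderiv_layerHom (c : ℂ) (I J : Fin 2) (k : ℕ+) (f : MvPolynomial ℕ+ ℂ) :
    pderiv (J, k) (layerHom c I f) = if J = I then c • layerHom c I (pderiv k f) else 0 := by
  induction f using MvPolynomial.induction_on with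
  | C a => simp [layerHom, MvPolynomial.algebraMap_eq]
  | add u v hu hv =>
    rw [map_add, map_add, hu, hv, map_add, map_add]
    split_ifs <;> simp
  | mul_X u n hu =>
    rw [map_mul, Derivation.leibniz, Derivation.leibniz, hu, layerHom_X, Derivation.map_smul,
      pderiv_X, pderiv_X, map_add, smul_eq_mul, smul_eq_mul, smul_eq_mul, smul_eq_mul, map_mul,
      map_mul, layerHom_X]
    by_cases hJ : J = I
    · subst hJ
      by_cases hk : k = n
      · subst hk
        simp only [Pi.single_eq_same, if_true, map_one, mul_one, smul_add, mul_smul_comm,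
          smul_mul_assoc]
      · have h1 : (J, k) ≠ (J, n) := fun h => hk (congrArg Prod.snd h)
        rw [Pi.single_eq_of_ne h1.symm, Pi.single_eq_of_ne (Ne.symm hk), map_zero]
        simp only [if_true, smul_zero, mul_zero, zero_add, smul_mul_assoc, mul_smul_comm]
    · have h1 : (J, k) ≠ (I, n) := fun h => hJ (congrArg Prod.fst h)
      rw [Pi.single_eq_of_ne h1.symm, if_neg hJ, if_neg hJ, smul_zero, mul_zero, mul_zero, add_zero]

/-- A state w of the other layer is a constant for the derivatives of layer I, so it is carried
along as a factor. -/
theorem laughlinHam_layerHom_mul {p : ℝ} (hp : 0 < p) {I : Fin 2} (f : MvPolynomial ℕ+ ℂ)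
    {w : Fock} (hw : ∀ k, pderiv (I, k) w = 0) :
    laughlinHam bose p I (layerHom (2 / ((Real.sqrt p : ℝ) : ℂ)) I f * w)
      = layerHom (2 / ((Real.sqrt p : ℝ) : ℂ)) I (jackHam (p / 2) f) * w := by
  refine laughlinHam_map hp (LinearMap.mulRight ℂ w ∘ₗ (layerHom _ I).toLinearMap)
    (fun k f => ?_) (fun k f => ?_) f
  · simp only [LinearMap.comp_apply, AlgHom.toLinearMap_apply, LinearMap.mulRight_apply, map_mul,
      layerHom_X, smul_mul_assoc, mul_assoc]
  · simp only [LinearMap.comp_apply, AlgHom.toLinearMap_apply, LinearMap.mulRight_apply]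
    rw [Derivation.leibniz, hw, pderiv_layerHom, if_pos rfl, smul_zero, zero_add, smul_eq_mul,
      mul_smul_comm, mul_comm]

/-- The bi-Jack states are eigenvectors of the two Laughlin Hamiltonians. -/
theorem freeHam_biJack {p q : ℝ} (hp : 0 < p) (hq : 0 < q) {d e : ℕ} (lam : d.Partition)
    (mu : e.Partition) : freeHam p q (biJack p q lam mu)
      = (energy p q lam mu : ℂ) • biJack p q lam mu := by
  have h1 : laughlinHam bose p 0 (biJack p q lam mu)
      = (layerEnergy p lam : ℂ) • biJack p q lam mu := by
    have := laughlinHam_layerHom_mul hp (I := 0) (jack (2 / (p : ℂ)) lam) (w := jackState q 1 mu)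
      fun k => (pderiv_layerHom _ 1 0 k _).trans (if_neg (by decide))
    rwa [jackHam_jack hp, map_smul, smul_mul_assoc] at this
  have h2 : laughlinHam bose q 1 (biJack p q lam mu)
      = (layerEnergy q mu : ℂ) • biJack p q lam mu := by
    have := laughlinHam_layerHom_mul hq (I := 1) (jack (2 / (q : ℂ)) mu) (w := jackState p 0 lam)
      fun k => (pderiv_layerHom _ 0 1 k _).trans (if_neg (by decide))
    rw [jackHam_jack hq, map_smul, smul_mul_assoc, mul_comm] at this
    exact this
  rw [freeHam, h1, h2, energy, ← add_smul, Complex.ofReal_add]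

/-- Rescaling of the variables. -/
def scaleEquiv {σ : Type} (c : σ → ℂ) (hc : ∀ k, c k ≠ 0) :
    MvPolynomial σ ℂ ≃ₐ[ℂ] MvPolynomial σ ℂ :=
  AlgEquiv.ofAlgHom (aeval fun k => c k • X k) (aeval fun k => (c k)⁻¹ • X k)
    (algHom_ext fun k => by
      rw [AlgHom.comp_apply, aeval_X, map_smul, aeval_X, smul_smul, inv_mul_cancel₀ (hc k),
        one_smul, AlgHom.id_apply])
    (algHom_ext fun k => by
      rw [AlgHom.comp_apply, aeval_X, map_smul, aeval_X, smul_smul, mul_inv_cancel₀ (hc k),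
        one_smul, AlgHom.id_apply])

/-- The Fock space as the tensor product of its layers. -/
def fockEquiv (c : Fin 2 → ℂ) (hc : ∀ I, c I ≠ 0) :
    MvPolynomial ℕ+ ℂ ⊗[ℂ] MvPolynomial ℕ+ ℂ ≃ₐ[ℂ] Fock :=
  (tensorEquivSum ℂ ℕ+ ℕ+ ℂ).trans ((renameEquiv ℂ
    ((finTwoEquiv.prodCongr (Equiv.refl ℕ+)).trans (Equiv.boolProdEquivSum ℕ+)).symm).trans
      (scaleEquiv (fun k => c k.1) fun k => hc k.1))

theorem fockEquiv_tmul (c : Fin 2 → ℂ) (hc : ∀ I, c I ≠ 0) (f g : MvPolynomial ℕ+ ℂ) :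
    fockEquiv c hc (f ⊗ₜ g) = layerHom (c 0) 0 f * layerHom (c 1) 1 g := by
  have h1 : (fockEquiv c hc).toAlgHom.comp (Algebra.TensorProduct.includeLeft :
      MvPolynomial ℕ+ ℂ →ₐ[ℂ] MvPolynomial ℕ+ ℂ ⊗[ℂ] MvPolynomial ℕ+ ℂ)
      = layerHom (c 0) 0 := algHom_ext fun k => by
    rw [layerHom_X]
    simp [fockEquiv, scaleEquiv]
    rfl
  have h2 : (fockEquiv c hc).toAlgHom.comp (Algebra.TensorProduct.includeRight :
      MvPolynomial ℕ+ ℂ →ₐ[ℂ] MvPolynomial ℕ+ ℂ ⊗[ℂ] MvPolynomial ℕ+ ℂ)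
      = layerHom (c 1) 1 := algHom_ext fun k => by
    rw [layerHom_X]
    simp [fockEquiv, scaleEquiv]
    rfl
  have h3 : f ⊗ₜ[ℂ] g = (f ⊗ₜ 1) * (1 ⊗ₜ g) := by
    rw [Algebra.TensorProduct.tmul_mul_tmul, mul_one, one_mul]
  rw [h3, map_mul, ← h1, ← h2]
  rfl

theorem two_div_sqrt_ne_zero {p q : ℝ} (hp : 0 < p) (hq : 0 < q) (I : Fin 2) :
    (![2 / ((Real.sqrt p : ℝ) : ℂ), 2 / ((Real.sqrt q : ℝ) : ℂ)] : Fin 2 → ℂ) I ≠ 0 := by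
  have h1 : ((Real.sqrt p : ℝ) : ℂ) ≠ 0 := by exact_mod_cast (Real.sqrt_pos.2 hp).ne'
  have h2 : ((Real.sqrt q : ℝ) : ℂ) ≠ 0 := by exact_mod_cast (Real.sqrt_pos.2 hq).ne'
  fin_cases I
  · exact div_ne_zero two_ne_zero h1
  · exact div_ne_zero two_ne_zero h2

/-- The basis of bi-Jack states. -/
def biJackBasis {p q : ℝ} (hp : 0 < p) (hq : 0 < q) :
    Module.Basis ((Σ d : ℕ, d.Partition) × (Σ e : ℕ, e.Partition)) ℂ Fock :=
  ((jackBasis (div_pos two_pos hp)).tensorProduct (jackBasis (div_pos two_pos hq))).map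
    (fockEquiv _ (two_div_sqrt_ne_zero hp hq)).toLinearEquiv

theorem biJackBasis_apply {p q : ℝ} (hp : 0 < p) (hq : 0 < q)
    (s : (Σ d : ℕ, d.Partition) × (Σ e : ℕ, e.Partition)) :
    biJackBasis hp hq s = biJack p q s.1.2 s.2.2 := by
  rw [biJackBasis, Module.Basis.map_apply, Module.Basis.tensorProduct_apply, jackBasis_apply,
    jackBasis_apply]
  have h := fockEquiv_tmul _ (two_div_sqrt_ne_zero hp hq) (jack ((2 / p : ℝ) : ℂ) s.1.2)
    (jack ((2 / q : ℝ) : ℂ) s.2.2)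
  refine h.trans ?_
  rw [Complex.ofReal_div, Complex.ofReal_div]
  rfl

theorem linearIndependent_biJack {p q : ℝ} (hp : 0 < p) (hq : 0 < q) :
    LinearIndependent ℂ (fun s : (Σ d : ℕ, d.Partition) × (Σ e : ℕ, e.Partition) =>
      biJack p q s.1.2 s.2.2) := by
  rw [← funext (biJackBasis_apply hp hq)]
  exact (biJackBasis hp hq).linearIndependent

theorem span_biJack {p q : ℝ} (hp : 0 < p) (hq : 0 < q) :
    Submodule.span ℂ (Set.range fun s : (Σ d : ℕ, d.Partition) × (Σ e : ℕ, e.Partition) =>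
      biJack p q s.1.2 s.2.2) = ⊤ := by
  rw [← funext (biJackBasis_apply hp hq)]
  exact (biJackBasis hp hq).span_eq

end Halperin

namespace Halperin

open MvPolynomial

/-! ### Linearity of the Hamiltonians -/

theorem exists_linear_finsum {α V : Type} [AddCommGroup V] [Module ℂ V] (F : α → Module.End ℂ V)
    (h : ∀ v, HasFinsum (fun t => F t v) (∑ᶠ t, F t v)) :
    ∃ L : Module.End ℂ V, ∀ v, L v = ∑ᶠ t, F t v :=
  ⟨{ toFun := fun v => ∑ᶠ t, F t v
     map_add' := fun u v => by
       simp only [map_add]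
       exact ((h u).add (h v)).eq
     map_smul' := fun c v => by
       simp only [map_smul]
       exact ((h v).smul c).eq }, fun _ => rfl⟩

theorem exists_linear_laughlinHam (p : ℝ) (I : Fin 2) :
    ∃ L : Module.End ℂ Fock, ∀ v, L v = laughlinHam bose p I v := by
  have hH := isHeisenberg_mode 0
  obtain ⟨L₁, h₁⟩ := exists_linear_finsum
    (fun n : ℕ+ => (n : ℂ) • (mode 0 I (-n) * mode 0 I n))
    fun v => hH.finsum_number_smul I I (fun n => (n : ℂ)) v
  obtain ⟨L₂, h₂⟩ := exists_linear_finsum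
    (fun t : ℕ+ × ℕ+ => mode 0 I (-t.1) * (mode 0 I (-t.2) * mode 0 I (t.1 + t.2))
      + (1 / 2 : ℂ) • (mode 0 I (-t.1 - t.2) * (mode 0 I t.1 * mode 0 I t.2)))
    fun v => ((hH.finsum_split I I I v).add ((hH.finsum_merge I I I v).smul (1 / 2 : ℂ))).self
  exact ⟨(1 - (p : ℂ) / 2) • L₁ + ((Real.sqrt p : ℝ) : ℂ) • L₂, fun v => by
    rw [LinearMap.add_apply, LinearMap.smul_apply, LinearMap.smul_apply, h₁, h₂]
    rfl⟩

theorem exists_linear_freeHam (p q : ℝ) : ∃ L : Module.End ℂ Fock, ∀ v, L v = freeHam p q v := by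
  obtain ⟨L₁, h₁⟩ := exists_linear_laughlinHam p 0
  obtain ⟨L₂, h₂⟩ := exists_linear_laughlinHam q 1
  exact ⟨L₁ + L₂, fun v => by rw [LinearMap.add_apply, h₁, h₂, freeHam]⟩

theorem exists_linear_interaction (p q r : ℝ) :
    ∃ L : Module.End ℂ Fock, ∀ v, L v = interaction bose p q r v := by
  have hH := isHeisenberg_mode 0
  obtain ⟨L₁, h₁⟩ := exists_linear_finsum
    (fun t : ℕ × ℕ+ => mode 0 0 (-t.1) * (mode 0 0 (t.1 - t.2) * mode 0 1 t.2))
    fun v => (hH.finsum_int1' v).self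
  obtain ⟨L₂, h₂⟩ := exists_linear_finsum
    (fun t : ℕ+ × ℕ+ => mode 0 0 (-t.2) * (mode 0 1 (-t.1) * mode 0 1 (t.1 + t.2)))
    fun v => (hH.finsum_int2 v).self
  exact ⟨(2 * (r : ℂ) / (Real.sqrt q : ℝ)) • L₁ + -((2 * (r : ℂ) / (Real.sqrt p : ℝ)) • L₂),
    fun v => by
      rw [LinearMap.add_apply, LinearMap.neg_apply, LinearMap.smul_apply, LinearMap.smul_apply,
        h₁, h₂]
      rfl⟩

/-! ### The numbers of boxes in the two layers -/

/-- The inclusion of the degrees of layer `I`. -/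
def layerDeg (I : Fin 2) : ℤ →+ ℤ × ℤ :=
  if I = 0 then AddMonoidHom.inl ℤ ℤ else AddMonoidHom.inr ℤ ℤ

/-- The degrees of the creation operators. -/
def biWeight (k : Fin 2 × ℕ+) : ℤ × ℤ := layerDeg k.1 (k.2 : ℤ)

/-- The states of a given bidegree. -/
def biDeg (z : ℤ × ℤ) : Submodule ℂ Fock := weightedHomogeneousSubmodule ℂ biWeight z

/-- Degrees are taken in ℤ × ℤ so that a mode of either sign shifts the bidegree by a plain
subtraction; negative degrees then contain only 0. -/
theorem bose_mem {z : ℤ × ℤ} {v : Fock} (hv : v ∈ biDeg z) (I : Fin 2) (j : ℤ) :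
    bose I j v ∈ biDeg (z - layerDeg I j) := by
  rcases int_cases j with ⟨n, rfl⟩ | rfl | ⟨n, rfl⟩
  · rw [bose, mode_pos]
    exact Submodule.smul_mem _ _ (IsWeightedHomogeneous.pderiv hv (sub_add_cancel _ _))
  · rw [bose_zero]
    exact zero_mem _
  · rw [bose, mode_neg, map_neg, sub_neg_eq_add, add_comm]
    exact IsWeightedHomogeneous.mul (isWeightedHomogeneous_X ℂ biWeight (I, n)) hv

theorem eq_zero_of_mem_biDeg {z : ℤ × ℤ} (hz : z.2 < 0) {v : Fock} (hv : v ∈ biDeg z) : v = 0 := by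
  refine MvPolynomial.ext _ _ fun d => ?_
  by_contra hd
  have h := hv hd
  have h2 : 0 ≤ (Finsupp.weight biWeight d).2 := by
    rw [Finsupp.weight_apply]
    change 0 ≤ AddMonoidHom.snd ℤ ℤ _
    rw [map_finsuppSum]
    refine Finset.sum_nonneg fun k _ => ?_
    change 0 ≤ (d k • biWeight k).2
    rw [Prod.smul_snd]
    refine nsmul_nonneg ?_ _
    rw [biWeight, layerDeg]
    split_ifs
    · exact le_rfl
    · exact Int.natCast_nonneg _
  rw [h] at h2
  omega

theorem layerHom_mem (c : ℂ) (I : Fin 2) {n : ℕ} {f : MvPolynomial ℕ+ ℂ} (hf : f ∈ symmDeg n) :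
    layerHom c I f ∈ biDeg (layerDeg I n) := by
  rw [f.as_sum, map_sum]
  refine sum_mem fun d hd => ?_
  have hm : monomial d (coeff d f) = coeff d f • (monomial d 1 : MvPolynomial ℕ+ ℂ) := by
    rw [smul_monomial, smul_eq_mul, mul_one]
  rw [hm, map_smul, ← mem_symmDeg.1 hf d (mem_support_iff.1 hd)]
  refine Submodule.smul_mem _ _ ?_
  clear hm hd hf
  induction d using Finsupp.induction_linear with
  | zero =>
    rw [map_zero, Nat.cast_zero, map_zero]
    exact (map_one (layerHom c I)).symm ▸ isWeightedHomogeneous_one ℂ biWeight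
  | add d d' h h' =>
    rw [← one_mul (1 : ℂ), ← monomial_mul, map_mul, map_add, Nat.cast_add, map_add]
    exact IsWeightedHomogeneous.mul h h'
  | single k m =>
    have hk : pweight (Finsupp.single k m) = m * k := by
      rw [pweight, Finsupp.weight_single, smul_eq_mul]
    rw [← X_pow_eq_monomial, map_pow, layerHom_X, hk, Nat.cast_mul, ← nsmul_eq_mul, map_nsmul]
    exact IsWeightedHomogeneous.pow (Submodule.smul_mem (biDeg (layerDeg I k)) c
      (isWeightedHomogeneous_X ℂ biWeight (I, k))) m

theorem biJack_mem {p q : ℝ} (hp : 0 < p) (hq : 0 < q) {d e : ℕ} (lam : d.Partition)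
    (mu : e.Partition) : biJack p q lam mu ∈ biDeg ((d : ℤ), (e : ℤ)) := by
  have h1 := (isJack_iff.1 (isJack_jack (div_pos two_pos hp) lam)).1
  have h2 := (isJack_iff.1 (isJack_jack (div_pos two_pos hq) mu)).1
  rw [Complex.ofReal_div] at h1 h2
  have h := IsWeightedHomogeneous.mul (layerHom_mem (2 / ((Real.sqrt p : ℝ) : ℂ)) 0 h1)
    (layerHom_mem (2 / ((Real.sqrt q : ℝ) : ℂ)) 1 h2)
  have hz : layerDeg 0 (d : ℤ) + layerDeg 1 (e : ℤ) = ((d : ℤ), (e : ℤ)) := by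
    simp [layerDeg]
  rwa [hz] at h

/-- Pairs of partitions. -/
abbrev PartitionPair : Type := (Σ d : ℕ, d.Partition) × (Σ e : ℕ, e.Partition)

/-- The bi-Jack basis is homogeneous, so projecting the expansion of v to its bidegree keeps some
basis vectors and deletes the others. -/
theorem mem_span_of_mem_biDeg {p q : ℝ} (hp : 0 < p) (hq : 0 < q) {d e : ℕ} {v : Fock}
    (hv : v ∈ biDeg ((d : ℤ), (e : ℤ))) :
    v ∈ Submodule.span ℂ (biJackBasis hp hq '' {s | s.1.1 = d ∧ s.2.1 = e}) := by
  have key : ⊤ ≤ (Submodule.span ℂ (biJackBasis hp hq '' {s | s.1.1 = d ∧ s.2.1 = e})).comap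
      (weightedHomogeneousComponent biWeight ((d : ℤ), (e : ℤ))) := by
    rw [← (biJackBasis hp hq).span_eq, Submodule.span_le]
    rintro _ ⟨s, rfl⟩
    have hs : biJackBasis hp hq s ∈ biDeg ((s.1.1 : ℤ), (s.2.1 : ℤ)) := by
      rw [biJackBasis_apply]
      exact biJack_mem hp hq _ _
    classical
    rw [SetLike.mem_coe, Submodule.mem_comap, weightedHomogeneousComponent_of_mem hs]
    split_ifs with h
    · have h1 : (d : ℤ) = s.1.1 := congrArg Prod.fst h
      have h2 : (e : ℤ) = s.2.1 := congrArg Prod.snd h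
      exact Submodule.subset_span ⟨s, ⟨by exact_mod_cast h1.symm, by exact_mod_cast h2.symm⟩, rfl⟩
    · exact zero_mem _
  have h := key (Submodule.mem_top (x := v))
  rw [Submodule.mem_comap, IsWeightedHomogeneous.weightedHomogeneousComponent_same hv] at h
  exact h

/-- The pairs of partitions with at least `j` boxes moved from layer 2 to layer 1. -/
def movedPairs (d e j : ℕ) : Set PartitionPair :=
  {s | ∃ k, j ≤ k ∧ s.1.1 = d + k ∧ s.2.1 + k = e}

/-- The span of the bi-Jack states with at least `j` boxes moved from layer 2 to layer 1. -/
def movedFrom {p q : ℝ} (hp : 0 < p) (hq : 0 < q) (d e j : ℕ) : Submodule ℂ Fock :=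
  Submodule.span ℂ (biJackBasis hp hq '' movedPairs d e j)

section Moved

variable {p q : ℝ} (hp : 0 < p) (hq : 0 < q) (d e : ℕ)

theorem movedSpan_eq : movedSpan p q d e = movedFrom hp hq d e 1 := by
  refine congrArg _ (Set.ext fun f => ⟨?_, ?_⟩)
  · rintro ⟨k, d', e', lam', mu', hk, hd, he, rfl⟩
    exact ⟨(⟨d', lam'⟩, ⟨e', mu'⟩), ⟨k, hk, hd, he⟩, biJackBasis_apply hp hq _⟩
  · rintro ⟨s, ⟨k, hk, hd, he⟩, rfl⟩
    exact ⟨k, _, _, s.1.2, s.2.2, hk, hd, he, biJackBasis_apply hp hq _⟩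

theorem movedFrom_anti {i j : ℕ} (hij : i ≤ j) : movedFrom hp hq d e j ≤ movedFrom hp hq d e i :=
  Submodule.span_mono (Set.image_mono fun _ ⟨k, hk, h⟩ => ⟨k, hij.trans hk, h⟩)

theorem movedFrom_eq_bot : movedFrom hp hq d e (e + 1) = ⊥ := by
  have : movedPairs d e (e + 1) = ∅ := Set.eq_empty_of_forall_notMem fun s ⟨k, hk, _, he⟩ => by
    omega
  rw [movedFrom, this, Set.image_empty, Submodule.span_empty]

theorem biDeg_le_movedFrom {j : ℕ} {v : Fock} {x : ℤ × ℤ} (hv : v ∈ biDeg x) {m : ℕ} (hjm : j ≤ m)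
    (h1 : x.1 = d + m) (h2 : x.2 = e - m) : v ∈ movedFrom hp hq d e j := by
  by_cases hm : m ≤ e
  · have hx : x = (((d + m : ℕ) : ℤ), ((e - m : ℕ) : ℤ)) := by
      refine Prod.ext ?_ ?_
      · rw [h1]; push_cast; rfl
      · rw [h2, Nat.cast_sub hm]
    rw [hx] at hv
    refine Submodule.span_mono (Set.image_mono ?_) (mem_span_of_mem_biDeg hp hq hv)
    rintro s ⟨hd, he⟩
    exact ⟨m, hjm, hd, by omega⟩
  · rw [eq_zero_of_mem_biDeg (by omega) hv]
    exact zero_mem _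

/-- In each cubic term the layer-2 modes have total index m > 0 and the layer-1 modes total -m, so
exactly m boxes change layers. If layer 2 has too few boxes the term vanishes. -/
theorem interaction_mem (r : ℝ) {j : ℕ} {v : Fock} (hv : v ∈ movedFrom hp hq d e j) :
    interaction bose p q r v ∈ movedFrom hp hq d e (j + 1) := by
  obtain ⟨L, hL⟩ := exists_linear_interaction p q r
  rw [← hL]
  suffices h : movedFrom hp hq d e j ≤ (movedFrom hp hq d e (j + 1)).comap L from h hv
  refine Submodule.span_le.2 ?_
  rintro _ ⟨s, ⟨k, hk, hd, he⟩, rfl⟩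
  have hs := biJack_mem hp hq s.1.2 s.2.2
  rw [SetLike.mem_coe, Submodule.mem_comap, biJackBasis_apply, hL]
  refine add_mem (Submodule.smul_mem _ _ (finsum_induction (· ∈ movedFrom hp hq d e (j + 1))
      (zero_mem _) (fun _ _ => add_mem) fun t => ?_))
    (neg_mem (Submodule.smul_mem _ _ (finsum_induction (· ∈ movedFrom hp hq d e (j + 1))
      (zero_mem _) (fun _ _ => add_mem) fun t => ?_)))
  · have hm := t.2.pos
    refine biDeg_le_movedFrom hp hq d e (bose_mem (bose_mem (bose_mem hs 1 _) 0 _) 0 _)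
      (m := k + t.2) (by omega) ?_ ?_
    · simp [layerDeg]
      omega
    · simp [layerDeg]
      omega
  · have hm := t.2.pos
    refine biDeg_le_movedFrom hp hq d e (bose_mem (bose_mem (bose_mem hs 1 _) 1 _) 0 _)
      (m := k + t.2) (by omega) ?_ ?_
    · simp [layerDeg]
      omega
    · simp [layerDeg]
      omega

end Moved

theorem biJack_mem_movedFrom {p q : ℝ} (hp : 0 < p) (hq : 0 < q) {d e : ℕ} (lam : d.Partition)
    (mu : e.Partition) : biJack p q lam mu ∈ movedFrom hp hq d e 0 :=
  Submodule.subset_span ⟨(⟨d, lam⟩, ⟨e, mu⟩), ⟨0, le_rfl, rfl, rfl⟩, biJackBasis_apply hp hq _⟩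

theorem biJack_notMem_movedFrom {p q : ℝ} (hp : 0 < p) (hq : 0 < q) {d e : ℕ} (lam : d.Partition)
    (mu : e.Partition) : biJack p q lam mu ∉ movedFrom hp hq d e 1 := by
  intro h
  have hb : biJackBasis hp hq (⟨d, lam⟩, ⟨e, mu⟩) = biJack p q lam mu := biJackBasis_apply hp hq _
  rw [← hb, movedFrom, Module.Basis.mem_span_image, Module.Basis.repr_self] at h
  have hmem : ((⟨d, lam⟩, ⟨e, mu⟩) : PartitionPair) ∈ (Finsupp.single
      ((⟨d, lam⟩, ⟨e, mu⟩) : PartitionPair) (1 : ℂ)).support := by simp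
  obtain ⟨k, hk, hd, -⟩ := h hmem
  dsimp only at hd
  omega

theorem interaction_biJack_mem {p q : ℝ} (hp : 0 < p) (hq : 0 < q) (r : ℝ) {d e : ℕ}
    (lam : d.Partition) (mu : e.Partition) :
    interaction bose p q r (biJack p q lam mu) ∈ movedSpan p q d e := by
  rw [movedSpan_eq hp hq]
  exact interaction_mem hp hq d e r (biJack_mem_movedFrom hp hq lam mu)

/-! ### The resolvent -/

section Resolvent

variable {p q : ℝ} (hp : 0 < p) (hq : 0 < q) {d e : ℕ} (lam : d.Partition) (mu : e.Partition)

/-- The resolvent of the two Laughlin Hamiltonians at `E_{λ,μ}`. -/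
def resolvent : Module.End ℂ Fock :=
  (biJackBasis hp hq).constr ℂ fun s =>
    ((energy p q lam mu : ℂ) - energy p q s.1.2 s.2.2)⁻¹ • biJackBasis hp hq s

theorem resolvent_basis (s : PartitionPair) : resolvent hp hq lam mu (biJackBasis hp hq s)
    = ((energy p q lam mu : ℂ) - energy p q s.1.2 s.2.2)⁻¹ • biJackBasis hp hq s :=
  (biJackBasis hp hq).constr_basis ℂ _ s

theorem map_movedFrom_le (L : Module.End ℂ Fock)
    (hL : ∀ s, ∃ c : ℂ, L (biJackBasis hp hq s) = c • biJackBasis hp hq s) (j : ℕ) {v : Fock}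
    (hv : v ∈ movedFrom hp hq d e j) : L v ∈ movedFrom hp hq d e j := by
  suffices h : movedFrom hp hq d e j ≤ (movedFrom hp hq d e j).comap L from h hv
  refine Submodule.span_le.2 ?_
  rintro _ ⟨s, hs, rfl⟩
  obtain ⟨c, hc⟩ := hL s
  rw [SetLike.mem_coe, Submodule.mem_comap, hc]
  exact Submodule.smul_mem _ _ (Submodule.subset_span ⟨s, hs, rfl⟩)

theorem resolvent_mem {j : ℕ} {v : Fock} (hv : v ∈ movedFrom hp hq d e j) :
    resolvent hp hq lam mu v ∈ movedFrom hp hq d e j :=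
  map_movedFrom_le hp hq _ (fun s => ⟨_, resolvent_basis hp hq lam mu s⟩) j hv

theorem exists_linear_energy_sub : ∃ T : Module.End ℂ Fock,
    (∀ u, T u = (energy p q lam mu : ℂ) • u - freeHam p q u) ∧
    ∀ s, T (biJackBasis hp hq s)
      = ((energy p q lam mu : ℂ) - energy p q s.1.2 s.2.2) • biJackBasis hp hq s := by
  obtain ⟨L, hL⟩ := exists_linear_freeHam p q
  have hT : ∀ u, ((energy p q lam mu : ℂ) • (1 : Module.End ℂ Fock) - L) u
      = (energy p q lam mu : ℂ) • u - freeHam p q u := fun u => by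
    rw [LinearMap.sub_apply, hL]
    rfl
  refine ⟨_, hT, fun s => ?_⟩
  rw [hT, biJackBasis_apply, freeHam_biJack hp hq, sub_smul]

variable {lam mu}

theorem energy_sub_ne_zero (h : NonResonant p q lam mu) {s : PartitionPair}
    (hs : s ∈ movedPairs d e 1) : (energy p q lam mu : ℂ) - energy p q s.1.2 s.2.2 ≠ 0 := by
  obtain ⟨k, hk, hd, he⟩ := hs
  rw [sub_ne_zero]
  exact_mod_cast (h k _ _ s.1.2 s.2.2 hk hd he).symm

theorem energy_sub_resolvent (h : NonResonant p q lam mu) {v : Fock}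
    (hv : v ∈ movedFrom hp hq d e 1) : (energy p q lam mu : ℂ) • resolvent hp hq lam mu v
      - freeHam p q (resolvent hp hq lam mu v) = v := by
  obtain ⟨T, hT, hTb⟩ := exists_linear_energy_sub hp hq lam mu
  rw [← hT]
  have key : Set.EqOn (T ∘ₗ resolvent hp hq lam mu) (LinearMap.id : Module.End ℂ Fock)
      (biJackBasis hp hq '' movedPairs d e 1) := by
    rintro _ ⟨s, hs, rfl⟩
    rw [LinearMap.comp_apply, LinearMap.id_apply, resolvent_basis, map_smul, hTb, smul_smul, inv_mul_cancel₀ (energy_sub_ne_zero h hs),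
      one_smul]
  have h1 := LinearMap.eqOn_span key hv
  rwa [LinearMap.comp_apply, LinearMap.id_apply] at h1

theorem resolvent_energy_sub (h : NonResonant p q lam mu) {v : Fock}
    (hv : v ∈ movedFrom hp hq d e 1) :
    resolvent hp hq lam mu ((energy p q lam mu : ℂ) • v - freeHam p q v) = v := by
  obtain ⟨T, hT, hTb⟩ := exists_linear_energy_sub hp hq lam mu
  rw [← hT]
  have key : Set.EqOn (resolvent hp hq lam mu ∘ₗ T) (LinearMap.id : Module.End ℂ Fock)
      (biJackBasis hp hq '' movedPairs d e 1) := by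
    rintro _ ⟨s, hs, rfl⟩
    rw [LinearMap.comp_apply, LinearMap.id_apply, hTb, map_smul, resolvent_basis, smul_smul, mul_inv_cancel₀ (energy_sub_ne_zero h hs),
      one_smul]
  have h1 := LinearMap.eqOn_span key hv
  rwa [LinearMap.comp_apply, LinearMap.id_apply] at h1

theorem bijOn_energy_sub (hp : 0 < p) (hq : 0 < q) (h : NonResonant p q lam mu) :
    Set.BijOn (fun u => (energy p q lam mu : ℂ) • u - freeHam p q u)
      (movedSpan p q d e) (movedSpan p q d e) := by
  rw [movedSpan_eq hp hq]
  obtain ⟨T, hT, hTb⟩ := exists_linear_energy_sub hp hq lam mu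
  refine Set.InvOn.bijOn (f' := resolvent hp hq lam mu)
    ⟨fun v hv => resolvent_energy_sub hp hq h hv, fun v hv => energy_sub_resolvent hp hq h hv⟩
    (fun v hv => ?_) fun v hv => resolvent_mem hp hq lam mu hv
  change _ - _ ∈ movedFrom hp hq d e 1
  rw [← hT]
  exact map_movedFrom_le hp hq T (fun s => ⟨_, hTb s⟩) 1 hv

/-- The preimage chosen by `Function.invFunOn` lies in the moved span, where E - H_0 is injective,
so it coincides with the value of the linear resolvent. -/
theorem dressing_eq (h : NonResonant p q lam mu) (r : ℝ) {v : Fock}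
    (hv : v ∈ movedFrom hp hq d e 0) :
    dressing p q r lam mu v = resolvent hp hq lam mu (interaction bose p q r v) := by
  have hmem := interaction_mem hp hq d e r hv
  have hex : ∃ u ∈ (movedSpan p q d e : Set Fock),
      (energy p q lam mu : ℂ) • u - freeHam p q u = interaction bose p q r v := by
    refine ⟨_, ?_, energy_sub_resolvent hp hq h hmem⟩
    rw [movedSpan_eq hp hq]
    exact resolvent_mem hp hq lam mu hmem
  have h1 := Function.invFunOn_mem hex
  have h2 := Function.invFunOn_eq hex
  have h3 := resolvent_energy_sub hp hq h (v := dressing p q r lam mu v) (by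
    rw [← movedSpan_eq hp hq]
    exact h1)
  rw [← h3]
  exact congrArg _ h2

/-- The resolvent formula: the dressed state solves the fixed point equation uniquely, and is a
nonzero eigenvector. -/
theorem dressedState_spec (hp : 0 < p) (hq : 0 < q) (h : NonResonant p q lam mu) (r : ℝ) :
    (∀ Ω : Fock, (Ω - biJack p q lam mu ∈ movedSpan p q d e ∧
        Ω - dressing p q r lam mu Ω = biJack p q lam mu) ↔ Ω = dressedState p q r lam mu) ∧
      dressedState p q r lam mu ≠ 0 ∧
      halperinHam p q r (dressedState p q r lam mu)
        = (energy p q lam mu : ℂ) • dressedState p q r lam mu := by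
  obtain ⟨L, hL⟩ := exists_linear_interaction p q r
  obtain ⟨T, hT, hTb⟩ := exists_linear_energy_sub hp hq lam mu
  set G : Module.End ℂ Fock := resolvent hp hq lam mu * L with hG
  set b := biJack p q lam mu with hb
  have hb0 : b ∈ movedFrom hp hq d e 0 := biJack_mem_movedFrom hp hq lam mu
  have hGv : ∀ v ∈ movedFrom hp hq d e 0, dressing p q r lam mu v = G v := fun v hv => by
    rw [dressing_eq hp hq h r hv, ← hL]
    rfl
  have hGmem : ∀ j, ∀ v ∈ movedFrom hp hq d e j, G v ∈ movedFrom hp hq d e (j + 1) :=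
    fun j v hv => by
      change resolvent hp hq lam mu (L v) ∈ _
      rw [hL]
      exact resolvent_mem hp hq lam mu (interaction_mem hp hq d e r hv)
  have hpow : ∀ k j, ∀ v ∈ movedFrom hp hq d e j, (G ^ k) v ∈ movedFrom hp hq d e (j + k) := by
    intro k
    induction k with
    | zero => exact fun j v hv => hv
    | succ k ih =>
      intro j v hv
      rw [pow_succ', Module.End.mul_apply, ← add_assoc]
      exact hGmem _ _ (ih j v hv)
  -- Each application of G moves at least one more box, and layer 2 has only e of them.
  have hlast : ∀ v ∈ movedFrom hp hq d e 0, (G ^ (e + 1)) v = 0 := fun v hv => by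
    have := hpow (e + 1) 0 v hv
    rwa [zero_add, movedFrom_eq_bot, Submodule.mem_bot] at this
  have hit : ∀ k, (dressing p q r lam mu)^[k] b = (G ^ k) b := by
    intro k
    induction k with
    | zero => rfl
    | succ k ih =>
      rw [Function.iterate_succ_apply', ih, pow_succ', Module.End.mul_apply]
      exact hGv _ (movedFrom_anti hp hq d e (Nat.zero_le _) (hpow k 0 b hb0))
  have hΩ : dressedState p q r lam mu = (∑ k ∈ Finset.range (e + 1), G ^ k) b := by
    rw [dressedState, LinearMap.sum_apply]
    exact Finset.sum_congr rfl fun k _ => hit k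
  set Ω₀ := dressedState p q r lam mu
  have hfix : Ω₀ - G Ω₀ = b := by
    have h1 := LinearMap.congr_fun (mul_neg_geom_sum G (e + 1)) b
    rw [Module.End.mul_apply, ← hΩ, LinearMap.sub_apply, LinearMap.sub_apply, hlast b hb0,
      Module.End.one_apply, Module.End.one_apply, sub_zero] at h1
    exact h1
  have hΩ0 : Ω₀ ∈ movedFrom hp hq d e 0 := by
    rw [hΩ, LinearMap.sum_apply]
    exact sum_mem fun k _ => movedFrom_anti hp hq d e (Nat.zero_le _) (hpow k 0 b hb0)
  have hdiff : Ω₀ - b = G Ω₀ := by rw [← hfix]; abel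
  have hmem1 : Ω₀ - b ∈ movedFrom hp hq d e 1 := hdiff ▸ hGmem 0 _ hΩ0
  refine ⟨fun Ω => ⟨fun ⟨h1, h2⟩ => ?_, ?_⟩, ?_, ?_⟩
  · rw [movedSpan_eq hp hq] at h1
    have h3 : Ω ∈ movedFrom hp hq d e 0 := by
      have := add_mem (movedFrom_anti hp hq d e zero_le_one h1) hb0
      rwa [sub_add_cancel] at this
    rw [hGv Ω h3] at h2
    -- Two solutions differ by a fixed vector of G, and G is nilpotent.
    have h4 : G (Ω - Ω₀) = Ω - Ω₀ := by
      rw [map_sub, ← sub_eq_zero]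
      have := h2.trans hfix.symm
      rw [← sub_eq_zero] at this
      rw [← neg_eq_zero, ← this]
      abel
    have h5 : ∀ k, (G ^ k) (Ω - Ω₀) = Ω - Ω₀ := by
      intro k
      induction k with
      | zero => rfl
      | succ k ih => rw [pow_succ, Module.End.mul_apply, h4, ih]
    have h6 := hlast _ (sub_mem h3 hΩ0)
    rw [h5] at h6
    exact sub_eq_zero.1 h6
  · rintro rfl
    rw [movedSpan_eq hp hq, hGv _ hΩ0]
    exact ⟨hmem1, hfix⟩
  · intro h0
    rw [h0, zero_sub] at hmem1
    exact biJack_notMem_movedFrom hp hq lam mu (neg_mem_iff.1 hmem1)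
  -- Since T = E - H_0 kills b, T Ω₀ = T (Ω₀ - b) = T G Ω₀ = H_int Ω₀, which is the eigenvalue
  -- equation.
  · have h1 : T b = 0 := by
      rw [hT, hb, freeHam_biJack hp hq, sub_self]
    have h2 := energy_sub_resolvent hp hq h (interaction_mem hp hq d e r hΩ0)
    rw [← hT, ← hL, ← Module.End.mul_apply (resolvent hp hq lam mu) L, ← hG,
      ← hdiff, map_sub, h1, sub_zero, hT, hL] at h2
    rw [halperinHam, ← h2, add_sub_cancel]

end Resolvent

end Halperin

end

theorem mainTheorem7 (p q r : ℝ) (hp : 0 < p) (hq : 0 < q) :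
    -- the Hamiltonian built from the ground state, with its ground state removed
    (∀ (N M : ℕ) (U : Set (Fin N ⊕ Fin M → ℂ)) (Ψ f : (Fin N ⊕ Fin M → ℂ) → ℂ),
      IsOpen U → Halperin.IsHalperinState (p / 2) (q / 2) r U Ψ → DifferentiableOn ℂ f U →
      ∀ Z ∈ U, Halperin.excitationHam Ψ f Z = Halperin.diffHam p q r N M f Z) ∧
    -- its bosonic form
    Halperin.IsBosonicForm p q (Halperin.diffHam p q r)
      (fun N M v => Halperin.laughlinHam Halperin.bose p 0 v
        + Halperin.laughlinHam Halperin.bose q 1 v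
        + Halperin.interaction Halperin.bose p q r v
        + Halperin.background p q r N M v) ∧
    -- the second form of the interaction
    (∀ v : Halperin.Fock, Halperin.interaction Halperin.bose p q r v =
      (r : ℂ) • ((2 / ((Real.sqrt q : ℝ) : ℂ)) •
          ∑ᶠ m : ℕ+, Halperin.virasoro Halperin.bose 0 (-m) (Halperin.bose 1 m v)
        + ∑ᶠ t : ℕ+ × ℕ+,
          ((1 / ((Real.sqrt q : ℝ) : ℂ)) •
              Halperin.bose 0 (-t.1) (Halperin.bose 0 (-t.2) (Halperin.bose 1 (t.1 + t.2) v))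
            - (2 / ((Real.sqrt p : ℝ) : ℂ)) •
              Halperin.bose 1 (-t.1) (Halperin.bose 0 (-t.2)
                (Halperin.bose 1 (t.1 + t.2) v))))) ∧
    -- the fermionized interaction
    (∀ (I J : Fin 2) (n m : ℤ) (v : Halperin.Fermi),
      Halperin.current I n (Halperin.current J m v) - Halperin.current J m (Halperin.current I n v)
        = if I = J ∧ n + m = 0 then (n : ℂ) • v else 0) ∧
    (∃ Φ : Halperin.Fock →ₗ[ℂ] Halperin.Fermi, Function.Injective Φ ∧ Φ 1 = 1 ∧
      (∀ I n v, Φ (Halperin.bose I n v) = Halperin.current I n (Φ v)) ∧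
      ∀ v, Φ (Halperin.interaction Halperin.bose p q r v) =
        Halperin.fermiInt1 q r (Φ v) + Halperin.fermiInt2 p r (Φ v)) ∧
    (∀ v, Halperin.int1 Halperin.current q r v = Halperin.fermiInt1 q r v) ∧
    (∀ v, Halperin.int2 Halperin.current p r v = Halperin.fermiInt2 p r v) ∧
    -- the bi-Jack states
    (∀ (α : ℝ) (n : ℕ) (lam : n.Partition), 0 < α → ∃! P, Halperin.IsJack (α : ℂ) lam P) ∧
    (LinearIndependent ℂ (fun s : (Σ d : ℕ, d.Partition) × (Σ e : ℕ, e.Partition) =>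
        Halperin.biJack p q s.1.2 s.2.2) ∧
      Submodule.span ℂ (Set.range fun s : (Σ d : ℕ, d.Partition) × (Σ e : ℕ, e.Partition) =>
        Halperin.biJack p q s.1.2 s.2.2) = ⊤) ∧
    ∀ (d e : ℕ) (lam : d.Partition) (mu : e.Partition),
      Halperin.freeHam p q (Halperin.biJack p q lam mu) =
          (Halperin.energy p q lam mu : ℂ) • Halperin.biJack p q lam mu ∧
      -- triangularity
      Halperin.interaction Halperin.bose p q r (Halperin.biJack p q lam mu)
          ∈ Halperin.movedSpan p q d e ∧
      -- the resolvent formula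
      (Halperin.NonResonant p q lam mu →
        Set.BijOn (fun u => (Halperin.energy p q lam mu : ℂ) • u - Halperin.freeHam p q u)
          (Halperin.movedSpan p q d e) (Halperin.movedSpan p q d e) ∧
        (∀ Ω : Halperin.Fock,
          (Ω - Halperin.biJack p q lam mu ∈ Halperin.movedSpan p q d e ∧
            Ω - Halperin.dressing p q r lam mu Ω = Halperin.biJack p q lam mu) ↔
          Ω = Halperin.dressedState p q r lam mu) ∧
        Halperin.dressedState p q r lam mu ≠ 0 ∧
        Halperin.halperinHam p q r (Halperin.dressedState p q r lam mu) =
          (Halperin.energy p q lam mu : ℂ) • Halperin.dressedState p q r lam mu) := by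
  refine ⟨fun N M U Ψ f hU h hf Z hZ => Halperin.excitationHam_halperin hU h hf hZ,
    Halperin.isBosonicForm r hp hq,
    (Halperin.isHeisenberg_mode 0).interaction_eq Halperin.bose_zero p q r,
    Halperin.current_comm, Halperin.exists_fermionization p q r, Halperin.int1_current q r,
    Halperin.int2_current p r, fun α n lam hα => Halperin.existsUnique_isJack hα lam,
    ⟨Halperin.linearIndependent_biJack hp hq, Halperin.span_biJack hp hq⟩,
    fun d e lam mu => ⟨Halperin.freeHam_biJack hp hq lam mu,
      Halperin.interaction_biJack_mem hp hq r lam mu, fun h =>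
      ⟨Halperin.bijOn_energy_sub hp hq h, Halperin.dressedState_spec hp hq h r⟩⟩⟩
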